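/- Let $n\ge 1$, $Q:=2n+2$, and let $\mathbf H^n=\mathbf R^n\times\mathbf R^n\times\mathbf R$ be the Heisenberg group, with points $\xi=(x,y,t)$, $z=x+iy$, $|z|^2=\sum_i(x_i^2+y_i^2)$, $|\xi|_H^4=|z|^4+t^2$, and group law $$\hat\xi\circ\xi=\Big(\hat x+x,\ \hat y+y,\ \hat t+t+2\sum_{i=1}^n(\hat y_i x_i-\hat x_i y_i)\Big).$$ Let $X_j=\partial_{x_j}+2y_j\partial_t$, $Y_j=\partial_{y_j}-2x_j\partial_t$ ($1\le j\le n$) be the corresponding left invariant horizontal vector fields, and write $(Z_1,\dots,Z_{2n})=(X_1,\dots,X_n,Y_1,\dots,Y_n)$. For a $C^2$ function $u$ put $\nabla_Hu=(Z_1u,\dots,Z_{2n}u)$, let $\nabla_H^2u$ be the $2n\times 2n$ matrix with entry $Z_bZ_au$ in row $a$ and column $b$, and let $\nabla^2_{H,s}u=\frac12(\nabla_H^2u+(\nabla_H^2u)^T)$. Put $$G=\begin{pmatrix}I_n&0\\0&-I_n\end{pmatrix},\qquad J=\begin{pmatrix}0&I_n\\-I_n&0\end{pmatrix},$$ let $\mathcal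 S^{2n\times 2n}$ be the space of real symmetric $2n\times2n$ matrices, and let $\mathcal S^{2n\times 2n}\oplus J\mathbf R$ be the space of the matrices $S+cJ$ with $S\in\mathcal S^{2n\times2n}$, $c\in\mathbf R$; it contains all values of $\nabla_H^2u$. The CR maps are the elements of the group of bijections of $\mathbf H^n\cup\{\infty\}$ generated by the left translations $\xi\mapsto\hat\xi\circ\xi$ ($\hat\xi\in\mathbf H^n$), the dilations $(x,y,t)\mapsto(\lambda x,\lambda y,\lambda^2t)$ ($\lambda>0$), the rotations $(z,t)\mapsto(Mz,t)$ ($M\in\mathcal U(n)$), the inversion $(x,y,t)\mapsto(x,-y,-t)$ (all of these fixing $\infty$), and the CR inversion $$\varphi(x,y,t)=\Big(\frac{xt+y|z|^2}{|\xi|_H^4},\ \frac{yt-x|z|^2}{|\xi|_H^4},\ \frac{-t}{|\xi|_H^4}\Big)\quad(\xi\ne0),\qquad \varphi(0)=\infty,\quad \varphi(\infty)=0.$$ For a CR map $\psi$ and $u:\mathbf H^n\to\mathbf R$ put $$u_\psi(\xi)=|J_\psi(\xi)|^{\frac{Q-2}{2Q}}\,u(\psi(\xi))\qquad(\psi(\xi)\neq\infty),$$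 where $|J_\psi|$ is the absolute value of the Jacobian determinant of $\psi$. Let $F:\mathbf H^n\times\mathbf R^+\times\mathbf R^{2n}\times(\mathcal S^{2n\times2n}\oplus J\mathbf R)\to\mathbf R$ be continuous, where $\mathbf R^+=(0,\infty)$. The operator $F(\cdot,u,\nabla_Hu,\nabla_H^2u)$ is called CR invariant if for every positive $u\in C^2(\mathbf H^n)$, every CR map $\psi$ and every $\xi\in\mathbf H^n$ with $\psi(\xi)\ne\infty$, $$F(\xi,u_\psi(\xi),\nabla_Hu_\psi(\xi),\nabla^2_Hu_\psi(\xi))=F(\psi(\xi),u(\psi(\xi)),\nabla_Hu(\psi(\xi)),\nabla^2_Hu(\psi(\xi))).$$ **Theorem.** The operator $F(\cdot,u,\nabla_Hu,\nabla^2_Hu)$ is CR invariant if and only if for every positive $u\in C^2(\mathbf H^n)$ and every $\xi\in\mathbf H^n$ $$F(\xi,u(\xi),\nabla_Hu(\xi),\nabla^2_Hu(\xi))=F\Big(0,1,0,-\frac{Q-2}{2}A^u(\xi)\Big),$$ where $$A^u=-\frac{2}{Q-2}u^{-\frac{Q+2}{Q-2}}\nabla^2_{H,s}u+\frac{2Q}{(Q-2)^2}u^{-\frac{2Q}{Q-2}}\nabla_Hu\otimes\nabla_Hu-\frac{4}{(Q-2)^2}u^{-\frac{2Q}{Q-2}}J\nabla_Hu\otimes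 J\nabla_Hu-\frac{2}{(Q-2)^2}u^{-\frac{2Q}{Q-2}}|\nabla_Hu|^2I_{2n},$$ and moreover for every $A\in\mathcal S^{2n\times2n}\oplus J\mathbf R$ 1. $F(0,1,0,A)=F(0,1,0,\widetilde M^TA\widetilde M)$ for every unitary $M=B+iC\in\mathcal U(n)$ ($B,C$ real), where $\widetilde M=\begin{pmatrix}B&-C\\C&B\end{pmatrix}$; 2. $F(0,1,0,A)=F(0,1,0,GAG)$; 3. $F(0,1,0,A)=F(0,1,0,A+\alpha J)$ for every $\alpha\in\mathbf R$. -/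

import Mathlib

namespace HeisenbergCR

/-- The underlying space `ℝⁿ × ℝⁿ × ℝ` of the Heisenberg group, with points `ξ = (x, y, t)`.
It carries its usual structure of a finite dimensional real vector space, which is what
derivatives, Jacobians and `C²` refer to; the group law is `op` below. -/
abbrev Heis (n : ℕ) : Type := (Fin n → ℝ) × (Fin n → ℝ) × ℝ

/-- Indices `1, …, 2n` of horizontal directions: `inl j` for `X_j`, `inr j` for `Y_j`. -/
abbrev Idx (n : ℕ) : Type := Fin n ⊕ Fin n

/-- Real `2n × 2n` matrices. -/
abbrev Mat (n : ℕ) : Type := Matrix (Idx n) (Idx n) ℝ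

/-- The homogeneous dimension `Q = 2n + 2`. -/
def hdim (n : ℕ) : ℝ := 2 * n + 2

/-! ## The group law and the maps generating the CR maps -/

/-- The Heisenberg group law, for which the fields `X_j = ∂_{x_j} + 2 y_j ∂_t` and
`Y_j = ∂_{y_j} - 2 x_j ∂_t` are left invariant. -/
def op {n : ℕ} (a b : Heis n) : Heis n :=
  (a.1 + b.1, a.2.1 + b.2.1, a.2.2 + b.2.2 + 2 * ∑ i, (a.2.1 i * b.1 i - a.1 i * b.2.1 i))

/-- `|z|² = ∑ (x_i² + y_i²)`. -/
def zsq {n : ℕ} (p : Heis n) : ℝ := ∑ i, (p.1 i ^ 2 + p.2.1 i ^ 2)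

/-- The fourth power `|z|⁴ + t²` of the homogeneous norm. -/
def gauge4 {n : ℕ} (p : Heis n) : ℝ := zsq p ^ 2 + p.2.2 ^ 2

/-- The complex coordinate `z = x + i y`. -/
def zc {n : ℕ} (p : Heis n) : Fin n → ℂ := fun i => ⟨p.1 i, p.2.1 i⟩

/-- The left translation `ξ ↦ a ∘ ξ`. -/
def translation {n : ℕ} (a : Heis n) : Heis n ≃ Heis n where
  toFun := op a
  invFun := op (-a)
  left_inv p := by
    have h : ∀ i, a.2.1 i * p.1 i - a.1 i * p.2.1 i +
        (-a.2.1 i * (a.1 i + p.1 i) - -a.1 i * (a.2.1 i + p.2.1 i)) = 0 := fun i => by ring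
    refine Prod.ext ?_ (Prod.ext ?_ ?_)
    · simp [op]
    · simp [op]
    · have := Finset.sum_congr (rfl : (Finset.univ : Finset (Fin n)) = _) (fun i _ => h i)
      rw [Finset.sum_add_distrib] at this
      simp [op] at this ⊢
      linarith
  right_inv p := by
    have h : ∀ i, (-a.2.1 i * p.1 i - -a.1 i * p.2.1 i) +
        (a.2.1 i * (-a.1 i + p.1 i) - a.1 i * (-a.2.1 i + p.2.1 i)) = 0 := fun i => by ring
    refine Prod.ext ?_ (Prod.ext ?_ ?_)
    · simp [op]
    · simp [op]
    · have := Finset.sum_congr (rfl : (Finset.univ : Finset (Fin n)) = _) (fun i _ => h i)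
      rw [Finset.sum_add_distrib] at this
      simp [op] at this ⊢
      linarith

/-- The dilation `(x, y, t) ↦ (l x, l y, l² t)`, for `l > 0`. -/
noncomputable def dilation {n : ℕ} (l : ℝ) (hl : 0 < l) : Heis n ≃ Heis n where
  toFun p := (l • p.1, l • p.2.1, l ^ 2 * p.2.2)
  invFun p := (l⁻¹ • p.1, l⁻¹ • p.2.1, l⁻¹ ^ 2 * p.2.2)
  left_inv p := by
    have := hl.ne'
    refine Prod.ext ?_ (Prod.ext ?_ ?_) <;> simp [smul_smul, this]
  right_inv p := by
    have := hl.ne'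
    refine Prod.ext ?_ (Prod.ext ?_ ?_) <;> simp [smul_smul, this]

/-- The map `(z, t) ↦ (M z, t)` for a complex matrix `M`. -/
def linAct {n : ℕ} (M : Matrix (Fin n) (Fin n) ℂ) (p : Heis n) : Heis n :=
  (fun i => (M.mulVec (zc p) i).re, fun i => (M.mulVec (zc p) i).im, p.2.2)

theorem linAct_linAct {n : ℕ} (M N : Matrix (Fin n) (Fin n) ℂ) (h : M * N = 1) (p : Heis n) :
    linAct M (linAct N p) = p := by
  have hz : zc (linAct N p) = N.mulVec (zc p) := rfl
  have hm : M.mulVec (zc (linAct N p)) = zc p := by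
    rw [hz, Matrix.mulVec_mulVec, h, Matrix.one_mulVec]
  change ((fun i => (M.mulVec (zc (linAct N p)) i).re,
    fun i => (M.mulVec (zc (linAct N p)) i).im, p.2.2) : Heis n) = p
  rw [hm]
  rfl

/-- The rotation `(z, t) ↦ (M z, t)` for a unitary matrix `M`. -/
def rotation {n : ℕ} (M : Matrix.unitaryGroup (Fin n) ℂ) : Heis n ≃ Heis n where
  toFun := linAct (M : Matrix (Fin n) (Fin n) ℂ)
  invFun := linAct (star (M : Matrix (Fin n) (Fin n) ℂ))
  left_inv := linAct_linAct _ _ (Matrix.mem_unitaryGroup_iff'.1 M.2)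
  right_inv := linAct_linAct _ _ (Matrix.mem_unitaryGroup_iff.1 M.2)

/-- The inversion `(x, y, t) ↦ (x, -y, -t)`. -/
def inversion (n : ℕ) : Heis n ≃ Heis n where
  toFun p := (p.1, -p.2.1, -p.2.2)
  invFun p := (p.1, -p.2.1, -p.2.2)
  left_inv p := by simp
  right_inv p := by simp

/-- The formula of the CR inversion at `(x, y, t) ≠ 0`. -/
noncomputable def phi {n : ℕ} (p : Heis n) : Heis n :=
  (fun i => (p.1 i * p.2.2 + p.2.1 i * zsq p) / gauge4 p,
   fun i => (p.2.1 i * p.2.2 - p.1 i * zsq p) / gauge4 p,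
   -p.2.2 / gauge4 p)

/-- The map `(x, y, t) ↦ (-x, -y, t)`. -/
def negZ {n : ℕ} (p : Heis n) : Heis n := (-p.1, -p.2.1, p.2.2)

theorem gauge4_pos {n : ℕ} {p : Heis n} (hp : p ≠ 0) : 0 < gauge4 p := by
  have h0 : 0 ≤ zsq p := Finset.sum_nonneg fun i _ => by positivity
  refine lt_of_le_of_ne (by unfold gauge4; positivity) fun h => hp ?_
  have h1 : zsq p ^ 2 = 0 := by unfold gauge4 at h; nlinarith [sq_nonneg (zsq p), sq_nonneg p.2.2]
  have h2 : p.2.2 ^ 2 = 0 := by unfold gauge4 at h; nlinarith [sq_nonneg (zsq p), sq_nonneg p.2.2]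
  have h3 : zsq p = 0 := by simpa using h1
  have h4 := (Finset.sum_eq_zero_iff_of_nonneg (fun i _ => by positivity)).1 h3
  refine Prod.ext (funext fun i => ?_) (Prod.ext (funext fun i => ?_) (by simpa using h2))
  · have := h4 i (Finset.mem_univ i)
    change p.1 i = 0
    nlinarith [sq_nonneg (p.1 i), sq_nonneg (p.2.1 i)]
  · have := h4 i (Finset.mem_univ i)
    change p.2.1 i = 0
    nlinarith [sq_nonneg (p.1 i), sq_nonneg (p.2.1 i)]

theorem zsq_phi {n : ℕ} {p : Heis n} (hp : p ≠ 0) : zsq (phi p) = zsq p / gauge4 p := by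
  have hg := (gauge4_pos hp).ne'
  have h : zsq (phi p) = ∑ i, (p.1 i ^ 2 + p.2.1 i ^ 2) * (1 / gauge4 p) := by
    refine Finset.sum_congr rfl fun i _ => ?_
    simp only [phi]
    field_simp
    unfold gauge4
    ring
  rw [h, ← Finset.sum_mul]
  change zsq p * (1 / gauge4 p) = _
  ring

theorem gauge4_phi {n : ℕ} {p : Heis n} (hp : p ≠ 0) : gauge4 (phi p) = 1 / gauge4 p := by
  have hg := (gauge4_pos hp).ne'
  have h : gauge4 (phi p) = (zsq p / gauge4 p) ^ 2 + (-p.2.2 / gauge4 p) ^ 2 := by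
    rw [← zsq_phi hp]; rfl
  rw [h]
  have h2 : gauge4 p = zsq p ^ 2 + p.2.2 ^ 2 := rfl
  field_simp
  linarith

theorem phi_ne {n : ℕ} {p : Heis n} (hp : p ≠ 0) : phi p ≠ 0 := by
  intro h
  have h1 := gauge4_phi hp
  have h2 := gauge4_pos hp
  rw [h] at h1
  have h3 : gauge4 (0 : Heis n) = 0 := by simp [gauge4, zsq]
  rw [h3] at h1
  exact (one_div_pos.2 h2).ne h1

theorem phi_phi {n : ℕ} {p : Heis n} (hp : p ≠ 0) : phi (phi p) = negZ p := by
  have hg := (gauge4_pos hp).ne'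
  have e : gauge4 p = zsq p ^ 2 + p.2.2 ^ 2 := rfl
  have h : phi (phi p) =
    (fun i => ((phi p).1 i * (phi p).2.2 + (phi p).2.1 i * (zsq p / gauge4 p)) / (1 / gauge4 p),
     fun i => ((phi p).2.1 i * (phi p).2.2 - (phi p).1 i * (zsq p / gauge4 p)) / (1 / gauge4 p),
     -(phi p).2.2 / (1 / gauge4 p)) := by
    rw [← zsq_phi hp, ← gauge4_phi hp]; rfl
  rw [h]
  refine Prod.ext (funext fun i => ?_) (Prod.ext (funext fun i => ?_) ?_)
  · simp only [phi, negZ, Pi.neg_apply]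
    field_simp
    rw [e]; ring
  · simp only [phi, negZ, Pi.neg_apply]
    field_simp
    rw [e]; ring
  · simp only [phi, negZ]
    field_simp

theorem negZ_negZ {n : ℕ} (p : Heis n) : negZ (negZ p) = p := by
  simp [negZ]

theorem negZ_ne {n : ℕ} {p : Heis n} (hp : p ≠ 0) : negZ p ≠ 0 := by
  intro h
  apply hp
  rw [← negZ_negZ p, h]
  simp [negZ]

theorem phi_negZ {n : ℕ} (p : Heis n) : phi (negZ p) = negZ (phi p) := by
  have h1 : zsq (negZ p) = zsq p := by simp [zsq, negZ]
  have h2 : gauge4 (negZ p) = gauge4 p := by rw [gauge4, h1]; rfl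
  refine Prod.ext (funext fun i => ?_) (Prod.ext (funext fun i => ?_) ?_)
  · simp only [phi, h1, h2]; simp only [negZ, Pi.neg_apply]; ring
  · simp only [phi, h1, h2]; simp only [negZ, Pi.neg_apply]; ring
  · simp only [phi, h2]; simp only [negZ]

open Classical in
/-- The CR inversion as a bijection of `ℍⁿ ∪ {∞}`: it exchanges `0` and `∞` and is given by
`phi` elsewhere. -/
noncomputable def crInversion (n : ℕ) : Equiv.Perm (OnePoint (Heis n)) where
  toFun q := q.elim ((0 : Heis n) : OnePoint (Heis n))
    (fun p => if p = 0 then OnePoint.infty else ((phi p : Heis n) : OnePoint (Heis n)))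
  invFun q := q.elim ((0 : Heis n) : OnePoint (Heis n))
    (fun p => if p = 0 then OnePoint.infty else ((phi (negZ p) : Heis n) : OnePoint (Heis n)))
  left_inv q := by
    induction q using OnePoint.rec with
    | infty => simp
    | coe p =>
      by_cases hp : p = 0
      · simp [hp]
      · simp [hp, phi_ne hp, phi_negZ, phi_phi hp, negZ_negZ]
  right_inv q := by
    induction q using OnePoint.rec with
    | infty => simp
    | coe p =>
      by_cases hp : p = 0
      · simp [hp]
      · simp [hp, phi_ne (negZ_ne hp), phi_phi (negZ_ne hp), negZ_negZ]

/-- A bijection of `ℍⁿ`, extended to `ℍⁿ ∪ {∞}` by fixing `∞`. -/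
def extend {n : ℕ} (e : Heis n ≃ Heis n) : Equiv.Perm (OnePoint (Heis n)) where
  toFun := OnePoint.map e
  invFun := OnePoint.map e.symm
  left_inv q := by
    induction q using OnePoint.rec with
    | infty => simp
    | coe p => simp
  right_inv q := by
    induction q using OnePoint.rec with
    | infty => simp
    | coe p => simp

/-- The group of CR maps, acting on `ℍⁿ ∪ {∞}`: the group generated by left translations,
dilations, rotations, the inversion and the CR inversion. -/
def crGroup (n : ℕ) : Subgroup (Equiv.Perm (OnePoint (Heis n))) :=
  Subgroup.closure
    ({g | ∃ a : Heis n, g = extend (translation a)} ∪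
      {g | ∃ (l : ℝ) (hl : 0 < l), g = extend (dilation l hl)} ∪
      {g | ∃ M : Matrix.unitaryGroup (Fin n) ℂ, g = extend (rotation M)} ∪
      {extend (inversion n), crInversion n})

/-- The map of `ℍⁿ` underlying `g`, with the value `0` where `g` takes the value `∞`. -/
def finitePart {n : ℕ} (g : Equiv.Perm (OnePoint (Heis n))) (p : Heis n) : Heis n :=
  (g (p : OnePoint (Heis n))).elim 0 id

/-! ## Horizontal derivatives -/

/-- The vector fields `X_j = ∂_{x_j} + 2 y_j ∂_t` and `Y_j = ∂_{y_j} - 2 x_j ∂_t`. -/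
def hfield {n : ℕ} (a : Idx n) (p : Heis n) : Heis n :=
  match a with
  | Sum.inl j => (Pi.single j 1, 0, 2 * p.2.1 j)
  | Sum.inr j => (0, Pi.single j 1, -2 * p.1 j)

/-- The derivative of `u` along the horizontal field with index `a`. -/
noncomputable def hderiv {n : ℕ} (a : Idx n) (u : Heis n → ℝ) (p : Heis n) : ℝ :=
  fderiv ℝ u p (hfield a p)

/-- The Heisenberg gradient `(X_1 u, …, X_n u, Y_1 u, …, Y_n u)`. -/
noncomputable def grad {n : ℕ} (u : Heis n → ℝ) (p : Heis n) : Idx n → ℝ :=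
  fun a => hderiv a u p

/-- The Heisenberg Hessian: the entry in row `a` and column `b` is `Z_b Z_a u`. -/
noncomputable def hess {n : ℕ} (u : Heis n → ℝ) (p : Heis n) : Mat n :=
  Matrix.of fun a b => hderiv b (hderiv a u) p

/-- The symmetric part of the Heisenberg Hessian. -/
noncomputable def hessSym {n : ℕ} (u : Heis n → ℝ) (p : Heis n) : Mat n :=
  (1 / 2 : ℝ) • (hess u p + (hess u p).transpose)

/-- `G = diag(I, -I)`. -/
def matG (n : ℕ) : Mat n := Matrix.fromBlocks 1 0 0 (-1)

/-- `J = (0, I; -I, 0)`. -/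
def matJ (n : ℕ) : Mat n := Matrix.fromBlocks 0 1 (-1) 0

/-- The real form `(B, -C; C, B)` of `M = B + i C`. -/
def realForm {n : ℕ} (M : Matrix (Fin n) (Fin n) ℂ) : Mat n :=
  Matrix.fromBlocks (M.map Complex.re) (-M.map Complex.im) (M.map Complex.im) (M.map Complex.re)

/-- The space of matrices `S + c J` with `S` symmetric and `c` real. -/
def symJ (n : ℕ) : Set (Mat n) :=
  {A | ∃ (S : Mat n) (c : ℝ), S.IsSymm ∧ A = S + c • matJ n}

/-- The tensor `A^u`. -/
noncomputable def tensorA {n : ℕ} (u : Heis n → ℝ) (p : Heis n) : Mat n :=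
  (-(2 / (hdim n - 2)) * u p ^ (-((hdim n + 2) / (hdim n - 2)))) • hessSym u p
  + (2 * hdim n / (hdim n - 2) ^ 2 * u p ^ (-(2 * hdim n / (hdim n - 2)))) •
      Matrix.vecMulVec (grad u p) (grad u p)
  - (4 / (hdim n - 2) ^ 2 * u p ^ (-(2 * hdim n / (hdim n - 2)))) •
      Matrix.vecMulVec ((matJ n).mulVec (grad u p)) ((matJ n).mulVec (grad u p))
  - (2 / (hdim n - 2) ^ 2 * u p ^ (-(2 * hdim n / (hdim n - 2))) * ∑ a, grad u p a ^ 2) •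
      (1 : Mat n)

/-! ## CR invariance -/

/-- The transform `u_ψ = |det Dψ|^{(Q-2)/(2Q)} (u ∘ ψ)` of `u` through a map `ψ`. -/
noncomputable def transform {n : ℕ} (ψ : Heis n → Heis n) (u : Heis n → ℝ) (p : Heis n) : ℝ :=
  |(fderiv ℝ ψ p).det| ^ ((hdim n - 2) / (2 * hdim n)) * u (ψ p)

/-- The domain `ℍⁿ × ℝ⁺ × ℝ²ⁿ × (S ⊕ Jℝ)` of the operators. -/
def opDomain (n : ℕ) : Set (Heis n × ℝ × (Idx n → ℝ) × Mat n) :=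
  {q | 0 < q.2.1 ∧ q.2.2.2 ∈ symJ n}

/-- `F(ξ, u, ∇u, ∇²u)` at the point `p`. -/
noncomputable def evalOp {n : ℕ} (F : Heis n → ℝ → (Idx n → ℝ) → Mat n → ℝ)
    (u : Heis n → ℝ) (p : Heis n) : ℝ :=
  F p (u p) (grad u p) (hess u p)

/-- CR invariance: for all positive `u ∈ C²(ℍⁿ)` and all CR maps `ψ`, the operator applied to
`u_ψ` at `ξ` equals the operator applied to `u` at `ψ(ξ)`, at every `ξ` where `ψ(ξ)` is finite. -/
def IsCRInvariant {n : ℕ} (F : Heis n → ℝ → (Idx n → ℝ) → Mat n → ℝ) : Prop :=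
  ∀ u : Heis n → ℝ, ContDiff ℝ 2 u → (∀ p, 0 < u p) →
    ∀ g ∈ crGroup n, ∀ p : Heis n, g (p : OnePoint (Heis n)) ≠ OnePoint.infty →
      evalOp F (transform (finitePart g) u) p = evalOp F u (finitePart g p)

end HeisenbergCR

/-!
Put `h = u^{-1/n} = u^{-2/(Q-2)}`. In terms of `h` the tensor `A^u` is the quadratic expression
`h ∇²_s h - J∇h ⊗ J∇h - |∇h|²/2 I` (`tensorA_eq_conf`), and `u ↦ u_ψ` becomes
`h ↦ κ⁻¹ (h ∘ ψ)`, where `κ O`, with `O` orthogonal, is the derivative of `ψ` on horizontal vectors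
(`ConformalContactAt.pot_transform`). The theorem rests on the covariance
`A^{u_ψ} = Oᵀ (A^u ∘ ψ) O`.

For translations, dilations, rotations and the inversion the covariance is immediate, since these
maps send horizontal lines to horizontal lines with a constant matrix `O`
(`AffineContact.tensorA_transform`). For the CR inversion `φ` the horizontal jets are computed by
differentiating twice along the image of a horizontal line, which is a horizontal curve, so that no
`∂_t` derivative enters (`deriv_deriv_comp_horizontal`, `hasDerivAt_phi_line`). In the complex
coordinates `z` and `w = t + i|z|²`, where `φ(z, w) = (z/w, -1/w)`, the derivative is `|w|⁻¹` times
a unitary matrix, and the covariance is an identity of quadratic forms (`conf_mul_comp_phi`).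

*The formula implies invariance.* A continuous function of `A^u` that is invariant under the
matrices of rotations and of the inversion is invariant under the generators, and one has to pass to
compositions. A composition can be finite at a point that an inner factor maps to `∞`. There the
transform of `u` is nevertheless `C²`, because CR maps are (conjugate) projective in the coordinates
`(1, z, w)` (`hasLinearLift_of_mem`, `finitePart_smooth`), and the identity follows from nearby
points by continuity (`TensorInvariant.mul`). Since `u_ψ` may be defined only near the point in
question, it is extended to all of `ℍⁿ` (`exists_global_extension`).

*Invariance implies the formula.* Rotations and the inversion fix `0` and act on Hessians at `0` by
conjugation, which gives the first two invariances of `A ↦ F(0, 1, 0, A)`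
(`IsCRInvariant.conj`). A vertical translation conjugated by the CR inversion fixes `0` and, up to a
rotation, changes the jet there only in the `∂_t` derivative, that is, it adds a multiple of `J` to
the Hessian (`IsCRInvariant.sub_matJ`). Finally every jet is brought to the form `(0, 1, 0, A)`: a
CR inversion, based at a suitable point, makes the gradient vanish (`exists_critical_phi`), and a
translation and a dilation normalize the point and the value. The tensor is only rotated in the
process, and at a normalized jet `-(Q-2)/2 A^u` is the symmetrized Hessian.
-/

namespace HeisenbergCR

open Matrix ComplexConjugate Topology

/-! ### Linear algebra of horizontal vectors -/

/-- The complex vector `x + i y` of a horizontal vector `(x, y)`. -/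
def cx {n : ℕ} (v : Idx n → ℝ) : Fin n → ℂ := fun i => ⟨v (Sum.inl i), v (Sum.inr i)⟩

/-- The Hermitian product `∑ conj(a_i) b_i`, conjugate linear in the first variable. -/
noncomputable def herm {n : ℕ} (a b : Fin n → ℂ) : ℂ := ∑ i, conj (a i) * b i

theorem dot_eq_re_herm {n : ℕ} (v w : Idx n → ℝ) : v ⬝ᵥ w = (herm (cx v) (cx w)).re := by
  simp [dotProduct, herm, cx, Fintype.sum_sum_type, Finset.sum_add_distrib]

theorem herm_add_right {n : ℕ} (a b c : Fin n → ℂ) : herm a (b + c) = herm a b + herm a c := by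
  simp [herm, mul_add, Finset.sum_add_distrib]

theorem herm_smul_right {n : ℕ} (k : ℂ) (a b : Fin n → ℂ) : herm a (k • b) = k * herm a b := by
  simp only [herm, Finset.mul_sum, Pi.smul_apply, smul_eq_mul]
  exact Finset.sum_congr rfl fun i _ => by ring

theorem herm_sub_right {n : ℕ} (a b c : Fin n → ℂ) : herm a (b - c) = herm a b - herm a c := by
  simp [herm, mul_sub, Finset.sum_sub_distrib]

theorem herm_conj {n : ℕ} (a b : Fin n → ℂ) : conj (herm a b) = herm b a := by
  simp only [herm, map_sum, map_mul, Complex.conj_conj]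
  exact Finset.sum_congr rfl fun i _ => by ring

theorem herm_add_left {n : ℕ} (a b c : Fin n → ℂ) : herm (a + b) c = herm a c + herm b c := by
  simp [herm, add_mul, Finset.sum_add_distrib]

theorem herm_smul_left {n : ℕ} (k : ℂ) (a b : Fin n → ℂ) :
    herm (k • a) b = conj k * herm a b := by
  simp only [herm, Finset.mul_sum, Pi.smul_apply, smul_eq_mul, map_mul]
  exact Finset.sum_congr rfl fun i _ => by ring

theorem herm_self_im {n : ℕ} (a : Fin n → ℂ) : (herm a a).im = 0 := by
  have := herm_conj a a
  exact Complex.conj_eq_iff_im.1 this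

theorem herm_self {n : ℕ} (v : Idx n → ℝ) : herm (cx v) (cx v) = ((v ⬝ᵥ v : ℝ) : ℂ) := by
  apply Complex.ext
  · rw [dot_eq_re_herm]; simp
  · simp [herm_self_im]

theorem herm_zc_self {n : ℕ} (p : Heis n) : herm (zc p) (zc p) = (zsq p : ℂ) := by
  apply Complex.ext
  · simp [herm, zc, zsq, sq]
  · simp [herm_self_im]

theorem cx_smul {n : ℕ} (k : ℝ) (v : Idx n → ℝ) : cx (k • v) = (k : ℂ) • cx v := by
  ext i; apply Complex.ext <;> simp [cx]

theorem cx_injective {n : ℕ} : Function.Injective (cx (n := n)) := by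
  intro v w h
  ext (i | i)
  · exact congrArg Complex.re (congrFun h i)
  · exact congrArg Complex.im (congrFun h i)

/-- The real horizontal vector of a complex vector, inverse to `cx`. -/
def rv {n : ℕ} (a : Fin n → ℂ) : Idx n → ℝ := Sum.elim (fun i => (a i).re) (fun i => (a i).im)

@[simp] theorem cx_rv {n : ℕ} (a : Fin n → ℂ) : cx (rv a) = a := by
  ext i; apply Complex.ext <;> simp [cx, rv]

theorem cx_realForm {n : ℕ} (M : Matrix (Fin n) (Fin n) ℂ) (v : Idx n → ℝ) :
    cx (realForm M *ᵥ v) = M *ᵥ cx v := by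
  ext i
  apply Complex.ext
  · simp [cx, realForm, mulVec, dotProduct, Fintype.sum_sum_type, sub_eq_add_neg,
      Finset.sum_add_distrib]
  · simp [cx, realForm, mulVec, dotProduct, Fintype.sum_sum_type, Finset.sum_add_distrib]
    rw [add_comm]

theorem cx_matJ {n : ℕ} (v : Idx n → ℝ) : cx (matJ n *ᵥ v) = (-Complex.I) • cx v := by
  ext i
  apply Complex.ext <;>
  simp [cx, matJ, mulVec, dotProduct, Fintype.sum_sum_type, one_apply]

theorem realForm_mul {n : ℕ} (M N : Matrix (Fin n) (Fin n) ℂ) :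
    realForm (M * N) = realForm M * realForm N := by
  refine ext_of_mulVec_single fun a => cx_injective ?_
  rw [cx_realForm, ← mulVec_mulVec, ← mulVec_mulVec, cx_realForm, cx_realForm]

theorem realForm_one {n : ℕ} : realForm (1 : Matrix (Fin n) (Fin n) ℂ) = 1 := by
  refine ext_of_mulVec_single fun a => cx_injective ?_
  simp only [cx_realForm, one_mulVec]

theorem realForm_star {n : ℕ} (M : Matrix (Fin n) (Fin n) ℂ) :
    realForm (star M) = (realForm M)ᵀ := by
  ext (i | i) (j | j) <;> simp [realForm, star_apply]

theorem realForm_transpose_mul {n : ℕ} {M : Matrix (Fin n) (Fin n) ℂ}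
    (hM : M ∈ unitaryGroup (Fin n) ℂ) : (realForm M)ᵀ * realForm M = 1 := by
  rw [← realForm_star, ← realForm_mul, mem_unitaryGroup_iff'.1 hM, realForm_one]

theorem realForm_mul_matJ {n : ℕ} (M : Matrix (Fin n) (Fin n) ℂ) :
    realForm M * matJ n = matJ n * realForm M := by
  refine ext_of_mulVec_single fun a => cx_injective ?_
  simp only [← mulVec_mulVec, cx_realForm, cx_matJ, mulVec_smul]

theorem matJ_transpose (n : ℕ) : (matJ n)ᵀ = -matJ n := by
  simp [matJ, fromBlocks_transpose, fromBlocks_neg]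

theorem matG_transpose (n : ℕ) : (matG n)ᵀ = matG n := by
  simp [matG, fromBlocks_transpose]

theorem matG_mul_matG (n : ℕ) : matG n * matG n = 1 := by
  simp [matG, fromBlocks_multiply]

theorem matG_mul_matJ (n : ℕ) : matG n * matJ n = -(matJ n * matG n) := by
  simp [matG, matJ, fromBlocks_multiply, fromBlocks_neg]

/-- Polarization: a symmetric matrix is determined by its quadratic form. -/
theorem eq_of_quadratic_eq {ι : Type*} [Fintype ι] [DecidableEq ι] {S T : Matrix ι ι ℝ}
    (hS : S.IsSymm) (hT : T.IsSymm) (h : ∀ v, v ⬝ᵥ S *ᵥ v = v ⬝ᵥ T *ᵥ v) : S = T := by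
  have key : ∀ (R : Matrix ι ι ℝ), R.IsSymm → ∀ i j, 2 * R i j =
      (Pi.single i 1 + Pi.single j 1) ⬝ᵥ R *ᵥ (Pi.single i 1 + Pi.single j 1)
      - Pi.single i 1 ⬝ᵥ R *ᵥ Pi.single i 1 - Pi.single j 1 ⬝ᵥ R *ᵥ Pi.single j 1 := by
    intro R hR i j
    have := hR.apply i j
    simp [mulVec_add, add_dotProduct, dotProduct_add, this]
    ring
  ext i j
  have h1 := key S hS i j
  have h2 := key T hT i j
  rw [h, h, h, ← h2] at h1
  linarith

theorem mem_symJ_of_isSymm {n : ℕ} {S : Mat n} (hS : S.IsSymm) : S ∈ symJ n :=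
  ⟨S, 0, hS, by simp⟩

/-! ### Second order jets along horizontal curves -/

/-- The horizontal tangent vector at `p` whose coefficients in the frame `X_j, Y_j` are `v`. -/
def hvec {n : ℕ} (p : Heis n) (v : Idx n → ℝ) : Heis n :=
  (fun i => v (Sum.inl i), fun i => v (Sum.inr i),
    2 * ∑ i, (p.2.1 i * v (Sum.inl i) - p.1 i * v (Sum.inr i)))

/-- The horizontal line through `p` in the direction `v`. It is the left translate by `p` of a
one-parameter subgroup. -/
def line {n : ℕ} (p : Heis n) (v : Idx n → ℝ) (s : ℝ) : Heis n := p + s • hvec p v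

theorem sum_smul_hfield {n : ℕ} (p : Heis n) (v : Idx n → ℝ) :
    ∑ a, v a • hfield a p = hvec p v := by
  refine Prod.ext ?_ (Prod.ext ?_ ?_)
  · ext i
    simp [Prod.fst_sum, hfield, hvec, Fintype.sum_sum_type, Finset.sum_apply, Pi.single_apply]
  · ext i
    simp [Prod.fst_sum, Prod.snd_sum, hfield, hvec, Fintype.sum_sum_type, Finset.sum_apply,
      Pi.single_apply]
  · simp only [Prod.snd_sum, hfield, hvec, Fintype.sum_sum_type, Finset.mul_sum,
      ← Finset.sum_add_distrib]
    refine Finset.sum_congr rfl fun i _ => ?_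
    simp only [Prod.snd_add, Prod.smul_snd, smul_eq_mul]
    ring

theorem grad_dot {n : ℕ} (u : Heis n → ℝ) (p : Heis n) (v : Idx n → ℝ) :
    grad u p ⬝ᵥ v = fderiv ℝ u p (hvec p v) := by
  rw [← sum_smul_hfield, map_sum]
  simp [dotProduct, grad, hderiv, mul_comm]

theorem dot_hess {n : ℕ} (u : Heis n → ℝ) (p : Heis n) (v : Idx n → ℝ) :
    v ⬝ᵥ hess u p *ᵥ v = ∑ a, v a * fderiv ℝ (hderiv a u) p (hvec p v) := by
  simp only [← sum_smul_hfield, map_sum, dotProduct, hess, mulVec, map_smul, smul_eq_mul]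
  refine Finset.sum_congr rfl fun a _ => ?_
  congr 1
  refine Finset.sum_congr rfl fun b _ => ?_
  simp only [of_apply, hderiv]
  ring

theorem dot_hessSym {n : ℕ} (u : Heis n → ℝ) (p : Heis n) (v : Idx n → ℝ) :
    v ⬝ᵥ hessSym u p *ᵥ v = v ⬝ᵥ hess u p *ᵥ v := by
  have h : v ⬝ᵥ (hess u p)ᵀ *ᵥ v = v ⬝ᵥ hess u p *ᵥ v := by
    rw [dotProduct_mulVec, vecMul_transpose, dotProduct_comm]
  rw [hessSym, smul_mulVec, add_mulVec, dotProduct_smul, dotProduct_add, h, smul_eq_mul]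
  ring

theorem hessSym_isSymm {n : ℕ} (u : Heis n → ℝ) (p : Heis n) : (hessSym u p).IsSymm := by
  simp [hessSym, IsSymm, add_comm]

theorem contDiff_hfield {n : ℕ} (a : Idx n) {k : WithTop ℕ∞} :
    ContDiff ℝ k (hfield (n := n) a) := by
  rcases a with j | j
  · change ContDiff ℝ k fun p : Heis n => ((Pi.single j 1, 0, 2 * p.2.1 j) : Heis n)
    fun_prop
  · change ContDiff ℝ k fun p : Heis n => ((0, Pi.single j 1, -2 * p.1 j) : Heis n)
    fun_prop

theorem contDiffAt_hderiv {n : ℕ} {u : Heis n → ℝ} {p : Heis n} (hu : ContDiffAt ℝ 2 u p)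
    (a : Idx n) : ContDiffAt ℝ 1 (hderiv a u) p :=
  (hu.fderiv_right (m := 1) (by norm_num)).clm_apply (contDiff_hfield a).contDiffAt

/-- The derivative `∂_t u`. -/
noncomputable def tderiv {n : ℕ} (u : Heis n → ℝ) (p : Heis n) : ℝ := fderiv ℝ u p (0, 0, 1)

/-- The Hessian in the left invariant frame is the second derivative of `u` in the frame vectors
plus a term from the derivatives of the frame, which are multiples of `∂_t`. -/
theorem fderiv_hderiv {n : ℕ} {u : Heis n → ℝ} {p : Heis n} (hu : ContDiffAt ℝ 2 u p)
    (a b : Idx n) : hderiv b (hderiv a u) p =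
      fderiv ℝ (fderiv ℝ u) p (hfield b p) (hfield a p) + 2 * tderiv u p * matJ n a b := by
  have h1 : HasFDerivAt (fderiv ℝ u) (fderiv ℝ (fderiv ℝ u) p) p :=
    ((hu.fderiv_right (m := 1) (by norm_num)).differentiableAt (by norm_num)).hasFDerivAt
  have h2 : HasFDerivAt (hfield (n := n) a) (fderiv ℝ (hfield a) p) p :=
    ((contDiff_hfield a (k := 1)).differentiable (by norm_num) p).hasFDerivAt
  have h3 := (h1.clm_apply h2).fderiv
  have h4 : fderiv ℝ (hfield a) p (hfield b p) = (2 * matJ n a b) • ((0, 0, 1) : Heis n) := by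
    have hl : HasDerivAt (fun s : ℝ => p + s • hfield b p) (hfield b p) 0 := by
      simpa using! ((hasDerivAt_id (0 : ℝ)).smul_const (hfield b p)).const_add p
    have h5 := h2.comp_hasDerivAt_of_eq (0 : ℝ) hl (by simp)
    have key : (hfield a ∘ fun s : ℝ => p + s • hfield b p) =
        fun s => hfield a p + s • ((2 * matJ n a b) • ((0, 0, 1) : Heis n)) := by
      funext s
      rcases a with j | j <;> rcases b with k | k <;>
        refine Prod.ext ?_ (Prod.ext ?_ ?_) <;>
        simp [hfield, matJ, Pi.single_apply, one_apply] <;> split_ifs <;>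
        simp <;> ring
    rw [key] at h5
    refine h5.unique ?_
    simpa using! ((hasDerivAt_id (0 : ℝ)).smul_const
      ((2 * matJ n a b) • ((0, 0, 1) : Heis n))).const_add (hfield a p)
  change fderiv ℝ (fun q => fderiv ℝ u q (hfield a q)) p (hfield b p) = _
  rw [h3]
  simp only [_root_.add_apply, ContinuousLinearMap.comp_apply, h4,
    ContinuousLinearMap.flip_apply, map_smul, smul_eq_mul, tderiv]
  ring

/-- The commutators `[X_j, Y_j]` are multiples of `∂_t`, so the skew part of the Hessian is a
multiple of `J`. -/
theorem hess_eq_hessSym_add {n : ℕ} {u : Heis n → ℝ} {p : Heis n} (hu : ContDiffAt ℝ 2 u p) :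
    hess u p = hessSym u p + (2 * tderiv u p) • matJ n := by
  have hsymm : ∀ v w, fderiv ℝ (fderiv ℝ u) p v w = fderiv ℝ (fderiv ℝ u) p w v :=
    hu.isSymmSndFDerivAt (by simp)
  have hJ : ∀ a b, matJ n b a = - matJ n a b := fun a b => by
    have := congrFun (congrFun (matJ_transpose n) a) b
    simpa using this
  ext a b
  simp only [hessSym, hess, Matrix.add_apply, Matrix.smul_apply, of_apply, transpose_apply,
    smul_eq_mul, fderiv_hderiv hu, hsymm (hfield a p) (hfield b p), hJ a b]
  ring

section Congr

variable {n : ℕ} {u v : Heis n → ℝ} {p : Heis n}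

theorem grad_congr (h : u =ᶠ[𝓝 p] v) : grad u p = grad v p := by
  funext a; simp [grad, hderiv, h.fderiv_eq (𝕜 := ℝ)]

theorem hess_congr (h : u =ᶠ[𝓝 p] v) : hess u p = hess v p := by
  have h2 : ∀ a, hderiv a u =ᶠ[𝓝 p] hderiv a v := fun a => by
    filter_upwards [h.fderiv (𝕜 := ℝ)] with q hq
    simp [hderiv, hq]
  ext a b
  simp only [hess, of_apply]
  rw [hderiv, (h2 a).fderiv_eq, hderiv]

theorem hessSym_congr (h : u =ᶠ[𝓝 p] v) : hessSym u p = hessSym v p := by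
  simp [hessSym, hess_congr h]

theorem tensorA_congr (h : u =ᶠ[𝓝 p] v) : tensorA u p = tensorA v p := by
  simp [tensorA, hessSym_congr h, grad_congr h, h.eq_of_nhds]

theorem evalOp_congr (F : Heis n → ℝ → (Idx n → ℝ) → Mat n → ℝ) (h : u =ᶠ[𝓝 p] v) :
    evalOp F u p = evalOp F v p := by
  simp [evalOp, hess_congr h, grad_congr h, h.eq_of_nhds]

end Congr

/-- First derivative of a function along a horizontal curve. -/
theorem hasDerivAt_comp_horizontal {n : ℕ} {u : Heis n → ℝ} {γ : ℝ → Heis n} {v : Idx n → ℝ}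
    {s : ℝ} (hu : DifferentiableAt ℝ u (γ s)) (hγ : HasDerivAt γ (hvec (γ s) v) s) :
    HasDerivAt (fun s => u (γ s)) (grad u (γ s) ⬝ᵥ v) s := by
  rw [grad_dot]
  exact hu.hasFDerivAt.comp_hasDerivAt s hγ

/-- Second derivative of a function along a horizontal curve: as the velocity is horizontal, no
`∂_t` derivative enters. -/
theorem deriv_deriv_comp_horizontal {n : ℕ} {u : Heis n → ℝ} {γ : ℝ → Heis n}
    {c : ℝ → Idx n → ℝ} {c' : Idx n → ℝ} (hu : ContDiffAt ℝ 2 u (γ 0))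
    (hγ : ∀ᶠ s in 𝓝 0, HasDerivAt γ (hvec (γ s) (c s)) s) (hc : HasDerivAt c c' 0) :
    (deriv fun s => u (γ s)) =ᶠ[𝓝 0] (fun s => grad u (γ s) ⬝ᵥ c s) ∧
    HasDerivAt (deriv fun s => u (γ s))
      (grad u (γ 0) ⬝ᵥ c' + c 0 ⬝ᵥ hess u (γ 0) *ᵥ c 0) 0 := by
  have hγ0 := hγ.self_of_nhds
  have h1 : (deriv fun s => u (γ s)) =ᶠ[𝓝 0] (fun s => grad u (γ s) ⬝ᵥ c s) := by
    have hev : ∀ᶠ q in 𝓝 (γ 0), DifferentiableAt ℝ u q := by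
      filter_upwards [hu.eventually (by simp)] with q hq
      exact hq.differentiableAt (by norm_num)
    filter_upwards [hγ, hγ0.continuousAt.eventually hev] with s hs hd
    exact (hasDerivAt_comp_horizontal hd hs).deriv
  refine ⟨h1, HasDerivAt.congr_of_eventuallyEq ?_ h1⟩
  have h2 : ∀ a, HasDerivAt (fun s => grad u (γ s) a)
      (fderiv ℝ (hderiv a u) (γ 0) (hvec (γ 0) (c 0))) 0 := fun a =>
    ((contDiffAt_hderiv hu a).differentiableAt (by norm_num)).hasFDerivAt.comp_hasDerivAt
      (0 : ℝ) hγ0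
  have h3 := HasDerivAt.fun_sum (u := Finset.univ)
    fun a _ => (h2 a).mul (hasDerivAt_pi.1 hc a)
  refine (h3.congr_of_eventuallyEq (.of_forall fun s => rfl)).congr_deriv ?_
  rw [dot_hess, Finset.sum_add_distrib, add_comm]
  refine congrArg₂ (· + ·) rfl ?_
  exact Finset.sum_congr rfl fun a _ => mul_comm _ _

theorem hvec_line {n : ℕ} (p : Heis n) (v : Idx n → ℝ) (s : ℝ) :
    hvec (line p v s) v = hvec p v := by
  refine Prod.ext rfl (Prod.ext rfl ?_)
  simp only [hvec, line, Prod.snd_add, Prod.fst_add, Prod.smul_snd, Prod.smul_fst, Pi.add_apply,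
    Pi.smul_apply, smul_eq_mul]
  congr 1
  exact Finset.sum_congr rfl fun i _ => by ring

theorem hasDerivAt_line {n : ℕ} (p : Heis n) (v : Idx n → ℝ) (s : ℝ) :
    HasDerivAt (line p v) (hvec (line p v s) v) s := by
  rw [hvec_line]
  have h := ((hasDerivAt_id s).smul_const (hvec p v)).const_add p
  rw [one_smul] at h
  exact h

@[simp] theorem line_zero {n : ℕ} (p : Heis n) (v : Idx n → ℝ) : line p v 0 = p := by
  simp [line]

/-- The second order horizontal jet of a function at a point is read off along horizontal
lines. -/
theorem hasDerivAt_comp_line {n : ℕ} {u : Heis n → ℝ} {p : Heis n} (hu : ContDiffAt ℝ 2 u p)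
    (v : Idx n → ℝ) :
    HasDerivAt (fun s => u (line p v s)) (grad u p ⬝ᵥ v) 0 ∧
    HasDerivAt (deriv fun s => u (line p v s)) (v ⬝ᵥ hess u p *ᵥ v) 0 := by
  have h0 : line p v 0 = p := line_zero p v
  constructor
  · have := hasDerivAt_comp_horizontal (u := u) (v := v) (s := 0) (γ := line p v)
      (by rw [h0]; exact hu.differentiableAt (by norm_num)) (hasDerivAt_line p v 0)
    rwa [h0] at this
  · have := (deriv_deriv_comp_horizontal (u := u) (γ := line p v) (c := fun _ => v) (c' := 0)
      (by rwa [h0]) (.of_forall (hasDerivAt_line p v)) (hasDerivAt_const _ _)).2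
    rw [h0] at this
    simpa using this

theorem eq_of_dot_eq {n : ℕ} {a b : Idx n → ℝ} (h : ∀ v, a ⬝ᵥ v = b ⬝ᵥ v) : a = b := by
  funext i
  simpa using h (Pi.single i 1)

/-- Two functions with the same restrictions to the horizontal lines through a point have the same
gradient and symmetrized Hessian there. -/
theorem jet_eq_of_comp_line {n : ℕ} {u v : Heis n → ℝ} {p q : Heis n} {C : Mat n} {k : ℝ}
    (hu : ContDiffAt ℝ 2 u p) (hv : ContDiffAt ℝ 2 v q)
    (h : ∀ w s, u (line p w s) = k * v (line q (C *ᵥ w) s)) :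
    grad u p = k • (Cᵀ *ᵥ grad v q) ∧ hessSym u p = k • (Cᵀ * hessSym v q * C) := by
  constructor
  · refine eq_of_dot_eq fun w => ?_
    have h1 := (hasDerivAt_comp_line hu w).1
    have h2 := ((hasDerivAt_comp_line hv (C *ᵥ w)).1).const_mul k
    rw [funext (h w)] at h1
    rw [h1.unique h2, smul_dotProduct, mulVec_transpose, dotProduct_mulVec, smul_eq_mul]
  · refine eq_of_quadratic_eq (hessSym_isSymm u p) ?_ fun w => ?_
    · simp [IsSymm, transpose_mul, (hessSym_isSymm v q).eq, Matrix.mul_assoc]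
    have h1 := (hasDerivAt_comp_line hu w).2
    have h2 := ((hasDerivAt_comp_line hv (C *ᵥ w)).2).const_mul k
    have h3 : (deriv fun s => u (line p w s)) =
        fun s => k * deriv (fun s => v (line q (C *ᵥ w) s)) s := by
      rw [funext (h w)]
      funext s
      exact deriv_const_mul_field k
    rw [h3] at h1
    rw [dot_hessSym, h1.unique h2, ← dot_hessSym, smul_mulVec, dotProduct_smul, smul_eq_mul,
      ← mulVec_mulVec, ← mulVec_mulVec, dotProduct_mulVec w, vecMul_transpose]

/-! ### The tensor `A^u` as a quadratic expression -/

/-- The power `u^{-1/n} = u^{-2/(Q-2)}` of a positive function `u`, in terms of which the tensor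
`A^u` is quadratic. -/
noncomputable def pot {n : ℕ} (u : Heis n → ℝ) : Heis n → ℝ := fun p => u p ^ (-(1 / (n : ℝ)))

/-- The tensor `h ∇²_s h - J∇h ⊗ J∇h - |∇h|²/2 I`, equal to `A^u` for `h = u^{-1/n}`. -/
noncomputable def conf {n : ℕ} (h : Heis n → ℝ) (p : Heis n) : Mat n :=
  h p • hessSym h p - vecMulVec (matJ n *ᵥ grad h p) (matJ n *ᵥ grad h p)
    - (1 / 2 * (grad h p ⬝ᵥ grad h p)) • (1 : Mat n)

theorem dot_vecMulVec {ι : Type*} [Fintype ι] (a v : ι → ℝ) :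
    v ⬝ᵥ vecMulVec a a *ᵥ v = (a ⬝ᵥ v) ^ 2 := by
  have : vecMulVec a a *ᵥ v = (a ⬝ᵥ v) • a := by
    ext i
    simp only [mulVec, vecMulVec, of_apply, dotProduct, Pi.smul_apply, smul_eq_mul,
      Finset.sum_mul]
    exact Finset.sum_congr rfl fun j _ => by ring
  rw [this, dotProduct_smul, dotProduct_comm, smul_eq_mul, sq]

theorem vecMulVec_self_isSymm {ι : Type*} (a : ι → ℝ) : (vecMulVec a a).IsSymm := by
  ext i j; simp [vecMulVec, mul_comm]

theorem conf_isSymm {n : ℕ} (h : Heis n → ℝ) (p : Heis n) : (conf h p).IsSymm :=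
  (((hessSym_isSymm h p).smul _).sub (vecMulVec_self_isSymm _)).sub (isSymm_one.smul _)

theorem tensorA_isSymm {n : ℕ} (u : Heis n → ℝ) (p : Heis n) : (tensorA u p).IsSymm :=
  ((((hessSym_isSymm u p).smul _).add ((vecMulVec_self_isSymm _).smul _)).sub
    ((vecMulVec_self_isSymm _).smul _)).sub (isSymm_one.smul _)

theorem matJ_mulVec_dot {n : ℕ} (a v : Idx n → ℝ) :
    (matJ n *ᵥ a) ⬝ᵥ v = -(a ⬝ᵥ matJ n *ᵥ v) := by
  rw [dotProduct_comm, dotProduct_mulVec, ← mulVec_transpose, matJ_transpose, neg_mulVec,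
    neg_dotProduct, dotProduct_comm]

theorem dot_conf {n : ℕ} (h : Heis n → ℝ) (p : Heis n) (v : Idx n → ℝ) :
    v ⬝ᵥ conf h p *ᵥ v = h p * (v ⬝ᵥ hess h p *ᵥ v) - (grad h p ⬝ᵥ matJ n *ᵥ v) ^ 2
      - 1 / 2 * (grad h p ⬝ᵥ grad h p) * (v ⬝ᵥ v) := by
  rw [conf, sub_mulVec, sub_mulVec, dotProduct_sub, dotProduct_sub, smul_mulVec, smul_mulVec,
    dotProduct_smul, dotProduct_smul, dot_hessSym, dot_vecMulVec, matJ_mulVec_dot, one_mulVec]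
  simp only [smul_eq_mul]
  ring

theorem hdim_sub_two (n : ℕ) : hdim n - 2 = 2 * n := by
  simp [hdim]

theorem contDiffAt_pot {n : ℕ} {u : Heis n → ℝ} {p : Heis n} (hu : ContDiffAt ℝ 2 u p)
    (hp : 0 < u p) : ContDiffAt ℝ 2 (pot u) p :=
  hu.rpow_const_of_ne hp.ne'

theorem pot_pos {n : ℕ} {u : Heis n → ℝ} {p : Heis n} (hp : 0 < u p) : 0 < pot u p :=
  Real.rpow_pos_of_pos hp _

/-- The first and second order jets of `u ↦ u^{-1/n}`. -/
theorem jet_pot {n : ℕ} {u : Heis n → ℝ} {p : Heis n} (hu : ContDiffAt ℝ 2 u p)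
    (hp : 0 < u p) :
    grad (pot u) p = (-(1 / (n : ℝ)) * pot u p / u p) • grad u p ∧
    ∀ v, v ⬝ᵥ hess (pot u) p *ᵥ v =
      1 / (n : ℝ) * (1 / (n : ℝ) + 1) * pot u p / u p ^ 2 * (grad u p ⬝ᵥ v) ^ 2
        - 1 / (n : ℝ) * pot u p / u p * (v ⬝ᵥ hess u p *ᵥ v) := by
  set r : ℝ := -(1 / (n : ℝ)) with hr
  have key : ∀ v, grad (pot u) p ⬝ᵥ v = r * pot u p / u p * (grad u p ⬝ᵥ v) ∧
      v ⬝ᵥ hess (pot u) p *ᵥ v =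
      r * (r - 1) * pot u p / u p ^ 2 * (grad u p ⬝ᵥ v) ^ 2
        + r * pot u p / u p * (v ⬝ᵥ hess u p *ᵥ v) := by
    intro v
    obtain ⟨h1, h2⟩ := hasDerivAt_comp_line hu v
    obtain ⟨h3, h4⟩ := hasDerivAt_comp_line (contDiffAt_pot hu hp) v
    have h0 : (fun s => u (line p v s)) 0 = u p := by simp
    have hpos : ∀ᶠ s in 𝓝 (0 : ℝ), 0 < u (line p v s) :=
      h1.continuousAt.eventually (lt_mem_nhds (by rw [h0]; exact hp))
    have hdiff : ∀ᶠ s in 𝓝 (0 : ℝ), DifferentiableAt ℝ (fun s => u (line p v s)) s := by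
      have hcont : ContinuousAt (line p v) 0 := (hasDerivAt_line p v 0).continuousAt
      have : ∀ᶠ q in 𝓝 (line p v 0), ContDiffAt ℝ 2 u q := by
        rw [line_zero]; exact hu.eventually (by simp)
      filter_upwards [hcont.eventually this] with s hs
      exact (hasDerivAt_comp_horizontal (hs.differentiableAt (by norm_num))
        (hasDerivAt_line p v s)).differentiableAt
    have e1 : r * pot u p / u p = r * u p ^ (r - 1) := by
      rw [Real.rpow_sub_one hp.ne', mul_div_assoc]; rfl
    have e2 : r * (r - 1) * pot u p / u p ^ 2 = r * ((r - 1) * u p ^ (r - 1 - 1)) := by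
      rw [Real.rpow_sub_one hp.ne', Real.rpow_sub_one hp.ne']
      change r * (r - 1) * u p ^ r / u p ^ 2 = _
      field_simp
    have h5 : (deriv fun s => pot u (line p v s)) =ᶠ[𝓝 0]
        fun s => deriv (fun s => u (line p v s)) s * (r * u (line p v s) ^ (r - 1)) := by
      filter_upwards [hpos, hdiff] with s hs hd
      have := (hd.hasDerivAt.rpow_const (p := r) (Or.inl hs.ne')).deriv
      rw [mul_assoc] at this
      exact this
    constructor
    · have h6 := h1.rpow_const (p := r) (Or.inl (by rw [line_zero]; exact hp.ne'))
      have := h3.unique h6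
      rw [this, e1]
      simp only [line_zero]
      ring
    · have h6 := (h1.rpow_const (p := r - 1) (Or.inl (by rw [line_zero]; exact hp.ne'))).const_mul r
      have h7 := h2.mul h6
      rw [h4.unique (h7.congr_of_eventuallyEq h5), e1, e2, h1.deriv]
      simp only [line_zero]
      ring
  refine ⟨eq_of_dot_eq fun v => ?_, fun v => ?_⟩
  · rw [(key v).1, smul_dotProduct, smul_eq_mul]
  · rw [(key v).2, hr]
    ring

/-- In terms of `u^{-1/n}` the two gradient terms `∇u ⊗ ∇u` cancel. -/
theorem tensorA_eq_conf {n : ℕ} (hn : 1 ≤ n) {u : Heis n → ℝ} {p : Heis n}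
    (hu : ContDiffAt ℝ 2 u p) (hp : 0 < u p) : tensorA u p = conf (pot u) p := by
  refine eq_of_quadratic_eq (tensorA_isSymm u p) (conf_isSymm _ p) fun v => ?_
  have hn0 : (n : ℝ) ≠ 0 := by positivity
  obtain ⟨h1, h2⟩ := jet_pot hu hp
  have e1 : u p ^ (-((hdim n + 2) / (hdim n - 2))) = pot u p ^ 2 / u p := by
    rw [← Real.rpow_natCast (pot u p) 2, pot, ← Real.rpow_mul hp.le, ← Real.rpow_sub_one hp.ne']
    congr 1
    simp only [hdim_sub_two]
    simp only [hdim]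
    push_cast
    field_simp
    ring
  have e2 : u p ^ (-(2 * hdim n / (hdim n - 2))) = pot u p ^ 2 / u p ^ 2 := by
    rw [← Real.rpow_natCast (pot u p) 2, pot, ← Real.rpow_mul hp.le, ← Real.rpow_natCast (u p) 2,
      ← Real.rpow_sub hp]
    congr 1
    simp only [hdim_sub_two]
    simp only [hdim]
    push_cast
    field_simp
    ring
  have e3 : ∑ a, grad u p a ^ 2 = grad u p ⬝ᵥ grad u p := by
    simp [dotProduct, sq]
  have e4 : v ⬝ᵥ tensorA u p *ᵥ v =
      -(2 / (hdim n - 2)) * (pot u p ^ 2 / u p) * (v ⬝ᵥ hess u p *ᵥ v)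
      + 2 * hdim n / (hdim n - 2) ^ 2 * (pot u p ^ 2 / u p ^ 2) * (grad u p ⬝ᵥ v) ^ 2
      - 4 / (hdim n - 2) ^ 2 * (pot u p ^ 2 / u p ^ 2) * (grad u p ⬝ᵥ matJ n *ᵥ v) ^ 2
      - 2 / (hdim n - 2) ^ 2 * (pot u p ^ 2 / u p ^ 2) * (grad u p ⬝ᵥ grad u p) * (v ⬝ᵥ v) := by
    rw [tensorA, e1, e2, e3, sub_mulVec, sub_mulVec, add_mulVec, dotProduct_sub, dotProduct_sub,
      dotProduct_add, smul_mulVec, smul_mulVec, smul_mulVec, smul_mulVec, dotProduct_smul,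
      dotProduct_smul, dotProduct_smul, dotProduct_smul, dot_hessSym, dot_vecMulVec,
      dot_vecMulVec, matJ_mulVec_dot, one_mulVec]
    simp only [smul_eq_mul]
    ring
  have hup := hp.ne'
  rw [e4, dot_conf, h2, h1, smul_dotProduct, smul_dotProduct, dotProduct_smul]
  simp only [smul_eq_mul, hdim_sub_two]
  simp only [hdim]
  field_simp
  ring

/-! ### Jacobians of conformal contact maps -/

/-- The derivative of `g` at `p` maps the horizontal space at `p` to the one at `g p` by the
multiple `κ O` of an orthogonal matrix, and scales `∂_t` by `± κ²` modulo horizontal vectors. -/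
structure ConformalContactAt {n : ℕ} (g : Heis n → Heis n) (p : Heis n) (κ : ℝ) (O : Mat n) :
    Prop where
  pos : 0 < κ
  orth : Oᵀ * O = 1
  diff : DifferentiableAt ℝ g p
  horizontal : ∀ v, fderiv ℝ g p (hvec p v) = hvec (g p) (κ • O *ᵥ v)
  vertical : ∃ w μ, fderiv ℝ g p (0, 0, 1) = hvec (g p) w + (0, 0, μ) ∧ |μ| = κ ^ 2

/-- Coordinates on `ℍⁿ` with index set `Idx n ⊕ Unit`. -/
def coords (n : ℕ) : (Idx n ⊕ Unit → ℝ) ≃ₗ[ℝ] Heis n where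
  toFun w := (fun i => w (.inl (.inl i)), fun i => w (.inl (.inr i)), w (.inr ()))
  invFun p := Sum.elim (Sum.elim p.1 p.2.1) fun _ => p.2.2
  map_add' _ _ := rfl
  map_smul' _ _ := rfl
  left_inv w := by ext ((i | i) | i) <;> rfl
  right_inv _ := rfl

theorem coords_elim {n : ℕ} (v : Idx n → ℝ) (f : Unit → ℝ) : coords n (Sum.elim v f) =
    (fun i => v (.inl i), fun i => v (.inr i), f ()) := rfl

/-- The linear map of `ℍⁿ` with matrix `A` in the coordinates `coords n`. -/
noncomputable def coordMap {n : ℕ} (A : Matrix (Idx n ⊕ Unit) (Idx n ⊕ Unit) ℝ) :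
    Heis n →ₗ[ℝ] Heis n :=
  (coords n : (Idx n ⊕ Unit → ℝ) →ₗ[ℝ] Heis n) ∘ₗ toLin' A ∘ₗ ((coords n).symm : Heis n →ₗ[ℝ] _)

theorem det_coordMap {n : ℕ} (A : Matrix (Idx n ⊕ Unit) (Idx n ⊕ Unit) ℝ) :
    LinearMap.det (coordMap A) = A.det := by
  rw [coordMap, LinearMap.det_conj, LinearMap.det_toLin']

/-- The matrix of the frame `X_j, Y_j, ∂_t` at `p`. -/
def frameMatrix {n : ℕ} (p : Heis n) : Matrix (Idx n ⊕ Unit) (Idx n ⊕ Unit) ℝ :=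
  fromBlocks 1 0 (of fun _ a => (hfield a p).2.2) 1

theorem coordMap_frameMatrix {n : ℕ} (p : Heis n) (v : Idx n → ℝ) (t : ℝ) :
    coordMap (frameMatrix p) (coords n (Sum.elim v fun _ => t)) = hvec p v + (0, 0, t) := by
  have h := congrArg (fun q : Heis n => q.2.2) (sum_smul_hfield p v)
  simp only [Prod.snd_sum, Prod.smul_snd, smul_eq_mul] at h
  simp only [coordMap, LinearMap.comp_apply, LinearEquiv.coe_coe, LinearEquiv.symm_apply_apply,
    toLin'_apply, frameMatrix, fromBlocks_mulVec]
  rw [coords_elim]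
  refine Prod.ext ?_ (Prod.ext ?_ ?_)
  · ext i; simp [hvec]
  · ext i; simp [hvec]
  · change _ = (hvec p v).2.2 + t
    rw [← h]
    simp [mulVec, dotProduct, mul_comm]

theorem abs_det_eq_one_of_orth {ι : Type*} [Fintype ι] [DecidableEq ι] {O : Matrix ι ι ℝ}
    (h : Oᵀ * O = 1) : |O.det| = 1 := by
  have := congrArg det h
  rw [det_mul, det_transpose, det_one] at this
  rw [← sq_eq_sq₀ (abs_nonneg _) zero_le_one, sq_abs, sq, this, one_pow]

theorem ConformalContactAt.abs_det {n : ℕ} {g : Heis n → Heis n} {p : Heis n} {κ : ℝ} {O : Mat n}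
    (h : ConformalContactAt g p κ O) : |(fderiv ℝ g p).det| = κ ^ (2 * n + 2) := by
  obtain ⟨w, μ, hw, hμ⟩ := h.vertical
  set B : Matrix (Idx n ⊕ Unit) (Idx n ⊕ Unit) ℝ :=
    fromBlocks (κ • O) (of fun a _ => w a) 0 (of fun _ _ => μ) with hB
  have hcomp : (fderiv ℝ g p : Heis n →ₗ[ℝ] Heis n) ∘ₗ coordMap (frameMatrix p) =
      coordMap (frameMatrix (g p)) ∘ₗ coordMap B := by
    refine LinearMap.ext fun q => ?_
    obtain ⟨c, rfl⟩ := (coords n).surjective q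
    obtain ⟨v, t, rfl⟩ : ∃ (v : Idx n → ℝ) (t : ℝ), c = Sum.elim v fun _ => t :=
      ⟨c ∘ Sum.inl, c (Sum.inr ()), by ext (a | a) <;> rfl⟩
    have hBc : coordMap B (coords n (Sum.elim v fun _ => t)) =
        coords n (Sum.elim (κ • O *ᵥ v + t • w) fun _ => μ * t) := by
      simp only [coordMap, LinearMap.comp_apply, LinearEquiv.coe_coe,
        LinearEquiv.symm_apply_apply, toLin'_apply, hB, fromBlocks_mulVec]
      congr 1
      ext (a | a)
      · simp [mulVec, dotProduct, smul_mulVec, mul_comm]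
      · simp [mulVec, dotProduct]
    have hadd : ∀ (q : Heis n) (a b : Idx n → ℝ), hvec q (a + b) = hvec q a + hvec q b := by
      intro q a b
      simp only [← sum_smul_hfield, Pi.add_apply, add_smul, Finset.sum_add_distrib]
    have hsmul : ∀ (q : Heis n) (k : ℝ) (a : Idx n → ℝ), hvec q (k • a) = k • hvec q a := by
      intro q k a
      simp only [← sum_smul_hfield, Pi.smul_apply, smul_eq_mul, mul_smul, Finset.smul_sum]
    have ht : ((0, 0, t) : Heis n) = t • (0, 0, 1) := by simp
    rw [LinearMap.comp_apply, LinearMap.comp_apply, hBc, coordMap_frameMatrix,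
      coordMap_frameMatrix, map_add, ht, map_smul]
    change fderiv ℝ g p (hvec p v) + t • fderiv ℝ g p (0, 0, 1) = _
    rw [h.horizontal, hw, hadd, hsmul _ t, smul_add, add_assoc]
    simp [mul_comm]
  have hdet := congrArg LinearMap.det hcomp
  have hframe : ∀ q : Heis n, (frameMatrix q).det = 1 := fun q => by
    rw [frameMatrix, det_fromBlocks_zero₁₂, det_one, det_one, one_mul]
  rw [LinearMap.det_comp, LinearMap.det_comp, det_coordMap, det_coordMap, det_coordMap, hframe,
    hframe, mul_one, one_mul, hB, det_fromBlocks_zero₂₁, det_smul] at hdet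
  have hu : (of fun (_ : Unit) (_ : Unit) => μ).det = μ := by simp
  change |LinearMap.det (fderiv ℝ g p : Heis n →ₗ[ℝ] Heis n)| = _
  rw [hdet, hu, abs_mul, abs_mul, abs_det_eq_one_of_orth h.orth, hμ, abs_pow, abs_of_pos h.pos]
  have hc : Fintype.card (Idx n) = 2 * n := by simp [two_mul]
  rw [hc]
  ring

/-- The exponent `(Q - 2) / (2 Q)` turns the Jacobian `κ ^ Q` into `κ ^ n`. -/
theorem ConformalContactAt.transform_eq {n : ℕ} {g : Heis n → Heis n} {p : Heis n} {κ : ℝ}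
    {O : Mat n} (h : ConformalContactAt g p κ O) (u : Heis n → ℝ) :
    transform g u p = κ ^ n * u (g p) := by
  rw [transform, h.abs_det, ← Real.rpow_natCast κ (2 * n + 2), ← Real.rpow_mul h.pos.le,
    ← Real.rpow_natCast κ n]
  congr 2
  simp only [hdim]
  push_cast
  have : (2 * (n : ℝ) + 2) ≠ 0 := by positivity
  field_simp
  ring

/-- On `u^{-1/n}` the transform acts with the weight `κ⁻¹`, independent of `n`. -/
theorem ConformalContactAt.pot_transform {n : ℕ} (hn : 1 ≤ n) {g : Heis n → Heis n} {p : Heis n}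
    {κ : ℝ} {O : Mat n} (h : ConformalContactAt g p κ O) {u : Heis n → ℝ} (hu : 0 < u (g p)) :
    pot (transform g u) p = κ⁻¹ * pot u (g p) := by
  have hn0 : (n : ℝ) ≠ 0 := by positivity
  rw [pot, h.transform_eq, Real.mul_rpow (pow_nonneg h.pos.le _) hu.le, ← Real.rpow_natCast,
    ← Real.rpow_mul h.pos.le, pot, ← Real.rpow_neg_one]
  congr 2
  field_simp

/-! ### Translations, dilations, rotations and the inversion -/

theorem conf_eq_of_quadratic {n : ℕ} {f h : Heis n → ℝ} {p q : Heis n} {O : Mat n}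
    (H : ∀ v, v ⬝ᵥ conf f p *ᵥ v = (O *ᵥ v) ⬝ᵥ conf h q *ᵥ (O *ᵥ v)) :
    conf f p = Oᵀ * conf h q * O := by
  refine eq_of_quadratic_eq (conf_isSymm f p) ?_ fun v => ?_
  · simp [IsSymm, transpose_mul, (conf_isSymm h q).eq, Matrix.mul_assoc]
  · rw [H, ← mulVec_mulVec, ← mulVec_mulVec, dotProduct_mulVec v, vecMul_transpose]

theorem orth_dot {n : ℕ} {O : Mat n} (h : Oᵀ * O = 1) (v w : Idx n → ℝ) :
    (O *ᵥ v) ⬝ᵥ (O *ᵥ w) = v ⬝ᵥ w := by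
  rw [dotProduct_mulVec, vecMul_mulVec, dotProduct_comm, h, vecMul_one, dotProduct_comm]

/-- A map sending every horizontal line to a horizontal line and every vertical line to a vertical
line, with derivative `κ O` in the frame `X_j, Y_j` and factor `μ` in the direction `∂_t`, the same
at every point. -/
structure AffineContact {n : ℕ} (g : Heis n → Heis n) (κ : ℝ) (O : Mat n) (μ : ℝ) : Prop where
  pos : 0 < κ
  orth : Oᵀ * O = 1
  smooth : ContDiff ℝ 2 g
  map_line : ∀ p v s, g (line p v s) = line (g p) (κ • O *ᵥ v) s
  map_vertical : ∀ p (s : ℝ), g (p + s • (0, 0, 1)) = g p + s • (0, 0, μ)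
  abs_vertical : |μ| = κ ^ 2

namespace AffineContact

variable {n : ℕ} {g : Heis n → Heis n} {κ : ℝ} {O : Mat n} {μ : ℝ}

theorem fderiv_vertical (h : AffineContact g κ O μ) (p : Heis n) :
    fderiv ℝ g p (0, 0, 1) = (0, 0, μ) := by
  have hl : HasDerivAt (fun s : ℝ => p + s • ((0, 0, 1) : Heis n)) (0, 0, 1) 0 := by
    simpa using! ((hasDerivAt_id (0 : ℝ)).smul_const ((0, 0, 1) : Heis n)).const_add p
  have hr : HasDerivAt (fun s : ℝ => g p + s • ((0, 0, μ) : Heis n)) (0, 0, μ) 0 := by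
    simpa using! ((hasDerivAt_id (0 : ℝ)).smul_const ((0, 0, μ) : Heis n)).const_add (g p)
  have := ((h.smooth.differentiable (by norm_num) p).hasFDerivAt.comp_hasDerivAt_of_eq (0 : ℝ)
    hl (by simp))
  rw [show (g ∘ fun s : ℝ => p + s • ((0, 0, 1) : Heis n)) = fun s => g p + s • (0, 0, μ) from
    funext (h.map_vertical p)] at this
  exact this.unique hr

theorem conformalContactAt (h : AffineContact g κ O μ) (p : Heis n) :
    ConformalContactAt g p κ O where
  pos := h.pos
  orth := h.orth
  diff := h.smooth.differentiable (by norm_num) p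
  horizontal v := by
    have h1 := ((h.smooth.differentiable (by norm_num) p).hasFDerivAt.comp_hasDerivAt_of_eq (0 : ℝ)
      (hasDerivAt_line p v 0) (by simp))
    rw [show (g ∘ line p v) = line (g p) (κ • O *ᵥ v) from funext (h.map_line p v), line_zero]
      at h1
    have h2 := hasDerivAt_line (g p) (κ • O *ᵥ v) 0
    rw [line_zero] at h2
    exact h1.unique h2
  vertical := ⟨0, μ, by rw [h.fderiv_vertical]; ext <;> simp [hvec], h.abs_vertical⟩

theorem transform_eq (h : AffineContact g κ O μ) (u : Heis n → ℝ) :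
    transform g u = fun p => κ ^ n * u (g p) :=
  funext fun p => (h.conformalContactAt p).transform_eq u

theorem contDiffAt_transform (h : AffineContact g κ O μ) {u : Heis n → ℝ} {p : Heis n}
    (hu : ContDiffAt ℝ 2 u (g p)) : ContDiffAt ℝ 2 (transform g u) p := by
  rw [h.transform_eq]
  exact contDiffAt_const.mul (hu.comp p h.smooth.contDiffAt)

theorem transform_pos (h : AffineContact g κ O μ) {u : Heis n → ℝ} {p : Heis n}
    (hu : 0 < u (g p)) : 0 < transform g u p := by
  rw [h.transform_eq]
  have := h.pos
  positivity

theorem grad_transform (h : AffineContact g κ O μ) {u : Heis n → ℝ} {p : Heis n}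
    (hu : ContDiffAt ℝ 2 u (g p)) :
    grad (transform g u) p = κ ^ n • ((κ • O)ᵀ *ᵥ grad u (g p)) :=
  (jet_eq_of_comp_line (h.contDiffAt_transform hu) hu fun w s => by
    rw [h.transform_eq, smul_mulVec, ← h.map_line]).1

theorem hessSym_transform (h : AffineContact g κ O μ) {u : Heis n → ℝ} {p : Heis n}
    (hu : ContDiffAt ℝ 2 u (g p)) :
    hessSym (transform g u) p = κ ^ n • ((κ • O)ᵀ * hessSym u (g p) * (κ • O)) :=
  (jet_eq_of_comp_line (h.contDiffAt_transform hu) hu fun w s => by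
    rw [h.transform_eq, smul_mulVec, ← h.map_line]).2

theorem tderiv_transform (h : AffineContact g κ O μ) {u : Heis n → ℝ} {p : Heis n}
    (hu : ContDiffAt ℝ 2 u (g p)) :
    tderiv (transform g u) p = κ ^ n * (μ * tderiv u (g p)) := by
  have h1 := (hu.differentiableAt (by norm_num)).hasFDerivAt.comp p
    (h.smooth.differentiable (by norm_num) p).hasFDerivAt
  have hv : ((0, 0, μ) : Heis n) = μ • (0, 0, 1) := by simp
  have h2 : fderiv ℝ (fun q => κ ^ n * u (g q)) p = _ := (h1.const_mul (κ ^ n)).fderiv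
  rw [h.transform_eq, tderiv, h2]
  simp only [_root_.smul_apply, ContinuousLinearMap.comp_apply, h.fderiv_vertical, hv,
    map_smul, smul_eq_mul, tderiv]

/-- The tensor is conjugated by `O`. As it is quadratic in `J`, it does not matter whether `O`
commutes or anticommutes with `J`; these are the cases `ε = 1` and `ε = -1`. -/
theorem tensorA_transform (hn : 1 ≤ n) (h : AffineContact g κ O μ) {ε : ℝ} (hε : ε ^ 2 = 1)
    (hJ : O * matJ n = ε • (matJ n * O)) {u : Heis n → ℝ} {p : Heis n}
    (hu : ContDiffAt ℝ 2 u (g p)) (hpos : 0 < u (g p)) :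
    tensorA (transform g u) p = Oᵀ * tensorA u (g p) * O := by
  have hκ := h.pos.ne'
  have hpot := contDiffAt_pot hu hpos
  rw [tensorA_eq_conf hn (h.contDiffAt_transform hu) (h.transform_pos hpos),
    tensorA_eq_conf hn hu hpos]
  set f : Heis n → ℝ := fun q => κ⁻¹ * pot u (g q) with hf
  have hfC : ContDiffAt ℝ 2 f p := contDiffAt_const.mul (hpot.comp p h.smooth.contDiffAt)
  have hev : pot (transform g u) =ᶠ[𝓝 p] f := by
    have : ∀ᶠ q in 𝓝 p, 0 < u (g q) :=
      (hu.continuousAt.comp h.smooth.continuous.continuousAt).eventually (lt_mem_nhds hpos)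
    filter_upwards [this] with q hq
    exact (h.conformalContactAt q).pot_transform hn hq
  obtain ⟨h1, h2⟩ := jet_eq_of_comp_line (C := κ • O) (k := κ⁻¹) hfC hpot fun w s => by
    rw [hf, smul_mulVec, ← h.map_line]
  have hg : grad (pot (transform g u)) p = Oᵀ *ᵥ grad (pot u) (g p) := by
    rw [grad_congr hev, h1, transpose_smul, smul_mulVec, smul_smul, inv_mul_cancel₀ hκ, one_smul]
  have hO : O * Oᵀ = 1 := mul_eq_one_comm.1 h.orth
  refine conf_eq_of_quadratic fun v => ?_
  have hgv : ∀ w, (Oᵀ *ᵥ grad (pot u) (g p)) ⬝ᵥ w = grad (pot u) (g p) ⬝ᵥ O *ᵥ w := fun w => by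
    rw [mulVec_transpose, ← dotProduct_mulVec]
  have hh : v ⬝ᵥ hess (pot (transform g u)) p *ᵥ v =
      κ * ((O *ᵥ v) ⬝ᵥ hess (pot u) (g p) *ᵥ (O *ᵥ v)) := by
    rw [← dot_hessSym, hessSym_congr hev, h2, ← dot_hessSym, smul_mulVec, ← mulVec_mulVec,
      ← mulVec_mulVec, dotProduct_smul, dotProduct_mulVec v, vecMul_transpose, smul_mulVec,
      mulVec_smul, smul_dotProduct, dotProduct_smul]
    simp only [smul_eq_mul]
    field_simp
  rw [dot_conf, dot_conf, hh, hg, hev.eq_of_nhds, hgv, hgv, mulVec_mulVec _ O Oᵀ, hO,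
    one_mulVec, mulVec_mulVec _ O (matJ n), hJ, smul_mulVec, dotProduct_smul,
    mulVec_mulVec _ (matJ n) O, orth_dot h.orth, smul_eq_mul,
    mul_pow, hε, hf]
  field_simp

end AffineContact

theorem affineContact_translation {n : ℕ} (a : Heis n) :
    AffineContact (translation a) 1 1 1 where
  pos := one_pos
  orth := by simp
  smooth := by
    change ContDiff ℝ 2 fun b : Heis n => ((a.1 + b.1, a.2.1 + b.2.1,
      a.2.2 + b.2.2 + 2 * ∑ i, (a.2.1 i * b.1 i - a.1 i * b.2.1 i)) : Heis n)
    fun_prop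
  map_line p v s := by
    change op a (line p v s) = line (op a p) _ s
    refine Prod.ext ?_ (Prod.ext ?_ ?_)
    · ext i; simp [op, line, hvec]; ring
    · ext i; simp [op, line, hvec]; ring
    · simp only [op, line, hvec, one_mulVec, Prod.snd_add, Prod.fst_add, Prod.smul_snd,
        Prod.smul_fst, Pi.add_apply, Pi.smul_apply, smul_eq_mul, Finset.mul_sum]
      simp only [add_assoc, ← Finset.sum_add_distrib]
      congr 2
      exact Finset.sum_congr rfl fun i _ => by ring
  map_vertical p s := by
    change op a _ = op a p + _
    refine Prod.ext ?_ (Prod.ext ?_ ?_)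
    · simp [op]
    · simp [op]
    · simp [op]; ring
  abs_vertical := by simp

theorem affineContact_dilation {n : ℕ} (l : ℝ) (hl : 0 < l) :
    AffineContact (dilation (n := n) l hl) l 1 (l ^ 2) where
  pos := hl
  orth := by simp
  smooth := by
    change ContDiff ℝ 2 fun b : Heis n => ((l • b.1, l • b.2.1, l ^ 2 * b.2.2) : Heis n)
    fun_prop
  map_line p v s := by
    refine Prod.ext ?_ (Prod.ext ?_ ?_)
    · ext i; simp [dilation, line, hvec]; ring
    · ext i; simp [dilation, line, hvec]; ring
    · simp only [dilation, Equiv.coe_fn_mk, line, hvec, one_mulVec, Prod.snd_add, Prod.fst_add,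
        Prod.smul_snd, Prod.smul_fst, Pi.smul_apply, smul_eq_mul, mul_add, Finset.mul_sum]
      congr 1
      exact Finset.sum_congr rfl fun i _ => by ring
  map_vertical p s := by
    refine Prod.ext ?_ (Prod.ext ?_ ?_)
    · simp [dilation]
    · simp [dilation]
    · simp [dilation]; ring
  abs_vertical := by simp

theorem hvec_snd_snd {n : ℕ} (p : Heis n) (v : Idx n → ℝ) :
    (hvec p v).2.2 = 2 * (herm (cx v) (zc p)).im := by
  simp only [hvec, herm, Complex.im_sum]
  congr 1
  refine Finset.sum_congr rfl fun i _ => ?_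
  simp [cx, zc]
  ring

theorem zc_line {n : ℕ} (p : Heis n) (v : Idx n → ℝ) (s : ℝ) :
    zc (line p v s) = zc p + (s : ℂ) • cx v := by
  ext i
  apply Complex.ext <;> simp [zc, line, hvec, cx]

theorem heis_ext {n : ℕ} {p q : Heis n} (h1 : zc p = zc q) (h2 : p.2.2 = q.2.2) : p = q := by
  refine Prod.ext (funext fun i => ?_) (Prod.ext (funext fun i => ?_) h2)
  · exact congrArg Complex.re (congrFun h1 i)
  · exact congrArg Complex.im (congrFun h1 i)

theorem herm_unitary {n : ℕ} {M : Matrix (Fin n) (Fin n) ℂ} (hM : M ∈ unitaryGroup (Fin n) ℂ)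
    (a b : Fin n → ℂ) : herm (M *ᵥ a) (M *ᵥ b) = herm a b := by
  have h : ∀ a b : Fin n → ℂ, herm a b = star a ⬝ᵥ b := fun a b => rfl
  rw [h, h, star_mulVec, ← dotProduct_mulVec, mulVec_mulVec, ← star_eq_conjTranspose,
    mem_unitaryGroup_iff'.1 hM, one_mulVec]

theorem affineContact_rotation {n : ℕ} (M : unitaryGroup (Fin n) ℂ) :
    AffineContact (rotation M) 1 (realForm (M : Matrix (Fin n) (Fin n) ℂ)) 1 where
  pos := one_pos
  orth := realForm_transpose_mul M.2
  smooth := by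
    have h : (rotation M : Heis n → Heis n) = fun p : Heis n =>
        ((fun i => ∑ j, (((M : Matrix (Fin n) (Fin n) ℂ) i j).re * p.1 j -
            ((M : Matrix (Fin n) (Fin n) ℂ) i j).im * p.2.1 j),
          fun i => ∑ j, (((M : Matrix (Fin n) (Fin n) ℂ) i j).re * p.2.1 j +
            ((M : Matrix (Fin n) (Fin n) ℂ) i j).im * p.1 j), p.2.2) : Heis n) := by
      funext p
      refine Prod.ext ?_ (Prod.ext ?_ rfl)
      · ext i; simp [rotation, linAct, mulVec, dotProduct, zc]
      · ext i; simp [rotation, linAct, mulVec, dotProduct, zc]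
    rw [h]
    fun_prop
  map_line p v s := by
    have hz : ∀ q, zc (rotation M q) = (M : Matrix (Fin n) (Fin n) ℂ) *ᵥ zc q := fun q => rfl
    have ht : ∀ q : Heis n, (rotation M q).2.2 = q.2.2 := fun q => rfl
    rw [one_smul]
    apply heis_ext
    · rw [hz, zc_line, zc_line, hz, cx_realForm, mulVec_add, mulVec_smul]
    · rw [ht, line, line, Prod.snd_add, Prod.snd_add, Prod.snd_add, Prod.snd_add, ht,
        Prod.smul_snd, Prod.smul_snd, Prod.smul_snd, Prod.smul_snd, hvec_snd_snd, hvec_snd_snd,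
        hz, cx_realForm, herm_unitary M.2]
  map_vertical p s := by
    have h : zc (p + s • ((0, 0, 1) : Heis n)) = zc p := by
      ext i; simp [zc]
    refine Prod.ext ?_ (Prod.ext ?_ rfl)
    · change (fun i => ((M : Matrix (Fin n) (Fin n) ℂ) *ᵥ zc (p + s • ((0, 0, 1) : Heis n))) i
        |>.re) = _
      rw [h]; simp [rotation, linAct]
    · change (fun i => ((M : Matrix (Fin n) (Fin n) ℂ) *ᵥ zc (p + s • ((0, 0, 1) : Heis n))) i
        |>.im) = _
      rw [h]; simp [rotation, linAct]
  abs_vertical := by simp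

theorem affineContact_inversion (n : ℕ) : AffineContact (inversion n) 1 (matG n) (-1) where
  pos := one_pos
  orth := by rw [matG_transpose, matG_mul_matG]
  smooth := by
    change ContDiff ℝ 2 fun p : Heis n => ((p.1, -p.2.1, -p.2.2) : Heis n)
    fun_prop
  map_line p v s := by
    have h1 : ∀ i, (matG n *ᵥ v) (Sum.inl i) = v (Sum.inl i) := fun i => by
      simp [matG, mulVec, dotProduct, Fintype.sum_sum_type, one_apply]
    have h2 : ∀ i, (matG n *ᵥ v) (Sum.inr i) = -v (Sum.inr i) := fun i => by
      simp [matG, mulVec, dotProduct, Fintype.sum_sum_type, one_apply]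
    refine Prod.ext ?_ (Prod.ext ?_ ?_)
    · ext i; simp [inversion, line, hvec, h1]
    · ext i; simp [inversion, line, hvec, h2]; ring
    · simp only [inversion, Equiv.coe_fn_mk, line, hvec, one_smul, Prod.snd_add, Prod.smul_snd,
        Pi.neg_apply, h1, h2, smul_eq_mul, neg_add, Finset.mul_sum, ← Finset.sum_neg_distrib]
      congr 1
      exact Finset.sum_congr rfl fun i _ => by ring
  map_vertical p s := by
    refine Prod.ext ?_ (Prod.ext ?_ ?_)
    · simp [inversion]
    · simp [inversion]
    · simp [inversion]; ring
  abs_vertical := by simp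

/-! ### The CR inversion -/

/-- The complex coordinate `w = t + i |z|²`, in which the CR inversion is
`(z, w) ↦ (z / w, -1 / w)`. Its modulus is the square of the homogeneous norm. -/
noncomputable def wc {n : ℕ} (p : Heis n) : ℂ := ⟨p.2.2, zsq p⟩

theorem normSq_wc {n : ℕ} (p : Heis n) : Complex.normSq (wc p) = gauge4 p := by
  simp [Complex.normSq_apply, wc, gauge4]; ring

theorem wc_ne_zero {n : ℕ} {p : Heis n} (hp : p ≠ 0) : wc p ≠ 0 := by
  rw [← Complex.normSq_pos, normSq_wc]
  exact gauge4_pos hp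

theorem zc_phi {n : ℕ} (p : Heis n) : zc (phi p) = (wc p)⁻¹ • zc p := by
  ext i
  apply Complex.ext <;>
  simp [zc, phi, Complex.inv_re, Complex.inv_im, normSq_wc] <;> simp [wc] <;> ring

theorem phi_snd_snd {n : ℕ} (p : Heis n) : (phi p).2.2 = -(wc p)⁻¹.re := by
  simp [phi, Complex.inv_re, normSq_wc]
  simp [wc]; ring

theorem wc_line {n : ℕ} (p : Heis n) (v : Idx n → ℝ) (s : ℝ) :
    wc (line p v s) = wc p + s * (2 * Complex.I * herm (zc p) (cx v))
      + s ^ 2 * (Complex.I * ((v ⬝ᵥ v : ℝ) : ℂ)) := by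
  have h1 : ((zsq (line p v s) : ℝ) : ℂ) = _ := (herm_zc_self _).symm
  rw [zc_line, herm_add_left, herm_add_right, herm_add_right, herm_smul_left, herm_smul_left,
    herm_smul_right, herm_smul_right, herm_zc_self, ← herm_conj (zc p), herm_self] at h1
  have h2 := congrArg Complex.re h1
  simp at h2
  have h3 : (line p v s).2.2 = p.2.2 + s * (hvec p v).2.2 := rfl
  rw [hvec_snd_snd, ← herm_conj] at h3
  apply Complex.ext
  · change (line p v s).2.2 = _
    rw [h3]; simp [wc, pow_two]
  · change zsq (line p v s) = _
    rw [h2]; simp [wc, pow_two]; ring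

/-- The derivative of the CR inversion at `p` on horizontal vectors, in complex notation. -/
noncomputable def phiDeriv {n : ℕ} (p : Heis n) (a : Fin n → ℂ) : Fin n → ℂ :=
  (wc p)⁻¹ • (a - (2 * Complex.I * herm (zc p) a * (wc p)⁻¹) • zc p)

theorem wc_sub_conj {n : ℕ} (p : Heis n) :
    wc p - conj (wc p) = 2 * Complex.I * (zsq p : ℂ) := by
  apply Complex.ext <;> simp [wc]
  ring

/-- The unitary part of the derivative of the CR inversion. -/
noncomputable def phiUnitary {n : ℕ} (p : Heis n) : Matrix (Fin n) (Fin n) ℂ :=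
  ((‖wc p‖ : ℂ) * (wc p)⁻¹) • (1 - (2 * Complex.I * (wc p)⁻¹) • vecMulVec (zc p) (star (zc p)))

theorem vecMulVec_star_mulVec {n : ℕ} (z a : Fin n → ℂ) :
    vecMulVec z (star z) *ᵥ a = herm z a • z := by
  ext i
  simp only [mulVec, vecMulVec, of_apply, dotProduct, herm, Pi.smul_apply, smul_eq_mul,
    Finset.sum_mul]
  exact Finset.sum_congr rfl fun j _ => by simp; ring

theorem phiUnitary_mulVec {n : ℕ} (p : Heis n) (a : Fin n → ℂ) :
    phiUnitary p *ᵥ a = (‖wc p‖ : ℂ) • phiDeriv p a := by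
  rw [phiUnitary, smul_mulVec, sub_mulVec, one_mulVec, smul_mulVec, vecMulVec_star_mulVec,
    phiDeriv, smul_smul, smul_smul]
  congr 3
  ring

theorem phiDeriv_smul {n : ℕ} (p : Heis n) (k : ℂ) (a : Fin n → ℂ) :
    phiDeriv p (k • a) = k • phiDeriv p a := by
  ext i
  simp [phiDeriv, herm_smul_right]
  ring

theorem norm_wc_sq {n : ℕ} (p : Heis n) : ((‖wc p‖ : ℂ)) ^ 2 = wc p * conj (wc p) := by
  rw [Complex.mul_conj, Complex.normSq_eq_norm_sq]
  push_cast; rfl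

/-- The derivative of the CR inversion is conformal on horizontal spaces, with factor `|w|⁻¹`. -/
theorem herm_phiDeriv {n : ℕ} {p : Heis n} (hp : p ≠ 0) (a b : Fin n → ℂ) :
    herm (phiDeriv p a) (phiDeriv p b) = (wc p * conj (wc p))⁻¹ * herm a b := by
  have hw := wc_ne_zero hp
  have hw' : conj (wc p) ≠ 0 := by simpa using hw
  have hz := wc_sub_conj p
  simp only [phiDeriv, herm_smul_left, herm_smul_right, sub_eq_add_neg, ← neg_smul, herm_add_left,
    herm_add_right, herm_zc_self, map_neg, map_mul, map_inv₀, Complex.conj_I, herm_conj]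
  have h2 : conj (2 : ℂ) = 2 := Complex.conj_ofNat 2
  rw [h2]
  have hN : (zsq p : ℂ) = (wc p - conj (wc p)) / (2 * Complex.I) := by
    rw [hz]; field_simp
  rw [hN]
  field_simp
  ring_nf

theorem phiUnitary_mem {n : ℕ} {p : Heis n} (hp : p ≠ 0) :
    phiUnitary p ∈ unitaryGroup (Fin n) ℂ := by
  have hw := wc_ne_zero hp
  have hw' : conj (wc p) ≠ 0 := by simpa using hw
  rw [mem_unitaryGroup_iff']
  have key : ∀ a b, herm (phiUnitary p *ᵥ a) (phiUnitary p *ᵥ b) = herm a b := by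
    intro a b
    rw [phiUnitary_mulVec, phiUnitary_mulVec, herm_smul_left, herm_smul_right, herm_phiDeriv hp,
      Complex.conj_ofReal, ← mul_assoc, ← mul_assoc, ← sq, norm_wc_sq,
      mul_inv_cancel₀ (mul_ne_zero hw hw'), one_mul]
  have hh : ∀ a b : Fin n → ℂ, herm a b = star a ⬝ᵥ b := fun a b => rfl
  ext i j
  have := key (Pi.single i 1) (Pi.single j 1)
  rw [hh, hh, star_mulVec, ← dotProduct_mulVec, mulVec_mulVec, ← star_eq_conjTranspose] at this
  simpa [one_apply, Pi.single_apply, eq_comm] using this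

/-- The derivative of the CR inversion is `|w|⁻¹` times the real form of a unitary matrix. -/
theorem cx_phi_frame {n : ℕ} {p : Heis n} (hp : p ≠ 0) (v : Idx n → ℝ) :
    ‖wc p‖⁻¹ • realForm (phiUnitary p) *ᵥ v = rv (phiDeriv p (cx v)) := by
  have hw : (‖wc p‖ : ℂ) ≠ 0 := by simpa using wc_ne_zero hp
  apply cx_injective
  rw [cx_smul, cx_realForm, phiUnitary_mulVec, smul_smul, cx_rv]
  push_cast
  rw [inv_mul_cancel₀ hw, one_smul]

/-- Curves in `ℍⁿ` are differentiated through their coordinates `z` and `t`. -/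
theorem hasDerivAt_heis {n : ℕ} {γ : ℝ → Heis n} {Z : ℝ → Fin n → ℂ} {Z' : Fin n → ℂ}
    {q' : Heis n} {s : ℝ} (hZ : ∀ r, zc (γ r) = Z r) (h1 : HasDerivAt Z Z' s)
    (h2 : HasDerivAt (fun r => (γ r).2.2) q'.2.2 s) (hq : zc q' = Z') : HasDerivAt γ q' s := by
  have hre : ∀ i, HasDerivAt (fun r => (γ r).1 i) (q'.1 i) s := fun i => by
    have h3 := Complex.reCLM.hasFDerivAt.comp_hasDerivAt s (hasDerivAt_pi.1 h1 i)
    have e1 : (Complex.reCLM ∘ fun r => Z r i) = fun r => (γ r).1 i := by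
      funext r; simp [← hZ, zc]
    have e2 : Complex.reCLM (Z' i) = q'.1 i := by simp [← hq, zc]
    rwa [e1, e2] at h3
  have him : ∀ i, HasDerivAt (fun r => (γ r).2.1 i) (q'.2.1 i) s := fun i => by
    have h3 := Complex.imCLM.hasFDerivAt.comp_hasDerivAt s (hasDerivAt_pi.1 h1 i)
    have e1 : (Complex.imCLM ∘ fun r => Z r i) = fun r => (γ r).2.1 i := by
      funext r; simp [← hZ, zc]
    have e2 : Complex.imCLM (Z' i) = q'.2.1 i := by simp [← hq, zc]
    rwa [e1, e2] at h3
  exact (hasDerivAt_pi.2 hre).prodMk ((hasDerivAt_pi.2 him).prodMk h2)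

theorem hasDerivAt_zc_line {n : ℕ} (p : Heis n) (v : Idx n → ℝ) (s : ℝ) :
    HasDerivAt (fun r => zc (line p v r)) (cx v) s := by
  simp only [zc_line]
  have := ((Complex.ofRealCLM.hasDerivAt (x := s)).smul_const (cx v)).const_add (zc p)
  simpa using! this

theorem hasDerivAt_wc_line {n : ℕ} (p : Heis n) (v : Idx n → ℝ) (s : ℝ) :
    HasDerivAt (fun r => wc (line p v r)) (2 * Complex.I * herm (zc (line p v s)) (cx v)) s := by
  simp only [wc_line]
  have h0 : HasDerivAt (fun r : ℝ => (r : ℂ)) 1 s := by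
    simpa using! Complex.ofRealCLM.hasDerivAt (x := s)
  have := ((h0.mul_const (2 * Complex.I * herm (zc p) (cx v))).const_add (wc p)).add
    ((h0.pow 2).mul_const (Complex.I * ((v ⬝ᵥ v : ℝ) : ℂ)))
  refine this.congr_deriv ?_
  rw [zc_line, herm_add_left, herm_smul_left, herm_self]
  simp
  ring

/-- The CR inversion maps horizontal lines to horizontal curves. -/
theorem hasDerivAt_phi_line {n : ℕ} {p : Heis n} {v : Idx n → ℝ} {s : ℝ}
    (hs : line p v s ≠ 0) : HasDerivAt (fun r => phi (line p v r))
      (hvec (phi (line p v s)) (rv (phiDeriv (line p v s) (cx v)))) s := by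
  have hw := wc_ne_zero hs
  have hw' : conj (wc (line p v s)) ≠ 0 := by simpa using hw
  have h1 := (hasDerivAt_wc_line p v s).inv hw
  have h2 := h1.smul (hasDerivAt_zc_line p v s)
  refine hasDerivAt_heis (fun r => zc_phi _) h2 ?_ ?_
  · simp only [phi_snd_snd]
    have h3 := (Complex.reCLM.hasFDerivAt.comp_hasDerivAt s h1).neg
    refine h3.congr_deriv ?_
    rw [hvec_snd_snd, cx_rv, zc_phi]
    set q := line p v s
    have hz := wc_sub_conj q
    have key : herm (phiDeriv q (cx v)) ((wc q)⁻¹ • zc q) =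
        conj (herm (zc q) (cx v) / wc q ^ 2) := by
      simp only [phiDeriv, herm_smul_left, herm_smul_right, sub_eq_add_neg, ← neg_smul,
        herm_add_left, herm_zc_self, map_neg, map_mul, map_inv₀, Complex.conj_I, herm_conj,
        map_div₀, map_pow]
      have h2 : conj (2 : ℂ) = 2 := Complex.conj_ofNat 2
      rw [h2]
      have hN : (zsq q : ℂ) = (wc q - conj (wc q)) / (2 * Complex.I) := by
        rw [hz]; field_simp
      rw [hN]
      field_simp
      ring
    rw [key]
    have : -(2 * Complex.I * herm (zc q) (cx v)) / wc q ^ 2 =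
      (-2 * (herm (zc q) (cx v) / wc q ^ 2)) * Complex.I := by ring
    rw [this, Complex.conj_im]
    generalize herm (zc q) (cx v) / wc q ^ 2 = x
    simp
  · change cx (rv _) = _
    rw [cx_rv]
    ext i
    simp [phiDeriv]
    field_simp
    ring

theorem contDiff_zsq {n : ℕ} {k : WithTop ℕ∞} : ContDiff ℝ k (zsq (n := n)) := by
  unfold zsq; fun_prop

theorem contDiff_gauge4 {n : ℕ} {k : WithTop ℕ∞} : ContDiff ℝ k (gauge4 (n := n)) := by
  have := contDiff_zsq (n := n) (k := k)
  unfold gauge4; fun_prop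

theorem contDiff_wc {n : ℕ} {k : WithTop ℕ∞} : ContDiff ℝ k (wc (n := n)) := by
  have h : (wc (n := n)) = fun p => (p.2.2 : ℂ) + (zsq p : ℂ) * Complex.I := by
    funext p; apply Complex.ext <;> simp [wc]
  have h1 := Complex.ofRealCLM.contDiff (n := k)
  rw [h]
  exact (h1.comp (by fun_prop)).add ((h1.comp contDiff_zsq).mul contDiff_const)

theorem contDiffAt_norm_wc {n : ℕ} {p : Heis n} (hp : p ≠ 0) {k : WithTop ℕ∞} :
    ContDiffAt ℝ k (fun q : Heis n => ‖wc q‖) p :=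
  contDiff_wc.contDiffAt.norm ℝ (wc_ne_zero hp)

theorem contDiffAt_phi {n : ℕ} {p : Heis n} (hp : p ≠ 0) {k : WithTop ℕ∞} :
    ContDiffAt ℝ k (phi (n := n)) p := by
  have hg := (contDiff_gauge4 (n := n) (k := k)).contDiffAt (x := p)
  have hz := (contDiff_zsq (n := n) (k := k)).contDiffAt (x := p)
  have h0 := (gauge4_pos hp).ne'
  refine ContDiffAt.prodMk (contDiffAt_pi.2 fun i => ?_)
    (ContDiffAt.prodMk (contDiffAt_pi.2 fun i => ?_) ?_)
  · exact ContDiffAt.div (by fun_prop) hg h0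
  · exact ContDiffAt.div (by fun_prop) hg h0
  · exact ContDiffAt.div (by fun_prop) hg h0

/-- Leibniz rules for the horizontal gradient and Hessian. -/
theorem jet_mul {n : ℕ} {f g : Heis n → ℝ} {p : Heis n} (hf : ContDiffAt ℝ 2 f p)
    (hg : ContDiffAt ℝ 2 g p) :
    grad (fun q => f q * g q) p = f p • grad g p + g p • grad f p ∧
    ∀ v, v ⬝ᵥ hess (fun q => f q * g q) p *ᵥ v = f p * (v ⬝ᵥ hess g p *ᵥ v)
      + 2 * (grad f p ⬝ᵥ v) * (grad g p ⬝ᵥ v) + g p * (v ⬝ᵥ hess f p *ᵥ v) := by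
  have hdiff : ∀ {h : Heis n → ℝ} (_ : ContDiffAt ℝ 2 h p) (v : Idx n → ℝ),
      ∀ᶠ s in 𝓝 (0 : ℝ), DifferentiableAt ℝ (fun s => h (line p v s)) s := by
    intro h hh v
    have hcont : ContinuousAt (line p v) 0 := (hasDerivAt_line p v 0).continuousAt
    have : ∀ᶠ q in 𝓝 (line p v 0), ContDiffAt ℝ 2 h q := by
      rw [line_zero]; exact hh.eventually (by simp)
    filter_upwards [hcont.eventually this] with s hs
    exact (hasDerivAt_comp_horizontal (hs.differentiableAt (by norm_num))
      (hasDerivAt_line p v s)).differentiableAt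
  have key := fun v => hasDerivAt_comp_line (hf.mul hg) v
  refine ⟨eq_of_dot_eq fun v => ?_, fun v => ?_⟩
  · have h1 := (hasDerivAt_comp_line hf v).1.mul (hasDerivAt_comp_line hg v).1
    rw [line_zero] at h1
    rw [(key v).1.unique h1, add_dotProduct, smul_dotProduct, smul_dotProduct]
    simp only [smul_eq_mul]
    ring
  · obtain ⟨f1, f2⟩ := hasDerivAt_comp_line hf v
    obtain ⟨g1, g2⟩ := hasDerivAt_comp_line hg v
    have h2 := (f2.mul g1).add (f1.mul g2)
    have h3 : (deriv fun s => f (line p v s) * g (line p v s)) =ᶠ[𝓝 0]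
        (deriv fun s => f (line p v s)) * (fun s => g (line p v s)) +
        (fun s => f (line p v s)) * (deriv fun s => g (line p v s)) := by
      filter_upwards [hdiff hf v, hdiff hg v] with s hs ht
      exact deriv_fun_mul hs ht
    refine ((key v).2.unique (h2.congr_of_eventuallyEq h3)).trans ?_
    rw [f1.deriv, g1.deriv, line_zero]
    ring

theorem norm_wc_mul_self {n : ℕ} (p : Heis n) : ‖wc p‖ * ‖wc p‖ = gauge4 p := by
  rw [← normSq_wc, Complex.normSq_eq_norm_sq, sq]

theorem jet_gauge4 {n : ℕ} (p : Heis n) (v : Idx n → ℝ) :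
    grad gauge4 p ⬝ᵥ v = 2 * (conj (wc p) * (2 * Complex.I * herm (zc p) (cx v))).re ∧
    v ⬝ᵥ hess gauge4 p *ᵥ v = 2 * Complex.normSq (2 * Complex.I * herm (zc p) (cx v))
      + 4 * zsq p * (v ⬝ᵥ v) := by
  obtain ⟨h1, h2⟩ := hasDerivAt_comp_line (contDiff_gauge4.contDiffAt (x := p)) v
  set m := 2 * Complex.I * herm (zc p) (cx v)
  have e : (fun s => gauge4 (line p v s)) = fun s : ℝ => (p.2.2 + s * m.re) ^ 2
      + (zsq p + s * m.im + s ^ 2 * (v ⬝ᵥ v)) ^ 2 := by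
    funext s
    rw [← normSq_wc, wc_line, Complex.normSq_apply]
    simp only [m, Complex.add_re, Complex.add_im, Complex.re_ofReal_mul, Complex.im_ofReal_mul,
      ← Complex.ofReal_pow, Complex.I_mul_re, Complex.I_mul_im, Complex.ofReal_re,
      Complex.ofReal_im]
    simp only [wc]
    ring
  have hid : ∀ s : ℝ, HasDerivAt (fun s : ℝ => s) 1 s := hasDerivAt_id
  have hd : ∀ s : ℝ, HasDerivAt (fun s : ℝ => (p.2.2 + s * m.re) ^ 2
      + (zsq p + s * m.im + s ^ 2 * (v ⬝ᵥ v)) ^ 2)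
      (2 * (p.2.2 + s * m.re) * m.re + 2 * (zsq p + s * m.im + s ^ 2 * (v ⬝ᵥ v)) *
        (m.im + 2 * s * (v ⬝ᵥ v))) s := fun s => by
    have := ((((hid s).mul_const m.re).const_add p.2.2).pow 2).add
      (((((hid s).mul_const m.im).const_add (zsq p)).add
        (((hid s).pow 2).mul_const (v ⬝ᵥ v))).pow 2)
    refine this.congr_deriv ?_
    simp
  have hd2 : HasDerivAt (fun s : ℝ => 2 * (p.2.2 + s * m.re) * m.re +
      2 * (zsq p + s * m.im + s ^ 2 * (v ⬝ᵥ v)) * (m.im + 2 * s * (v ⬝ᵥ v)))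
      (2 * m.re ^ 2 + 2 * m.im ^ 2 + 4 * zsq p * (v ⬝ᵥ v)) 0 := by
    have := (((((hid 0).mul_const m.re).const_add p.2.2).const_mul 2).mul_const m.re).add
      ((((((hid 0).mul_const m.im).const_add (zsq p)).add
        (((hid 0).pow 2).mul_const (v ⬝ᵥ v))).const_mul 2).mul
        ((((hid 0).const_mul 2).mul_const (v ⬝ᵥ v)).const_add m.im))
    refine this.congr_deriv ?_
    simp
    ring
  rw [e] at h1 h2
  rw [show deriv _ = _ from funext fun s => (hd s).deriv] at h2
  refine ⟨(h1.unique (hd 0)).trans ?_, (h2.unique hd2).trans ?_⟩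
  · simp [wc]; ring
  · rw [Complex.normSq_apply]; ring

/-- The gradient and Hessian of `ρ = |w|` along horizontal directions. -/
theorem jet_norm_wc {n : ℕ} {p : Heis n} (hp : p ≠ 0) (v : Idx n → ℝ) :
    ‖wc p‖ * (grad (fun q => ‖wc q‖) p ⬝ᵥ v) =
      (conj (wc p) * (2 * Complex.I * herm (zc p) (cx v))).re ∧
    ‖wc p‖ * (v ⬝ᵥ hess (fun q => ‖wc q‖) p *ᵥ v) + (grad (fun q => ‖wc q‖) p ⬝ᵥ v) ^ 2 =
      Complex.normSq (2 * Complex.I * herm (zc p) (cx v)) + 2 * zsq p * (v ⬝ᵥ v) := by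
  have hρ := contDiffAt_norm_wc hp (k := 2)
  obtain ⟨h1, h2⟩ := jet_mul hρ hρ
  obtain ⟨h3, h4⟩ := jet_gauge4 p v
  simp only [norm_wc_mul_self] at h1 h2
  have h1' : grad gauge4 p ⬝ᵥ v = _ := congrArg (· ⬝ᵥ v) h1
  have h2' : v ⬝ᵥ hess gauge4 p *ᵥ v = _ := h2 v
  simp only [add_dotProduct, smul_dotProduct, smul_eq_mul] at h1'
  constructor <;> linarith

theorem cx_grad_norm_wc {n : ℕ} {p : Heis n} (hp : p ≠ 0) :
    grad (fun q => ‖wc q‖) p =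
      rv (((-2 * Complex.I * wc p) * (‖wc p‖ : ℂ)⁻¹) • zc p) := by
  have hw : ‖wc p‖ ≠ 0 := by simpa using wc_ne_zero hp
  refine eq_of_dot_eq fun v => mul_left_cancel₀ hw ?_
  rw [(jet_norm_wc hp v).1, dot_eq_re_herm, cx_rv, herm_smul_left, ← Complex.re_ofReal_mul]
  congr 1
  have h2 : conj (2 : ℂ) = 2 := Complex.conj_ofNat 2
  have hw' : (‖wc p‖ : ℂ) ≠ 0 := by exact_mod_cast hw
  simp only [map_mul, map_neg, h2, Complex.conj_I, map_inv₀, Complex.conj_ofReal]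
  field_simp

theorem hasDerivAt_rv {n : ℕ} {Z : ℝ → Fin n → ℂ} {Z' : Fin n → ℂ} {s : ℝ}
    (h : HasDerivAt Z Z' s) : HasDerivAt (fun r => rv (Z r)) (rv Z') s := by
  refine hasDerivAt_pi.2 fun a => ?_
  rcases a with i | i
  · exact Complex.reCLM.hasFDerivAt.comp_hasDerivAt s (hasDerivAt_pi.1 h i)
  · exact Complex.imCLM.hasFDerivAt.comp_hasDerivAt s (hasDerivAt_pi.1 h i)

/-- The acceleration of the image of a horizontal line under the CR inversion. -/
theorem hasDerivAt_phiDeriv_line {n : ℕ} {p : Heis n} (hp : p ≠ 0) (v : Idx n → ℝ) :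
    HasDerivAt (fun s => phiDeriv (line p v s) (cx v))
      (-(2 * Complex.I * ((v ⬝ᵥ v : ℝ) : ℂ) * (wc p)⁻¹ ^ 2) • zc p
        - (4 * Complex.I * herm (zc p) (cx v) * (wc p)⁻¹) • phiDeriv p (cx v)) 0 := by
  have hw := wc_ne_zero hp
  have hZ := hasDerivAt_zc_line p v 0
  have hW := (hasDerivAt_wc_line p v 0).inv (by rw [line_zero]; exact hw)
  have hH : HasDerivAt (fun s => herm (zc (line p v s)) (cx v)) ((v ⬝ᵥ v : ℝ) : ℂ) 0 := by
    have h0 : HasDerivAt (fun r : ℝ => (r : ℂ)) 1 0 := by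
      simpa using! Complex.ofRealCLM.hasDerivAt (x := (0 : ℝ))
    have h1 := (h0.mul_const ((v ⬝ᵥ v : ℝ) : ℂ)).const_add (herm (zc p) (cx v))
    refine (h1.congr_of_eventuallyEq (.of_forall fun s => ?_)).congr_deriv (by simp)
    simp only [zc_line, herm_add_left, herm_smul_left, herm_self, Complex.conj_ofReal]
  have h := hW.smul (((((hH.const_mul (2 * Complex.I)).mul hW).smul hZ).const_sub (cx v)))
  refine (h.congr_of_eventuallyEq (.of_forall fun s => rfl)).congr_deriv ?_
  ext i
  simp [phiDeriv]
  field_simp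
  ring

theorem conformalContactAt_phi {n : ℕ} {p : Heis n} (hp : p ≠ 0) :
    ConformalContactAt phi p ‖wc p‖⁻¹ (realForm (phiUnitary p)) where
  pos := inv_pos.2 (norm_pos_iff.2 (wc_ne_zero hp))
  orth := realForm_transpose_mul (phiUnitary_mem hp)
  diff := (contDiffAt_phi hp (k := 1)).differentiableAt (by norm_num)
  horizontal v := by
    have hd := ((contDiffAt_phi hp (k := 1)).differentiableAt (by norm_num)).hasFDerivAt
    have h1 := hd.comp_hasDerivAt_of_eq (0 : ℝ) (hasDerivAt_line p v 0) (by simp)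
    have h2 := hasDerivAt_phi_line (p := p) (v := v) (s := 0) (by rwa [line_zero])
    rw [line_zero] at h1 h2
    rw [cx_phi_frame hp]
    exact h1.unique h2
  vertical := by
    have hw := wc_ne_zero hp
    have hw' : conj (wc p) ≠ 0 := by simpa using hw
    have hd := ((contDiffAt_phi hp (k := 1)).differentiableAt (by norm_num)).hasFDerivAt
    have hl : HasDerivAt (fun s : ℝ => p + s • ((0, 0, 1) : Heis n)) (0, 0, 1) 0 := by
      simpa using! ((hasDerivAt_id (0 : ℝ)).smul_const ((0, 0, 1) : Heis n)).const_add p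
    have h1 := hd.comp_hasDerivAt_of_eq (0 : ℝ) hl (by simp)
    refine ⟨rv (-((wc p)⁻¹ ^ 2) • zc p), ‖wc p‖⁻¹ ^ 2, h1.unique ?_, abs_of_nonneg (by positivity)⟩
    have hz : ∀ s : ℝ, zc (p + s • ((0, 0, 1) : Heis n)) = zc p := fun s => by
      ext i; simp [zc]
    have hwc : ∀ s : ℝ, wc (p + s • ((0, 0, 1) : Heis n)) = wc p + s := fun s => by
      apply Complex.ext <;> simp [wc, zsq]
    have h0 : HasDerivAt (fun r : ℝ => (r : ℂ)) 1 0 := by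
      simpa using! Complex.ofRealCLM.hasDerivAt (x := (0 : ℝ))
    have hW := (h0.const_add (wc p)).inv (by simpa using hw)
    refine hasDerivAt_heis (Z := fun s : ℝ => (wc p + s)⁻¹ • zc p)
      (Z' := -((wc p)⁻¹ ^ 2) • zc p) (fun s => ?_) ?_ ?_ ?_
    · simp only [Function.comp_apply, zc_phi, hz, hwc]
    · refine (hW.smul_const (zc p)).congr_deriv ?_
      congr 1
      simp [div_eq_mul_inv]
    · have h2 := (Complex.reCLM.hasFDerivAt.comp_hasDerivAt (0 : ℝ) hW).neg
      refine (h2.congr_of_eventuallyEq (.of_forall fun s => ?_)).congr_deriv ?_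
      · simp only [Function.comp_apply, phi_snd_snd, hwc]
        rfl
      · have hN : (zsq p : ℂ) = (wc p - conj (wc p)) / (2 * Complex.I) := by
          rw [wc_sub_conj]; field_simp
        -- `-2i` times the Hermitian product is `conj(w)⁻² - |w|⁻²`
        have key : herm (-((wc p)⁻¹ ^ 2) • zc p) (zc (phi p)) =
            (((conj (wc p))⁻¹ ^ 2 - ((‖wc p‖ : ℂ)⁻¹ ^ 2)) / 2) * Complex.I := by
          rw [zc_phi, herm_smul_left, herm_smul_right, herm_zc_self, hN, inv_pow, inv_pow _ 2,
            inv_pow _ 2, norm_wc_sq]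
          simp only [map_neg, map_inv₀, map_pow]
          field_simp
          ring_nf
          simp only [Complex.I_sq]
          ring
        rw [Prod.snd_add, Prod.snd_add, hvec_snd_snd, cx_rv, key]
        have e1 : (conj (wc p))⁻¹ ^ 2 = conj ((wc p)⁻¹ ^ 2) := by simp
        have e2 : ((‖wc p‖ : ℂ)⁻¹ ^ 2) = ((‖wc p‖⁻¹ ^ 2 : ℝ) : ℂ) := by push_cast; rfl
        have e3 : ∀ x : ℂ, (x * Complex.I).im = x.re := fun x => by simp
        rw [e3, e1, e2, Complex.div_ofNat_re, Complex.sub_re, Complex.conj_re, Complex.ofReal_re]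
        simp [div_eq_mul_inv]
        ring
    · have : ∀ a b : Heis n, zc (a + b) = zc a + zc b := fun a b => by
        ext i; apply Complex.ext <;> simp [zc]
      rw [this]
      have h3 : zc ((0, 0, ‖wc p‖⁻¹ ^ 2) : Heis n) = 0 := by
        ext i; simp [zc]; rfl
      rw [h3, add_zero]
      exact cx_rv _

theorem dot_rv {n : ℕ} (a : Idx n → ℝ) (b : Fin n → ℂ) :
    a ⬝ᵥ rv b = (herm (cx a) b).re := by
  rw [dot_eq_re_herm, cx_rv]

/-- The horizontal jet of `h ∘ φ`. -/
theorem jet_comp_phi {n : ℕ} {h : Heis n → ℝ} {p : Heis n} (hp : p ≠ 0)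
    (hh : ContDiffAt ℝ 2 h (phi p)) (v : Idx n → ℝ) :
    grad (fun q => h (phi q)) p ⬝ᵥ v = (herm (cx (grad h (phi p))) (phiDeriv p (cx v))).re ∧
    v ⬝ᵥ hess (fun q => h (phi q)) p *ᵥ v =
      (herm (cx (grad h (phi p))) (-(2 * Complex.I * ((v ⬝ᵥ v : ℝ) : ℂ) * (wc p)⁻¹ ^ 2) • zc p
        - (4 * Complex.I * herm (zc p) (cx v) * (wc p)⁻¹) • phiDeriv p (cx v))).re
      + rv (phiDeriv p (cx v)) ⬝ᵥ hess h (phi p) *ᵥ rv (phiDeriv p (cx v)) := by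
  obtain ⟨h1, h2⟩ := hasDerivAt_comp_line (hh.comp p (contDiffAt_phi hp)) v
  have hne : ∀ᶠ s in 𝓝 (0 : ℝ), line p v s ≠ 0 :=
    (hasDerivAt_line p v 0).continuousAt.eventually_ne (by rwa [line_zero])
  have hcurve : ∀ᶠ s in 𝓝 (0 : ℝ), HasDerivAt (fun r => phi (line p v r))
      (hvec (phi (line p v s)) (rv (phiDeriv (line p v s) (cx v)))) s := by
    filter_upwards [hne] with s hs
    exact hasDerivAt_phi_line hs
  have hh' : ContDiffAt ℝ 2 h (phi (line p v 0)) := by rwa [line_zero]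
  have h3 := hasDerivAt_comp_horizontal (hh'.differentiableAt (by norm_num)) hcurve.self_of_nhds
  have h4 := (deriv_deriv_comp_horizontal (γ := fun r => phi (line p v r)) hh' hcurve
    (hasDerivAt_rv (hasDerivAt_phiDeriv_line hp v))).2
  simp only [line_zero, dot_rv] at h3 h4
  exact ⟨h1.unique h3, h2.unique h4⟩

theorem smul_add_dot_self {ι : Type*} [Fintype ι] (a b : ι → ℝ) (k l : ℝ) :
    (k • a + l • b) ⬝ᵥ (k • a + l • b) =
      k ^ 2 * (a ⬝ᵥ a) + 2 * k * l * (a ⬝ᵥ b) + l ^ 2 * (b ⬝ᵥ b) := by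
  simp only [add_dotProduct, dotProduct_add, smul_dotProduct, dotProduct_smul, smul_eq_mul,
    dotProduct_comm b a]
  ring

/-- The conformal covariance of the tensor under the CR inversion. Both sides are compared as
quadratic forms at `v`, by expanding the horizontal jet of `ρ (h ∘ φ)` with `ρ = |w|`: the terms
quadratic in `h` vanish, those linear in `h` and linear in its gradient cancel, and what remains is
the tensor of `h` at `φ(p)`. -/
theorem conf_mul_comp_phi {n : ℕ} {h : Heis n → ℝ} {p : Heis n} (hp : p ≠ 0)
    (hh : ContDiffAt ℝ 2 h (phi p)) :
    conf (fun q => ‖wc q‖ * h (phi q)) p =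
      (realForm (phiUnitary p))ᵀ * conf h (phi p) * realForm (phiUnitary p) := by
  have hw := wc_ne_zero hp
  have hw' : conj (wc p) ≠ 0 := by simpa using hw
  have hr : ‖wc p‖ ≠ 0 := norm_ne_zero_iff.2 hw
  have hrc : (‖wc p‖ : ℂ) ≠ 0 := by exact_mod_cast hr
  have hr2 := norm_wc_sq p
  have horth := realForm_transpose_mul (phiUnitary_mem hp)
  refine conf_eq_of_quadratic fun v => ?_
  set O := realForm (phiUnitary p) with hO
  set a := grad h (phi p) with ha
  set N := zsq p with hNdef
  have hOv : ∀ v : Idx n → ℝ, O *ᵥ v = ‖wc p‖ • rv (phiDeriv p (cx v)) := fun v => by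
    rw [← cx_phi_frame hp, smul_smul, mul_inv_cancel₀ hr, one_smul]
  -- the jets of `ρ = |w|`, of `h ∘ φ` and of the product
  obtain ⟨m1, m2⟩ := jet_mul (contDiffAt_norm_wc hp) (hh.comp p (contDiffAt_phi hp))
  have g1 : ∀ v, grad (fun q => h (phi q)) p ⬝ᵥ v = (herm (cx a) (phiDeriv p (cx v))).re :=
    fun v => (jet_comp_phi hp hh v).1
  have g2 := (jet_comp_phi hp hh v).2
  obtain ⟨r1, r2⟩ := jet_norm_wc hp v
  have r1J := (jet_norm_wc hp (matJ n *ᵥ v)).1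
  have m1' : grad (fun q => ‖wc q‖ * h (phi q)) p = ‖wc p‖ • grad (fun q => h (phi q)) p
      + h (phi p) • grad (fun q => ‖wc q‖) p := m1
  have m2' := m2 v
  have hcomp : h ∘ phi = fun q => h (phi q) := rfl
  simp only [hcomp] at m2'
  have hgrad : grad (fun q => h (phi q)) p = ‖wc p‖⁻¹ • (Oᵀ *ᵥ a) := by
    refine eq_of_dot_eq fun w => ?_
    rw [g1, smul_dotProduct, mulVec_transpose, ← dotProduct_mulVec, hOv, dotProduct_smul, dot_rv]
    simp only [smul_eq_mul]
    field_simp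
  have hgg : grad (fun q => h (phi q)) p ⬝ᵥ grad (fun q => h (phi q)) p =
      ‖wc p‖⁻¹ ^ 2 * (a ⬝ᵥ a) := by
    rw [hgrad, smul_dotProduct, dotProduct_smul, mulVec_transpose, ← dotProduct_mulVec,
      ← mulVec_transpose, mulVec_mulVec, mul_eq_one_comm.1 horth, one_mulVec]
    simp only [smul_eq_mul]
    ring
  have hgρ := cx_grad_norm_wc hp
  have hρρ : grad (fun q => ‖wc q‖) p ⬝ᵥ grad (fun q => ‖wc q‖) p = 4 * N := by
    have h2 : conj (2 : ℂ) = 2 := Complex.conj_ofNat 2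
    rw [hgρ, dot_rv, cx_rv, herm_smul_left, herm_smul_right, herm_zc_self, ← mul_assoc]
    have : conj (-2 * Complex.I * wc p * (‖wc p‖ : ℂ)⁻¹) *
        (-2 * Complex.I * wc p * (‖wc p‖ : ℂ)⁻¹) = 4 := by
      simp only [map_mul, map_neg, map_inv₀, Complex.conj_ofReal, h2, Complex.conj_I]
      have hk : (‖wc p‖ : ℂ)⁻¹ ^ 2 * (wc p * conj (wc p)) = 1 := by
        rw [← hr2]; field_simp
      linear_combination (-4 * Complex.I ^ 2) * hk - 4 * Complex.I_sq
    rw [this]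
    simp [N]
  set X := herm (cx a) (phiDeriv p (cx v)) with hX
  set Y := herm (cx a) (zc p) with hY
  set μ := herm (zc p) (cx v) with hμ
  have hsub := wc_sub_conj p
  have hHρ : grad (fun q => h (phi q)) p ⬝ᵥ grad (fun q => ‖wc q‖) p =
      (-2 * Complex.I * conj (wc p) * (wc p)⁻¹ * Y * (‖wc p‖ : ℂ)⁻¹).re := by
    rw [g1, hgρ, cx_rv, phiDeriv_smul, herm_smul_right, phiDeriv, herm_smul_right, herm_sub_right,
      herm_smul_right, herm_zc_self]
    congr 1
    have : conj (wc p) = wc p - 2 * Complex.I * (zsq p : ℂ) := by rw [← hsub]; ring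
    rw [this, ← hY]
    field_simp
  have hgJ : grad (fun q => h (phi q)) p ⬝ᵥ matJ n *ᵥ v = X.im := by
    rw [g1, cx_matJ, phiDeriv_smul, herm_smul_right]
    simp [X]
  rw [cx_matJ, herm_smul_right] at r1J
  have hR : (‖wc p‖ : ℂ) * ((grad (fun q => ‖wc q‖) p ⬝ᵥ v : ℝ) +
      (grad (fun q => ‖wc q‖) p ⬝ᵥ matJ n *ᵥ v : ℝ) * Complex.I) =
      conj (wc p) * (2 * Complex.I * μ) := by
    apply Complex.ext
    · rw [Complex.re_ofReal_mul, ← r1]; simp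
    · have : (conj (wc p) * (2 * Complex.I * μ)).im =
          (conj (wc p) * (2 * Complex.I * (-Complex.I * μ))).re := by simp; ring
      rw [this, Complex.im_ofReal_mul, ← r1J]; simp
  rw [dot_conf, dot_conf, m2', m1', smul_add_dot_self, add_dotProduct, smul_dotProduct,
    smul_dotProduct, hgJ, hgg, hρρ, hHρ, orth_dot horth, mulVec_mulVec _ (matJ n) O,
    ← realForm_mul_matJ, ← mulVec_mulVec, hOv, hOv]
  have hE : (herm (cx a) (-(2 * Complex.I * ((v ⬝ᵥ v : ℝ) : ℂ) * (wc p)⁻¹ ^ 2) • zc p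
      - (4 * Complex.I * μ * (wc p)⁻¹) • phiDeriv p (cx v))).re =
      (-2 * Complex.I * (wc p)⁻¹ ^ 2 * Y).re * (v ⬝ᵥ v)
        + (-4 * Complex.I * μ * (wc p)⁻¹ * X).re := by
    rw [herm_sub_right, herm_smul_right, herm_smul_right, ← Complex.re_mul_ofReal,
      ← Complex.add_re]
    congr 1
    ring
  set R := grad (fun q => ‖wc q‖) p ⬝ᵥ v
  set S := grad (fun q => ‖wc q‖) p ⬝ᵥ matJ n *ᵥ v
  -- the terms quadratic in `h`: the function `ρ` itself has vanishing tensor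
  have key1 : R ^ 2 + S ^ 2 = Complex.normSq (2 * Complex.I * μ) := by
    have h1 := congrArg Complex.normSq hR
    rw [map_mul, map_mul, Complex.normSq_conj, Complex.normSq_ofReal, Complex.normSq_add_mul_I,
      Complex.normSq_eq_norm_sq (wc p), ← sq] at h1
    exact mul_left_cancel₀ (pow_ne_zero 2 hr) h1
  -- the terms linear in `h` and in its gradient
  have key2 : ‖wc p‖ * (-4 * Complex.I * μ * (wc p)⁻¹ * X).re = -2 * (R * X.re - S * X.im) := by
    have h1 : (‖wc p‖ : ℂ) * (-4 * Complex.I * μ * (wc p)⁻¹ * X) =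
        -2 * ((R + S * Complex.I) * X) := by
      have h2 : 2 * Complex.I * μ = (conj (wc p))⁻¹ * (‖wc p‖ * (R + S * Complex.I)) := by
        rw [hR]; field_simp
      have h3 : -4 * Complex.I * μ * (wc p)⁻¹ * X = -2 * (2 * Complex.I * μ) * (wc p)⁻¹ * X := by
        ring
      have h4 : (‖wc p‖ : ℂ) ^ 2 * ((wc p)⁻¹ * (conj (wc p))⁻¹) = 1 := by
        rw [hr2]; field_simp
      rw [h3, h2]
      linear_combination (-2 * (R + S * Complex.I) * X) * h4
    have h2 := congrArg Complex.re h1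
    rw [Complex.re_ofReal_mul] at h2
    rw [h2]
    simp
  have key3 : ‖wc p‖ * (-2 * Complex.I * (wc p)⁻¹ ^ 2 * Y).re =
      (-2 * Complex.I * conj (wc p) * (wc p)⁻¹ * Y * (‖wc p‖ : ℂ)⁻¹).re := by
    rw [← Complex.re_ofReal_mul]
    congr 1
    have h4 : (‖wc p‖ : ℂ) * (wc p)⁻¹ = conj (wc p) * (‖wc p‖ : ℂ)⁻¹ := by
      field_simp
      rw [hr2]
    linear_combination (-2 * Complex.I * (wc p)⁻¹ * Y) * h4
  have hlast : a ⬝ᵥ ‖wc p‖ • rv (phiDeriv p (cx (matJ n *ᵥ v))) = ‖wc p‖ * X.im := by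
    rw [dotProduct_smul, dot_rv, ← g1, hgJ, smul_eq_mul]
  have g2' := g2.trans (congrArg (· + _) hE)
  have hrr : ‖wc p‖ ^ 2 * ‖wc p‖⁻¹ ^ 2 = 1 := by field_simp
  rw [hlast, g1, g2', mulVec_smul, smul_dotProduct, dotProduct_smul]
  simp only [smul_eq_mul]
  linear_combination (‖wc p‖ * h (phi p) * (v ⬝ᵥ v)) * key3 + ‖wc p‖ * h (phi p) * key2
    + h (phi p) ^ 2 * (r2 - key1) - 1 / 2 * (a ⬝ᵥ a) * (v ⬝ᵥ v) * hrr

theorem contDiffAt_transform_phi {n : ℕ} {f : Heis n → ℝ} {p : Heis n} (hp : p ≠ 0)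
    (hf : ContDiffAt ℝ 2 f (phi p)) : ContDiffAt ℝ 2 (transform phi f) p := by
  have htr : transform phi f =ᶠ[𝓝 p] fun q => ‖wc q‖⁻¹ ^ n * f (phi q) := by
    filter_upwards [eventually_ne_nhds hp] with q hq
    exact (conformalContactAt_phi hq).transform_eq f
  exact ((((contDiffAt_norm_wc hp).inv (norm_ne_zero_iff.2 (wc_ne_zero hp))).pow n).mul
      (hf.comp p (contDiffAt_phi hp))).congr_of_eventuallyEq htr

theorem transform_phi_pos {n : ℕ} {f : Heis n → ℝ} {p : Heis n} (hp : p ≠ 0)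
    (hf : 0 < f (phi p)) : 0 < transform phi f p := by
  rw [(conformalContactAt_phi hp).transform_eq]
  have := norm_pos_iff.2 (wc_ne_zero hp)
  positivity

theorem pot_transform_phi {n : ℕ} (hn : 1 ≤ n) {f : Heis n → ℝ} {p : Heis n} (hp : p ≠ 0)
    (hf : ContDiffAt ℝ 2 f (phi p)) (hpos : 0 < f (phi p)) :
    pot (transform phi f) =ᶠ[𝓝 p] fun q => ‖wc q‖ * pot f (phi q) := by
  have : ∀ᶠ q in 𝓝 p, 0 < f (phi q) :=
    (hf.continuousAt.comp (contDiffAt_phi hp (k := 2)).continuousAt).eventually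
      (lt_mem_nhds hpos)
  filter_upwards [this, eventually_ne_nhds hp] with q hq hq0
  rw [(conformalContactAt_phi hq0).pot_transform hn hq, inv_inv]

/-- Composition with the CR inversion rotates the tensor by the unitary part of the derivative. -/
theorem tensorA_transform_phi {n : ℕ} (hn : 1 ≤ n) {u : Heis n → ℝ} {p : Heis n} (hp : p ≠ 0)
    (hu : ContDiffAt ℝ 2 u (phi p)) (hpos : 0 < u (phi p)) :
    tensorA (transform phi u) p =
      (realForm (phiUnitary p))ᵀ * tensorA u (phi p) * realForm (phiUnitary p) := by
  have hev := pot_transform_phi hn hp hu hpos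
  have hconf : conf (pot (transform phi u)) p = conf (fun q => ‖wc q‖ * pot u (phi q)) p := by
    simp [conf, hessSym_congr hev, grad_congr hev, hev.eq_of_nhds]
  rw [tensorA_eq_conf hn (contDiffAt_transform_phi hp hu) (transform_phi_pos hp hpos),
    tensorA_eq_conf hn hu hpos, hconf, conf_mul_comp_phi hp (contDiffAt_pot hu hpos)]

/-! ### Smoothness of CR maps -/

/-- Homogeneous coordinates `(1, z, w)` of the point `(z, t)` with `w = t + i |z|²`, and `(0, 0, 1)`
of the point at infinity. -/
noncomputable def lift {n : ℕ} (q : OnePoint (Heis n)) : ℂ × (Fin n → ℂ) × ℂ :=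
  q.elim (0, 0, 1) fun p => (1, zc p, wc p)

@[simp] theorem lift_coe {n : ℕ} (p : Heis n) : lift (p : OnePoint (Heis n)) = (1, zc p, wc p) :=
  rfl

@[simp] theorem lift_infty {n : ℕ} : lift (OnePoint.infty : OnePoint (Heis n)) = (0, 0, 1) := rfl

/-- The map `g` is induced in homogeneous coordinates by a real linear map that preserves complex
lines (it is complex linear, or conjugate linear when `g` reverses the complex structure). -/
def HasLinearLift {n : ℕ} (g : Equiv.Perm (OnePoint (Heis n))) : Prop :=
  ∃ L : (ℂ × (Fin n → ℂ) × ℂ) →ₗ[ℝ] (ℂ × (Fin n → ℂ) × ℂ),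
    (∀ (c : ℂ) v, c ≠ 0 → ∃ c' : ℂ, c' ≠ 0 ∧ L (c • v) = c' • L v) ∧
    ∀ q, ∃ c : ℂ, c ≠ 0 ∧ L (lift q) = c • lift (g q)

theorem HasLinearLift.mul {n : ℕ} {g h : Equiv.Perm (OnePoint (Heis n))} (hg : HasLinearLift g)
    (hh : HasLinearLift h) : HasLinearLift (g * h) := by
  obtain ⟨L, hL, hLg⟩ := hg
  obtain ⟨K, hK, hKh⟩ := hh
  refine ⟨L ∘ₗ K, fun c v hc => ?_, fun q => ?_⟩
  · obtain ⟨c', hc', h1⟩ := hK c v hc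
    obtain ⟨c'', hc'', h2⟩ := hL c' (K v) hc'
    exact ⟨c'', hc'', by simp [h1, h2]⟩
  · obtain ⟨c, hc, h1⟩ := hKh q
    obtain ⟨c', hc', h2⟩ := hL c (lift (h q)) hc
    obtain ⟨d, hd, h3⟩ := hLg (h q)
    exact ⟨c' * d, mul_ne_zero hc' hd, by
      rw [LinearMap.comp_apply, h1, h2, h3, smul_smul, Equiv.Perm.mul_apply]⟩

@[simp] theorem extend_coe {n : ℕ} (e : Heis n ≃ Heis n) (p : Heis n) :
    extend e (p : OnePoint (Heis n)) = (e p : OnePoint (Heis n)) := rfl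

@[simp] theorem extend_infty {n : ℕ} (e : Heis n ≃ Heis n) :
    extend e (OnePoint.infty : OnePoint (Heis n)) = OnePoint.infty := rfl

theorem hasLinearLift_translation {n : ℕ} (a : Heis n) :
    HasLinearLift (extend (translation a)) := by
  refine ⟨{ toFun := fun v => (v.1, v.2.1 + v.1 • zc a,
              v.2.2 + v.1 * wc a + 2 * Complex.I * herm (zc a) v.2.1)
            map_add' := fun v w => ?_
            map_smul' := fun k v => ?_ }, fun c v hc => ⟨c, hc, ?_⟩, fun q => ⟨1, one_ne_zero, ?_⟩⟩
  · refine Prod.ext rfl (Prod.ext ?_ ?_)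
    · simp [add_smul]; abel
    · simp [herm_add_right]; ring
  · refine Prod.ext rfl (Prod.ext ?_ ?_)
    · ext i; simp; ring
    · have : herm (zc a) (k • v.2.1) = k * herm (zc a) v.2.1 := herm_smul_right (k : ℂ) _ _
      simp [this]; ring
  · refine Prod.ext rfl (Prod.ext ?_ ?_)
    · simp [smul_smul]
    · simp [herm_smul_right]; ring
  · induction q using OnePoint.rec with
    | infty => simp [herm]
    | coe p =>
      have hz : zc (translation a p) = zc a + zc p := by
        ext i; apply Complex.ext <;> simp [zc, translation, op]
      have hw : wc (translation a p) = wc p + wc a + 2 * Complex.I * herm (zc a) (zc p) := by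
        apply Complex.ext
        · simp [wc, translation, op, herm, zc, Finset.sum_add_distrib, Finset.sum_sub_distrib]
          ring
        · change zsq (translation a p) = _
          have h1 : ((zsq (translation a p) : ℝ) : ℂ) = _ := (herm_zc_self _).symm
          rw [hz, herm_add_left, herm_add_right, herm_add_right, herm_zc_self, herm_zc_self,
            ← herm_conj (zc a) (zc p)] at h1
          have h2 := congrArg Complex.re h1
          simp at h2
          rw [h2]; simp [wc]; ring
      simp [hz, hw, add_comm]

theorem hasLinearLift_dilation {n : ℕ} (l : ℝ) (hl : 0 < l) :
    HasLinearLift (extend (dilation (n := n) l hl)) := by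
  refine ⟨{ toFun := fun v => (v.1, (l : ℂ) • v.2.1, (l : ℂ) ^ 2 * v.2.2)
            map_add' := fun v w => ?_
            map_smul' := fun k v => ?_ }, fun c v hc => ⟨c, hc, ?_⟩, fun q => ?_⟩
  · refine Prod.ext rfl (Prod.ext ?_ ?_) <;> simp [mul_add]
  · refine Prod.ext rfl (Prod.ext ?_ ?_)
    · ext i; simp; ring
    · simp; ring
  · refine Prod.ext rfl (Prod.ext ?_ ?_)
    · ext i; simp; ring
    · simp; ring
  · induction q using OnePoint.rec with
    | infty => exact ⟨(l : ℂ) ^ 2, by simp [hl.ne'], by simp⟩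
    | coe p =>
      have hz : zc (dilation l hl p) = (l : ℂ) • zc p := by
        ext i; apply Complex.ext <;> simp [zc, dilation]
      have hw : wc (dilation l hl p) = (l : ℂ) ^ 2 * wc p := by
        rw [← Complex.ofReal_pow]
        apply Complex.ext
        · rw [Complex.re_ofReal_mul]; simp [wc, dilation]
        · rw [Complex.im_ofReal_mul]
          simp only [wc, dilation, zsq, Equiv.coe_fn_mk, Pi.smul_apply, smul_eq_mul,
            Finset.mul_sum]
          exact Finset.sum_congr rfl fun i _ => by ring
      exact ⟨1, one_ne_zero, by simp [hz, hw]⟩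

theorem hasLinearLift_rotation {n : ℕ} (M : unitaryGroup (Fin n) ℂ) :
    HasLinearLift (extend (rotation M)) := by
  refine ⟨{ toFun := fun v => (v.1, (M : Matrix (Fin n) (Fin n) ℂ) *ᵥ v.2.1, v.2.2)
            map_add' := fun v w => ?_
            map_smul' := fun k v => ?_ }, fun c v hc => ⟨c, hc, ?_⟩, fun q => ⟨1, one_ne_zero, ?_⟩⟩
  · refine Prod.ext rfl (Prod.ext ?_ rfl)
    simp [mulVec_add]
  · refine Prod.ext rfl (Prod.ext ?_ rfl)
    simp [mulVec_smul]
  · refine Prod.ext rfl (Prod.ext ?_ rfl)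
    simp [mulVec_smul]
  · induction q using OnePoint.rec with
    | infty => simp
    | coe p =>
      have hz : zc (rotation M p) = (M : Matrix (Fin n) (Fin n) ℂ) *ᵥ zc p := rfl
      have hw : wc (rotation M p) = wc p := by
        apply Complex.ext
        · rfl
        · change zsq (rotation M p) = zsq p
          have := herm_zc_self (rotation M p)
          rw [hz, herm_unitary M.2, herm_zc_self] at this
          exact_mod_cast this.symm
      simp [hz, hw]

theorem hasLinearLift_inversion (n : ℕ) : HasLinearLift (extend (inversion n)) := by
  refine ⟨{ toFun := fun v => (conj v.1, fun i => conj (v.2.1 i), -conj v.2.2)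
            map_add' := fun v w => ?_
            map_smul' := fun k v => ?_ }, fun c v hc => ⟨conj c, by simpa using hc, ?_⟩,
          fun q => ?_⟩
  · refine Prod.ext ?_ (Prod.ext ?_ ?_)
    · simp
    · ext i; simp
    · simp; ring
  · refine Prod.ext ?_ (Prod.ext ?_ ?_)
    · simp
    · ext i; simp
    · simp
  · refine Prod.ext ?_ (Prod.ext ?_ ?_)
    · simp
    · ext i; simp
    · simp
  · induction q using OnePoint.rec with
    | infty => exact ⟨-1, by simp, by ext <;> simp⟩
    | coe p =>
      refine ⟨1, one_ne_zero, ?_⟩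
      have hz : zc (inversion n p) = fun i => conj (zc p i) := by
        ext i; apply Complex.ext <;> simp [zc, inversion]
      have hw : wc (inversion n p) = -conj (wc p) := by
        apply Complex.ext <;> simp [wc, inversion, zsq]
      simp [hz, hw]

theorem wc_phi {n : ℕ} (p : Heis n) (hp : p ≠ 0) : wc (phi p) = -(wc p)⁻¹ := by
  apply Complex.ext
  · rw [Complex.neg_re, ← phi_snd_snd]; rfl
  · change zsq (phi p) = _
    rw [zsq_phi hp, Complex.neg_im, Complex.inv_im, normSq_wc]
    simp [wc]
    ring

theorem crInversion_coe {n : ℕ} {p : Heis n} (hp : p ≠ 0) :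
    crInversion n (p : OnePoint (Heis n)) = (phi p : OnePoint (Heis n)) := if_neg hp

@[simp] theorem crInversion_zero {n : ℕ} :
    crInversion n ((0 : Heis n) : OnePoint (Heis n)) = OnePoint.infty := if_pos rfl

@[simp] theorem crInversion_infty {n : ℕ} :
    crInversion n OnePoint.infty = ((0 : Heis n) : OnePoint (Heis n)) := rfl

theorem hasLinearLift_crInversion (n : ℕ) : HasLinearLift (crInversion n) := by
  refine ⟨{ toFun := fun v => (v.2.2, v.2.1, -v.1)
            map_add' := fun v w => ?_
            map_smul' := fun k v => ?_ }, fun c v hc => ⟨c, hc, ?_⟩, fun q => ?_⟩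
  · refine Prod.ext rfl (Prod.ext rfl ?_)
    simp; ring
  · refine Prod.ext rfl (Prod.ext rfl ?_)
    simp
  · refine Prod.ext rfl (Prod.ext rfl ?_)
    simp
  · have h0 : zc (0 : Heis n) = 0 := rfl
    have h1 : wc (0 : Heis n) = 0 := by apply Complex.ext <;> simp [wc, zsq]
    induction q using OnePoint.rec with
    | infty => exact ⟨1, one_ne_zero, by simp [h0, h1]⟩
    | coe p =>
      by_cases hp : p = 0
      · subst hp
        exact ⟨-1, by simp, by simp [h0, h1]⟩
      · have hw := wc_ne_zero hp
        refine ⟨wc p, hw, ?_⟩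
        rw [crInversion_coe hp]
        simp [zc_phi, wc_phi p hp, smul_smul, hw]

theorem extend_symm {n : ℕ} (e : Heis n ≃ Heis n) : (extend e)⁻¹ = extend e.symm :=
  Equiv.ext fun _ => rfl

/-- The inverse of the CR inversion is its composition with the rotation `z ↦ -z`. -/
theorem crInversion_inv (n : ℕ) :
    (crInversion n)⁻¹ = crInversion n * extend (rotation (-1)) := by
  have hneg : ∀ p : Heis n, rotation (-1) p = negZ p := fun p => by
    have h : ((-1 : unitaryGroup (Fin n) ℂ) : Matrix (Fin n) (Fin n) ℂ) = -1 := rfl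
    refine Prod.ext (funext fun i => ?_) (Prod.ext (funext fun i => ?_) rfl) <;>
    simp [rotation, linAct, negZ, zc, neg_mulVec, h]
  rw [inv_eq_iff_mul_eq_one]
  ext q : 1
  induction q using OnePoint.rec with
  | infty => simp
  | coe p =>
    by_cases hp : p = 0
    · subst hp
      have : negZ (0 : Heis n) = 0 := by simp [negZ]
      simp [hneg, this]
    · simp [hneg, crInversion_coe (negZ_ne hp),
        crInversion_coe (phi_ne (negZ_ne hp)), phi_phi (negZ_ne hp), negZ_negZ]

/-- CR maps act on `ℍⁿ ∪ {∞}`, which is a real quadric in complex projective space, by projective or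
conjugate projective transformations. -/
theorem hasLinearLift_of_mem {n : ℕ} {g : Equiv.Perm (OnePoint (Heis n))} (hg : g ∈ crGroup n) :
    HasLinearLift g := by
  refine Subgroup.closure_induction_left (p := fun g _ => HasLinearLift g) ?_ ?_ ?_ hg
  · exact ⟨LinearMap.id, fun c v hc => ⟨c, hc, rfl⟩, fun q => ⟨1, one_ne_zero, by simp⟩⟩
  · rintro x (((⟨a, rfl⟩ | ⟨l, hl, rfl⟩) | ⟨M, rfl⟩) | (rfl | rfl)) y _ hy
    · exact (hasLinearLift_translation a).mul hy
    · exact (hasLinearLift_dilation l hl).mul hy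
    · exact (hasLinearLift_rotation M).mul hy
    · exact (hasLinearLift_inversion n).mul hy
    · exact (hasLinearLift_crInversion n).mul hy
  · rintro x (((⟨a, rfl⟩ | ⟨l, hl, rfl⟩) | ⟨M, rfl⟩) | (rfl | rfl)) y _ hy
    · rw [extend_symm, show (translation a).symm = translation (-a) from Equiv.ext fun _ => rfl]
      exact (hasLinearLift_translation _).mul hy
    · rw [extend_symm, show (dilation (n := n) l hl).symm = dilation l⁻¹ (inv_pos.2 hl) from
        Equiv.ext fun _ => rfl]
      exact (hasLinearLift_dilation _ _).mul hy
    · rw [extend_symm, show (rotation M).symm = rotation (star M) from Equiv.ext fun _ => rfl]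
      exact (hasLinearLift_rotation _).mul hy
    · rw [extend_symm, show (inversion n).symm = inversion n from Equiv.ext fun _ => rfl]
      exact (hasLinearLift_inversion n).mul hy
    · rw [crInversion_inv]
      exact ((hasLinearLift_crInversion n).mul (hasLinearLift_rotation _)).mul hy

theorem coe_finitePart {n : ℕ} {g : Equiv.Perm (OnePoint (Heis n))} {p : Heis n}
    (h : g (p : OnePoint (Heis n)) ≠ OnePoint.infty) :
    ((finitePart g p : Heis n) : OnePoint (Heis n)) = g (p : OnePoint (Heis n)) := by
  obtain ⟨q, hq⟩ := OnePoint.ne_infty_iff_exists.1 h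
  simp [finitePart, ← hq]

theorem finitePart_eq {n : ℕ} {g : Equiv.Perm (OnePoint (Heis n))} {p q : Heis n}
    (h : g (p : OnePoint (Heis n)) = (q : OnePoint (Heis n))) : finitePart g p = q := by
  simp [finitePart, h]

/-- CR maps are smooth wherever they take finite values, and finiteness is an open condition. This
holds also at points where a factor of the map, written in generators, takes the value `∞`. Three
derivatives are needed for the Jacobian determinant to be `C²`. -/
theorem finitePart_smooth {n : ℕ} {g : Equiv.Perm (OnePoint (Heis n))} (hg : g ∈ crGroup n)
    {p : Heis n} (hp : g (p : OnePoint (Heis n)) ≠ OnePoint.infty) :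
    (∀ᶠ q : Heis n in 𝓝 p, g (q : OnePoint (Heis n)) ≠ OnePoint.infty) ∧
    ContDiffAt ℝ 3 (finitePart g) p := by
  obtain ⟨L, -, hL⟩ := hasLinearLift_of_mem hg
  have hl : ContDiff ℝ 3 fun q : Heis n => lift (q : OnePoint (Heis n)) := by
    simp only [lift_coe]
    have hz : ContDiff ℝ 3 (zc (n := n)) := contDiff_pi.2 fun i => by
      have h : (fun q : Heis n => zc q i) =
          fun q => (q.1 i : ℂ) + (q.2.1 i : ℂ) * Complex.I := by
        funext p; apply Complex.ext <;> simp [zc]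
      have h1 := Complex.ofRealCLM.contDiff (n := 3)
      rw [h]
      exact (h1.comp (by fun_prop)).add ((h1.comp (by fun_prop)).mul contDiff_const)
    exact contDiff_const.prodMk (hz.prodMk contDiff_wc)
  have hLl : ContDiff ℝ 3 fun q : Heis n => L (lift (q : OnePoint (Heis n))) :=
    (LinearMap.toContinuousLinearMap L).contDiff.comp hl
  have key : ∀ q : Heis n, (L (lift (q : OnePoint (Heis n)))).1 ≠ 0 ↔
      g (q : OnePoint (Heis n)) ≠ OnePoint.infty := fun q => by
    obtain ⟨c, hc, h⟩ := hL q
    rw [h]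
    induction g (q : OnePoint (Heis n)) using OnePoint.rec with
    | infty => simp
    | coe r => simp [hc]
  have hev : ∀ᶠ q : Heis n in 𝓝 p, (L (lift (q : OnePoint (Heis n)))).1 ≠ 0 :=
    (hLl.continuous.fst.continuousAt).eventually_ne ((key p).2 hp)
  refine ⟨by filter_upwards [hev] with q hq using (key q).1 hq, ?_⟩
  have heq : finitePart g =ᶠ[𝓝 p] fun q =>
      ((fun i => ((L (lift (q : OnePoint (Heis n)))).2.1 i *
          (L (lift (q : OnePoint (Heis n)))).1⁻¹).re,
        fun i => ((L (lift (q : OnePoint (Heis n)))).2.1 i *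
          (L (lift (q : OnePoint (Heis n)))).1⁻¹).im,
        ((L (lift (q : OnePoint (Heis n)))).2.2 *
          (L (lift (q : OnePoint (Heis n)))).1⁻¹).re) : Heis n) := by
    filter_upwards [hev] with q hq
    obtain ⟨c, hc, h⟩ := hL q
    obtain ⟨r, hr⟩ := OnePoint.ne_infty_iff_exists.1 ((key q).1 hq)
    rw [finitePart_eq hr.symm, h, ← hr]
    have e : ∀ x : ℂ, c * x * (c * 1)⁻¹ = x := fun x => by field_simp
    simp only [lift_coe, Prod.smul_fst, Prod.smul_snd, Pi.smul_apply, smul_eq_mul, e]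
    rfl
  refine ContDiffAt.congr_of_eventuallyEq ?_ heq
  have h1 : ContDiffAt ℝ 3 (fun q : Heis n => (L (lift (q : OnePoint (Heis n)))).1) p :=
    hLl.fst.contDiffAt
  have h2 : ∀ i, ContDiffAt ℝ 3 (fun q : Heis n => (L (lift (q : OnePoint (Heis n)))).2.1 i) p :=
    fun i => (contDiff_pi.1 hLl.snd.fst i).contDiffAt
  have h3 : ContDiffAt ℝ 3 (fun q : Heis n => (L (lift (q : OnePoint (Heis n)))).2.2) p :=
    hLl.snd.snd.contDiffAt
  have h0 := (key p).2 hp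
  exact (contDiffAt_pi.2 fun i => Complex.reCLM.contDiff.contDiffAt.comp p
    ((h2 i).mul (h1.inv h0))).prodMk
    ((contDiffAt_pi.2 fun i => Complex.imCLM.contDiff.contDiffAt.comp p
      ((h2 i).mul (h1.inv h0))).prodMk
        (Complex.reCLM.contDiff.contDiffAt.comp p (h3.mul (h1.inv h0))))

/-! ### The transform of functions under CR maps -/

theorem contDiff_det {n : ℕ} {k : WithTop ℕ∞} :
    ContDiff ℝ k fun A : Heis n →L[ℝ] Heis n => A.det := by
  have h : (fun A : Heis n →L[ℝ] Heis n => A.det) = fun A =>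
      (of fun i j => (coords n).symm (A (coords n (Pi.single j 1))) i).det := by
    funext A
    let b : Module.Basis (Idx n ⊕ Unit) ℝ (Heis n) := Module.Basis.ofEquivFun (coords n).symm
    change LinearMap.det (A : Heis n →ₗ[ℝ] Heis n) = _
    rw [← LinearMap.det_toMatrix b]
    congr 1
  rw [h]
  simp only [det_apply, of_apply]
  refine ContDiff.sum fun σ _ => (contDiff_prod fun i _ => ?_).const_smul _
  have hc : ContDiff ℝ k fun p : Heis n => (coords n).symm p :=
    (LinearMap.toContinuousLinearMap (coords n).symm.toLinearMap).contDiff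
  have happ : ContDiff ℝ k fun A : Heis n →L[ℝ] Heis n => A (coords n (Pi.single i 1)) :=
    contDiff_id.clm_apply contDiff_const
  exact contDiff_pi.1 (hc.comp happ) (σ i)

section Transform

variable {n : ℕ}

theorem transform_congr {ψ χ : Heis n → Heis n} {p : Heis n} (h : ψ =ᶠ[𝓝 p] χ)
    (u : Heis n → ℝ) : transform ψ u =ᶠ[𝓝 p] transform χ u := by
  filter_upwards [h, h.fderiv (𝕜 := ℝ)] with q hq hq'
  simp only [transform, hq, hq']

theorem finitePart_mul {g h : Equiv.Perm (OnePoint (Heis n))} {p : Heis n}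
    (hp : h (p : OnePoint (Heis n)) ≠ OnePoint.infty) :
    finitePart (g * h) p = finitePart g (finitePart h p) := by
  simp only [finitePart, Equiv.Perm.mul_apply]
  rw [← coe_finitePart hp]
  rfl

theorem coe_mul_ne {g h : Equiv.Perm (OnePoint (Heis n))} {p : Heis n}
    (hp : h (p : OnePoint (Heis n)) ≠ OnePoint.infty)
    (hgh : (g * h) (p : OnePoint (Heis n)) ≠ OnePoint.infty) :
    g (finitePart h p : OnePoint (Heis n)) ≠ OnePoint.infty := by
  rwa [coe_finitePart hp]

/-- Chain rule for the Jacobian determinant of a composition of CR maps. -/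
theorem det_fderiv_mul {g h : Equiv.Perm (OnePoint (Heis n))} (hg : g ∈ crGroup n)
    (hh : h ∈ crGroup n) {p : Heis n} (hp : h (p : OnePoint (Heis n)) ≠ OnePoint.infty)
    (hgh : (g * h) (p : OnePoint (Heis n)) ≠ OnePoint.infty) :
    (fderiv ℝ (finitePart (g * h)) p).det =
      (fderiv ℝ (finitePart g) (finitePart h p)).det * (fderiv ℝ (finitePart h) p).det := by
  obtain ⟨hev, hhs⟩ := finitePart_smooth hh hp
  have hgs := (finitePart_smooth hg (coe_mul_ne hp hgh)).2
  have he : finitePart (g * h) =ᶠ[𝓝 p] finitePart g ∘ finitePart h := by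
    filter_upwards [hev] with q hq using finitePart_mul hq
  rw [he.fderiv_eq, fderiv_comp p (hgs.differentiableAt (by norm_num))
    (hhs.differentiableAt (by norm_num))]
  exact LinearMap.det_comp _ _

theorem finitePart_one : finitePart (1 : Equiv.Perm (OnePoint (Heis n))) = id := by
  funext p; rfl

theorem det_fderiv_ne_zero {g : Equiv.Perm (OnePoint (Heis n))} (hg : g ∈ crGroup n)
    {p : Heis n} (hp : g (p : OnePoint (Heis n)) ≠ OnePoint.infty) :
    (fderiv ℝ (finitePart g) p).det ≠ 0 := by
  have h := det_fderiv_mul (inv_mem hg) hg hp (by simp)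
  rw [inv_mul_cancel, finitePart_one, fderiv_id] at h
  have h1 : (ContinuousLinearMap.id ℝ (Heis n)).det = 1 := LinearMap.det_id
  rw [h1] at h
  exact right_ne_zero_of_mul (h ▸ one_ne_zero)

theorem transform_one (u : Heis n → ℝ) :
    transform (finitePart (1 : Equiv.Perm (OnePoint (Heis n)))) u = u := by
  funext p
  have h1 : (ContinuousLinearMap.id ℝ (Heis n)).det = 1 := LinearMap.det_id
  rw [transform, finitePart_one, fderiv_id, h1]
  simp

/-- The action `u ↦ u_ψ` turns compositions around. -/
theorem transform_mul {g h : Equiv.Perm (OnePoint (Heis n))} (hg : g ∈ crGroup n)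
    (hh : h ∈ crGroup n) {p : Heis n} (hp : h (p : OnePoint (Heis n)) ≠ OnePoint.infty)
    (hgh : (g * h) (p : OnePoint (Heis n)) ≠ OnePoint.infty) (u : Heis n → ℝ) :
    transform (finitePart (g * h)) u =ᶠ[𝓝 p]
      transform (finitePart h) (transform (finitePart g) u) := by
  filter_upwards [(finitePart_smooth hh hp).1, (finitePart_smooth (mul_mem hg hh) hgh).1]
    with q hq hq'
  rw [transform, transform, transform, det_fderiv_mul hg hh hq hq', abs_mul,
    Real.mul_rpow (abs_nonneg _) (abs_nonneg _), finitePart_mul hq]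
  ring

theorem contDiffAt_transform {g : Equiv.Perm (OnePoint (Heis n))} (hg : g ∈ crGroup n)
    {p : Heis n} (hp : g (p : OnePoint (Heis n)) ≠ OnePoint.infty) {u : Heis n → ℝ}
    (hu : ContDiffAt ℝ 2 u (finitePart g p)) : ContDiffAt ℝ 2 (transform (finitePart g) u) p := by
  have hs := (finitePart_smooth hg hp).2
  have hdet : ContDiffAt ℝ 2 (fun q => (fderiv ℝ (finitePart g) q).det) p :=
    contDiff_det.contDiffAt.comp p (hs.fderiv_right (m := 2) (by norm_num))
  have h0 := det_fderiv_ne_zero hg hp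
  have habs : ContDiffAt ℝ 2 (fun q => |(fderiv ℝ (finitePart g) q).det|) p :=
    ContDiffAt.comp (g := fun x : ℝ => |x|) p (contDiffAt_abs h0) hdet
  exact (habs.rpow_const_of_ne (abs_ne_zero.2 h0)).mul
    (hu.comp p (hs.of_le (by norm_num)))

theorem transform_pos {g : Equiv.Perm (OnePoint (Heis n))} (hg : g ∈ crGroup n)
    {p : Heis n} (hp : g (p : OnePoint (Heis n)) ≠ OnePoint.infty) {u : Heis n → ℝ}
    (hu : 0 < u (finitePart g p)) : 0 < transform (finitePart g) u p :=
  mul_pos (Real.rpow_pos_of_pos (abs_pos.2 (det_fderiv_ne_zero hg hp)) _) hu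

end Transform

theorem continuousAt_tensorA {n : ℕ} {u : Heis n → ℝ} {p : Heis n} (hu : ContDiffAt ℝ 2 u p)
    (hp : 0 < u p) : ContinuousAt (tensorA u) p := by
  have hg : ∀ a, ContinuousAt (hderiv a u) p := fun a => (contDiffAt_hderiv hu a).continuousAt
  have hgrad : ContinuousAt (grad u) p := continuousAt_pi.2 hg
  have hhess : ContinuousAt (hess u) p := by
    refine continuousAt_pi.2 fun a => continuousAt_pi.2 fun b => ?_
    exact (((contDiffAt_hderiv hu a).fderiv_right (m := 0) (by norm_num)).clm_apply
      (contDiff_hfield b).contDiffAt).continuousAt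
  have hT : ContinuousAt (fun q => (hess u q)ᵀ) p :=
    (continuous_id.matrix_transpose (A := fun A : Mat n => A)).continuousAt.comp hhess
  have hsym : ContinuousAt (fun q => (1 / 2 : ℝ) • (hess u q + (hess u q)ᵀ)) p :=
    (hhess.add hT).const_smul (1 / 2 : ℝ)
  have hpow : ∀ r : ℝ, ContinuousAt (fun q => u q ^ r) p := fun r =>
    hu.continuousAt.rpow_const (Or.inl hp.ne')
  have hv : ∀ f : Heis n → Idx n → ℝ, ContinuousAt f p →
      ContinuousAt (fun q => vecMulVec (f q) (f q)) p := fun f hf =>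
    (continuous_id.matrix_vecMulVec continuous_id).continuousAt.comp hf
  have hJ : ContinuousAt (fun q => matJ n *ᵥ grad u q) p :=
    (continuous_const.matrix_mulVec continuous_id).continuousAt.comp hgrad
  have hsq : ContinuousAt (fun q => ∑ a, grad u q a ^ 2) p :=
    tendsto_finsetSum _ fun a _ => (hg a).pow 2
  exact ((((continuousAt_const.mul (hpow _)).smul hsym).add
    ((continuousAt_const.mul (hpow _)).smul (hv _ hgrad))).sub
    ((continuousAt_const.mul (hpow _)).smul (hv _ hJ))).sub
    (((continuousAt_const.mul (hpow _)).mul hsq).smul continuousAt_const)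

/-- A function of symmetric matrices takes the same value on the tensors of `u_g` and of `u`, at
corresponding points where `g` is finite. -/
def TensorInvariant {n : ℕ} (Φ : Mat n → ℝ) (g : Equiv.Perm (OnePoint (Heis n))) : Prop :=
  ∀ p : Heis n, g (p : OnePoint (Heis n)) ≠ OnePoint.infty → ∀ u : Heis n → ℝ,
    ContDiffAt ℝ 2 u (finitePart g p) → 0 < u (finitePart g p) →
      Φ (tensorA (transform (finitePart g) u) p) = Φ (tensorA u (finitePart g p))

theorem finitePart_extend {n : ℕ} (e : Heis n ≃ Heis n) : finitePart (extend e) = e := by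
  funext p; rfl

theorem finitePart_crInversion {n : ℕ} {p : Heis n} (hp : p ≠ 0) :
    finitePart (crInversion n) =ᶠ[𝓝 p] phi := by
  filter_upwards [eventually_ne_nhds hp] with q hq
  exact finitePart_eq (crInversion_coe hq)

theorem TensorInvariant.of_affine {n : ℕ} (hn : 1 ≤ n) {Φ : Mat n → ℝ} {e : Heis n ≃ Heis n}
    {κ μ ε : ℝ} {O : Mat n} (h : AffineContact e κ O μ) (hε : ε ^ 2 = 1)
    (hJ : O * matJ n = ε • (matJ n * O)) (hΦ : ∀ A : Mat n, A.IsSymm → Φ (Oᵀ * A * O) = Φ A) :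
    TensorInvariant Φ (extend e) := by
  intro p _ u hu hpos
  rw [finitePart_extend] at *
  rw [h.tensorA_transform hn hε hJ hu hpos, hΦ _ (tensorA_isSymm _ _)]

/-- Where both factors are finite this is the chain rule. At the one remaining point both sides are
continuous, so the identity extends to it. -/
theorem TensorInvariant.mul {n : ℕ} {Φ : Mat n → ℝ} (hΦ : ContinuousOn Φ {A | A.IsSymm})
    {g h : Equiv.Perm (OnePoint (Heis n))} (hgm : g ∈ crGroup n) (hhm : h ∈ crGroup n)
    (hg : TensorInvariant Φ g) (hh : TensorInvariant Φ h) : TensorInvariant Φ (g * h) := by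
  have regular : ∀ p : Heis n, h (p : OnePoint (Heis n)) ≠ OnePoint.infty →
      (g * h) (p : OnePoint (Heis n)) ≠ OnePoint.infty → ∀ u : Heis n → ℝ,
      ContDiffAt ℝ 2 u (finitePart (g * h) p) → 0 < u (finitePart (g * h) p) →
      Φ (tensorA (transform (finitePart (g * h)) u) p) =
        Φ (tensorA u (finitePart (g * h) p)) := by
    intro p hp hgp u hu hpos
    have hgp' := coe_mul_ne hp hgp
    rw [finitePart_mul hp] at hu hpos ⊢
    rw [tensorA_congr (transform_mul hgm hhm hp hgp u),
      hh p hp _ (contDiffAt_transform hgm hgp' hu) (transform_pos hgm hgp' hpos),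
      hg _ hgp' u hu hpos]
  intro p hgp u hu hpos
  by_cases hp : h (p : OnePoint (Heis n)) = OnePoint.infty
  swap
  · exact regular p hp hgp u hu hpos
  -- at the point mapped to `∞` by `h` the identity follows by continuity from nearby points
  obtain ⟨hev, hs⟩ := finitePart_smooth (mul_mem hgm hhm) hgp
  have hΦc : ∀ {f : Heis n → Mat n}, (∀ q, (f q).IsSymm) → ContinuousAt f p →
      ContinuousAt (fun q => Φ (f q)) p := fun {f} hf hc =>
    (hΦ (f p) (hf p)).tendsto.comp
      (tendsto_nhdsWithin_iff.2 ⟨hc, Filter.Eventually.of_forall hf⟩)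
  have h1 : ContinuousAt (fun q => Φ (tensorA (transform (finitePart (g * h)) u) q)) p :=
    hΦc (fun q => tensorA_isSymm _ q) (continuousAt_tensorA
      (contDiffAt_transform (mul_mem hgm hhm) hgp hu) (transform_pos (mul_mem hgm hhm) hgp hpos))
  have h2 : ContinuousAt (fun q => Φ (tensorA u (finitePart (g * h) q))) p :=
    hΦc (fun q => tensorA_isSymm _ _)
      (ContinuousAt.comp (g := tensorA u) (continuousAt_tensorA hu hpos) hs.continuousAt)
  have heq : ∀ᶠ q in 𝓝[≠] p, Φ (tensorA (transform (finitePart (g * h)) u) q) =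
      Φ (tensorA u (finitePart (g * h) q)) := by
    have hu' : ∀ᶠ q in 𝓝 p, ContDiffAt ℝ 2 u (finitePart (g * h) q) :=
      hs.continuousAt.eventually (hu.eventually (by simp))
    have hpos' : ∀ᶠ q in 𝓝 p, 0 < u (finitePart (g * h) q) :=
      (ContinuousAt.comp (g := u) hu.continuousAt hs.continuousAt).eventually (lt_mem_nhds hpos)
    filter_upwards [hev.filter_mono nhdsWithin_le_nhds, hu'.filter_mono nhdsWithin_le_nhds,
      hpos'.filter_mono nhdsWithin_le_nhds, self_mem_nhdsWithin] with q hq huq hposq hne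
    refine regular q (fun hq' => hne ?_) hq u huq hposq
    have := h.injective (hq'.trans hp.symm)
    exact OnePoint.coe_injective this
  have : (𝓝[≠] p).NeBot := Module.punctured_nhds_neBot ℝ (Heis n) p
  exact tendsto_nhds_unique_of_eventuallyEq (h1.tendsto.mono_left nhdsWithin_le_nhds)
    (h2.tendsto.mono_left nhdsWithin_le_nhds) heq

theorem TensorInvariant.inv {n : ℕ} {Φ : Mat n → ℝ} {g : Equiv.Perm (OnePoint (Heis n))}
    (hgm : g ∈ crGroup n) (hg : TensorInvariant Φ g) : TensorInvariant Φ g⁻¹ := by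
  intro p hp u hu hpos
  have h1 : g (finitePart g⁻¹ p : OnePoint (Heis n)) = (p : OnePoint (Heis n)) := by
    rw [coe_finitePart hp]; simp
  have h2 : finitePart g (finitePart g⁻¹ p) = p := finitePart_eq h1
  have h3 := hg (finitePart g⁻¹ p) (by rw [h1]; simp) (transform (finitePart g⁻¹) u)
  rw [h2] at h3
  have h4 := transform_mul (p := finitePart g⁻¹ p) (inv_mem hgm) hgm (by rw [h1]; simp)
    (by simp) u
  rw [inv_mul_cancel, transform_one] at h4
  rw [← h3 (contDiffAt_transform (inv_mem hgm) hp hu) (transform_pos (inv_mem hgm) hp hpos),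
    tensorA_congr h4]

/-- Invariance under the matrices of rotations and of the inversion implies invariance under all CR
maps. -/
theorem tensorInvariant_of_mem {n : ℕ} (hn : 1 ≤ n) {Φ : Mat n → ℝ}
    (hΦ : ContinuousOn Φ {A | A.IsSymm})
    (hrot : ∀ A : Mat n, A.IsSymm → ∀ M ∈ unitaryGroup (Fin n) ℂ,
      Φ ((realForm M)ᵀ * A * realForm M) = Φ A)
    (hG : ∀ A : Mat n, A.IsSymm → Φ (matG n * A * matG n) = Φ A)
    {g : Equiv.Perm (OnePoint (Heis n))} (hg : g ∈ crGroup n) : TensorInvariant Φ g := by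
  refine Subgroup.closure_induction (p := fun g _ => TensorInvariant Φ g) ?_ ?_ ?_ ?_ hg
  · rintro x (((⟨a, rfl⟩ | ⟨l, hl, rfl⟩) | ⟨M, rfl⟩) | (rfl | rfl))
    · exact .of_affine hn (ε := 1) (affineContact_translation a) (by simp) (by simp) (by simp)
    · exact .of_affine hn (ε := 1) (affineContact_dilation l hl) (by simp) (by simp) (by simp)
    · exact .of_affine hn (ε := 1) (affineContact_rotation M) (by simp)
        (by rw [one_smul, realForm_mul_matJ]) fun A hA => hrot A hA _ M.2
    · exact .of_affine hn (ε := -1) (affineContact_inversion n) (by simp)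
        (by rw [neg_one_smul, matG_mul_matJ]) fun A hA => by rw [matG_transpose, hG A hA]
    · intro p hp u hu hpos
      have hp0 : p ≠ 0 := fun h => hp (by rw [h, crInversion_zero])
      have he := finitePart_crInversion hp0
      rw [he.eq_of_nhds] at hu hpos ⊢
      rw [tensorA_congr (transform_congr he u), tensorA_transform_phi hn hp0 hu hpos,
        hrot _ (tensorA_isSymm _ _) _ (phiUnitary_mem hp0)]
  · intro p _ u _ _
    rw [transform_one]
    rfl
  · exact fun g h hgm hhm hg hh => hg.mul hΦ hgm hhm hh
  · exact fun g hgm hg => hg.inv hgm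

/-! ### Invariant operators -/

/-- Every germ of a positive `C²` function extends to a positive `C²` function on `ℍⁿ`. -/
theorem exists_global_extension {n : ℕ} {f : Heis n → ℝ} {p : Heis n} (hf : ContDiffAt ℝ 2 f p)
    (hp : 0 < f p) : ∃ v : Heis n → ℝ, ContDiff ℝ 2 v ∧ (∀ q, 0 < v q) ∧ v =ᶠ[𝓝 p] f := by
  have hev : ∀ᶠ q in 𝓝 p, ContDiffAt ℝ 2 f q ∧ 0 < f q :=
    (hf.eventually (by simp)).and (hf.continuousAt.eventually (lt_mem_nhds hp))
  obtain ⟨R, hR, hball⟩ := Metric.eventually_nhds_iff.1 hev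
  let χ : ContDiffBump p := ⟨R / 3, R / 2, by positivity, by linarith⟩
  refine ⟨fun q => χ q * f q + (1 - χ q), ?_, fun q => ?_, ?_⟩
  · refine contDiff_iff_contDiffAt.2 fun q => ?_
    by_cases hq : dist q p < R
    · exact (χ.contDiffAt.mul (hball hq).1).add (contDiffAt_const.sub χ.contDiffAt)
    · have h1 : ∀ᶠ r in 𝓝 q, R / 2 < dist r p :=
        (continuous_id.dist continuous_const).continuousAt.eventually
          (lt_mem_nhds (by simp only [id]; linarith))
      refine (contDiffAt_const (c := (1 : ℝ))).congr_of_eventuallyEq ?_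
      filter_upwards [h1] with r hr
      rw [χ.zero_of_le_dist hr.le]
      simp
  · by_cases hq : dist q p < R
    · have h1 := (hball hq).2
      have h2 := χ.nonneg (x := q)
      have h3 := χ.le_one (x := q)
      rcases h2.eq_or_lt with h | h
      · simp [← h]
      · have := mul_pos h h1
        linarith
    · have : χ q = 0 := χ.zero_of_le_dist (by change R / 2 ≤ _; linarith)
      simp [this]
  · filter_upwards [χ.eventuallyEq_one] with q hq
    simp [hq]

theorem tderiv_eq_of_hasDerivAt {n : ℕ} {u : Heis n → ℝ} {p : Heis n} {d : ℝ}
    (hu : DifferentiableAt ℝ u p)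
    (h : HasDerivAt (fun s : ℝ => u (p + s • (0, 0, 1))) d 0) : tderiv u p = d := by
  have hl : HasDerivAt (fun s : ℝ => p + s • ((0, 0, 1) : Heis n)) (0, 0, 1) 0 := by
    simpa using! ((hasDerivAt_id (0 : ℝ)).smul_const ((0, 0, 1) : Heis n)).const_add p
  exact (hu.hasFDerivAt.comp_hasDerivAt_of_eq (0 : ℝ) hl (by simp)).unique h

/-- Every element of `S ⊕ Jℝ` is the Hessian at `0` of a function with value `1` and gradient
`0`. -/
theorem exists_jet {n : ℕ} {S : Mat n} (hS : S.IsSymm) (c : ℝ) : ∃ u : Heis n → ℝ,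
    ContDiff ℝ 2 u ∧ u 0 = 1 ∧ grad u 0 = 0 ∧ hessSym u 0 = S ∧ tderiv u 0 = c := by
  let x : Heis n → Idx n → ℝ := fun q => Sum.elim q.1 q.2.1
  let u : Heis n → ℝ := fun q => 1 + 1 / 2 * ∑ a, ∑ b, x q a * S a b * x q b + c * q.2.2
  have hx : ∀ a, ContDiff ℝ 2 fun q => x q a := by
    rintro (i | i)
    · exact (contDiff_pi.1 contDiff_fst i)
    · exact (contDiff_pi.1 contDiff_snd.fst i)
  have hu : ContDiff ℝ 2 u := by
    refine ContDiff.add (contDiff_const.add (contDiff_const.mul ?_)) (by fun_prop)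
    exact ContDiff.sum fun a _ => ContDiff.sum fun b _ => ((hx a).mul contDiff_const).mul (hx b)
  have hline : ∀ v : Idx n → ℝ, (fun s => u (line 0 v s)) =
      fun s => 1 + 1 / 2 * (v ⬝ᵥ S *ᵥ v) * s ^ 2 := by
    intro v
    funext s
    have h1 : ∀ a, x (line 0 v s) a = s * v a := by
      rintro (i | i) <;> simp [x, line, hvec]
    have h2 : (line 0 v s).2.2 = 0 := by simp [line, hvec]
    simp only [u, h1, h2, dotProduct, mulVec, Finset.mul_sum, Finset.sum_mul, mul_zero, add_zero]
    congr 1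
    refine Finset.sum_congr rfl fun a _ => Finset.sum_congr rfl fun b _ => ?_
    ring
  have hid : ∀ s : ℝ, HasDerivAt (fun s : ℝ => s) 1 s := hasDerivAt_id
  have hd : ∀ (v : Idx n → ℝ) (s : ℝ), HasDerivAt (fun s => u (line 0 v s))
      ((v ⬝ᵥ S *ᵥ v) * s) s := fun v s => by
    rw [hline v]
    refine ((((hid s).pow 2).const_mul (1 / 2 * (v ⬝ᵥ S *ᵥ v))).const_add 1).congr_deriv ?_
    simp
    ring
  refine ⟨u, hu, by simp [u, x], eq_of_dot_eq fun v => ?_,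
    eq_of_quadratic_eq (hessSym_isSymm _ _) hS fun v => ?_, ?_⟩
  · rw [(hasDerivAt_comp_line hu.contDiffAt v).1.unique (hd v 0)]
    simp
  · have h1 := (hasDerivAt_comp_line (hu.contDiffAt (x := 0)) v).2
    rw [funext fun s => (hd v s).deriv] at h1
    rw [dot_hessSym, h1.unique ((hid 0).const_mul _), mul_one]
  · refine tderiv_eq_of_hasDerivAt (hu.differentiable (by norm_num) 0) ?_
    have h1 : (fun s : ℝ => u (0 + s • ((0, 0, 1) : Heis n))) = fun s => 1 + c * s := by
      funext s
      have hx0 : ∀ a, x (0 + s • ((0, 0, 1) : Heis n)) a = 0 := by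
        rintro (i | i) <;> simp [x]
      simp only [u, hx0]
      simp
    rw [h1]
    simpa using ((hid 0).const_mul c).const_add 1

/-- At a jet with value `1` and gradient `0` the tensor reduces to the Hessian. -/
theorem smul_tensorA_of_normalized {n : ℕ} (hn : 1 ≤ n) {u : Heis n → ℝ} {p : Heis n}
    (h1 : u p = 1) (h2 : grad u p = 0) :
    -((hdim n - 2) / 2) • tensorA u p = hessSym u p := by
  have hn0 : (n : ℝ) ≠ 0 := by positivity
  simp [tensorA, h1, h2, hdim_sub_two, smul_smul]
  rw [show (n : ℝ) * (2 / (2 * n)) = 1 by field_simp, one_smul]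

section Forward

variable {n : ℕ} {F : Heis n → ℝ → (Idx n → ℝ) → Mat n → ℝ}

/-- CR invariance for functions that are `C²` and positive near one point only. -/
theorem IsCRInvariant.eval_local (hF : IsCRInvariant F) {g : Equiv.Perm (OnePoint (Heis n))}
    (hg : g ∈ crGroup n) {p : Heis n} (hp : g (p : OnePoint (Heis n)) ≠ OnePoint.infty)
    {f : Heis n → ℝ} (hf : ContDiffAt ℝ 2 f (finitePart g p)) (hpos : 0 < f (finitePart g p)) :
    evalOp F (transform (finitePart g) f) p = evalOp F f (finitePart g p) := by
  obtain ⟨v, hv, hvpos, hev⟩ := exists_global_extension hf hpos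
  have h1 : transform (finitePart g) v =ᶠ[𝓝 p] transform (finitePart g) f := by
    filter_upwards [(finitePart_smooth hg hp).2.continuousAt.eventually hev] with q hq
    simp only [transform, hq]
  rw [← evalOp_congr F h1, hF v hv hvpos g hg p hp, evalOp_congr F hev]

theorem IsCRInvariant.eval_extend (hF : IsCRInvariant F) {e : Heis n ≃ Heis n}
    (he : extend e ∈ crGroup n) {p : Heis n} {f : Heis n → ℝ} (hf : ContDiffAt ℝ 2 f (e p))
    (hpos : 0 < f (e p)) : evalOp F (transform e f) p = evalOp F f (e p) :=
  hF.eval_local he (p := p) (by simp) hf hpos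

theorem IsCRInvariant.eval_phi (hF : IsCRInvariant F) {p : Heis n} (hp : p ≠ 0) {f : Heis n → ℝ}
    (hf : ContDiffAt ℝ 2 f (phi p)) (hpos : 0 < f (phi p)) :
    evalOp F (transform phi f) p = evalOp F f (phi p) := by
  have he := finitePart_crInversion hp
  have := hF.eval_local (g := crInversion n) (Subgroup.subset_closure (by simp)) (p := p)
    (by rw [crInversion_coe hp]; simp) (f := f) (by rwa [he.eq_of_nhds])
    (by rwa [he.eq_of_nhds])
  rwa [he.eq_of_nhds, evalOp_congr F (transform_congr he f)] at this

theorem translation_mem (a : Heis n) : extend (translation a) ∈ crGroup n :=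
  Subgroup.subset_closure (Or.inl (Or.inl (Or.inl ⟨a, rfl⟩)))

theorem dilation_mem (l : ℝ) (hl : 0 < l) :
    extend (dilation (n := n) l hl) ∈ crGroup n :=
  Subgroup.subset_closure (Or.inl (Or.inl (Or.inr ⟨l, hl, rfl⟩)))

theorem rotation_mem (M : unitaryGroup (Fin n) ℂ) :
    extend (rotation M) ∈ crGroup n :=
  Subgroup.subset_closure (Or.inl (Or.inr ⟨M, rfl⟩))

theorem inversion_mem : extend (inversion n) ∈ crGroup n :=
  Subgroup.subset_closure (by simp)

/-- Invariance under a linear isometric CR map, expressed at `(0, 1, 0)`. -/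
theorem IsCRInvariant.conj (hF : IsCRInvariant F) {e : Heis n ≃ Heis n}
    (he : extend e ∈ crGroup n) (h0 : e 0 = 0) {O : Mat n} {μ : ℝ}
    (h : AffineContact e 1 O μ) (hJ : Oᵀ * matJ n * O = μ • matJ n) {A : Mat n}
    (hA : A ∈ symJ n) : F 0 1 0 A = F 0 1 0 (Oᵀ * A * O) := by
  obtain ⟨S, c, hS, rfl⟩ := hA
  obtain ⟨u, hu, u0, ug, uh, ut⟩ := exists_jet hS (c / 2)
  have hue : ContDiffAt ℝ 2 u (e 0) := hu.contDiffAt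
  have hpos : 0 < u (e 0) := by rw [h0, u0]; exact one_pos
  have key := hF.eval_extend he (p := 0) hue hpos
  have e1 : transform e u 0 = 1 := by simp [h.transform_eq, h0, u0]
  have e2 : grad (transform e u) 0 = 0 := by rw [h.grad_transform hue, h0, ug]; simp
  have hmat : Oᵀ * (S + c • matJ n) * O = Oᵀ * S * O + (c * μ) • matJ n := by
    rw [Matrix.mul_add, Matrix.add_mul, Matrix.mul_smul, Matrix.smul_mul, hJ, smul_smul]
  have e3 : hess (transform e u) 0 = Oᵀ * (S + c • matJ n) * O := by
    rw [hmat, hess_eq_hessSym_add (h.contDiffAt_transform hue), h.hessSym_transform hue,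
      h.tderiv_transform hue, h0, uh, ut]
    simp only [one_pow, one_smul, one_mul]
    congr 2
    ring
  have e4 : hess u 0 = S + c • matJ n := by
    rw [hess_eq_hessSym_add hu.contDiffAt, uh, ut]
    congr 2
    ring
  rw [evalOp, evalOp, h0, e1, e2, e3, e4, u0, ug] at key
  exact key.symm

theorem IsCRInvariant.eq_rotation (hF : IsCRInvariant F) {A : Mat n} (hA : A ∈ symJ n)
    {M : Matrix (Fin n) (Fin n) ℂ} (hM : M ∈ unitaryGroup (Fin n) ℂ) :
    F 0 1 0 A = F 0 1 0 ((realForm M)ᵀ * A * realForm M) := by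
  refine hF.conj (rotation_mem ⟨M, hM⟩) ?_ (affineContact_rotation ⟨M, hM⟩) ?_ hA
  · have : zc (0 : Heis n) = 0 := rfl
    ext <;> simp [rotation, linAct, this]
  · rw [Matrix.mul_assoc, ← realForm_mul_matJ, ← Matrix.mul_assoc, realForm_transpose_mul hM,
      one_mul, one_smul]

theorem IsCRInvariant.eq_inversion (hF : IsCRInvariant F) {A : Mat n} (hA : A ∈ symJ n) :
    F 0 1 0 A = F 0 1 0 (matG n * A * matG n) := by
  have := hF.conj inversion_mem (by ext <;> simp [inversion])
    (affineContact_inversion n) (by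
      rw [matG_transpose, matG_mul_matJ, neg_mul, Matrix.mul_assoc, matG_mul_matG, mul_one,
        neg_one_smul]) hA
  rwa [matG_transpose] at this

end Forward

/-! ### Invariance under addition of multiples of `J` -/

section Forward

variable {n : ℕ} {F : Heis n → ℝ → (Idx n → ℝ) → Mat n → ℝ}

theorem grad_pot_transform_phi (hn : 1 ≤ n) {f : Heis n → ℝ} {p : Heis n} (hp : p ≠ 0)
    (hf : ContDiffAt ℝ 2 f (phi p)) (hpos : 0 < f (phi p)) (v : Idx n → ℝ) :
    grad (pot (transform phi f)) p ⬝ᵥ v =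
      ‖wc p‖ * (herm (cx (grad (pot f) (phi p))) (phiDeriv p (cx v))).re
      + pot f (phi p) * (grad (fun q => ‖wc q‖) p ⬝ᵥ v) := by
  have hpot := contDiffAt_pot hf hpos
  have h1 := (jet_mul (contDiffAt_norm_wc hp) (hpot.comp p (contDiffAt_phi hp))).1
  have h2 : grad (pot (transform phi f)) p = _ :=
    (grad_congr (pot_transform_phi hn hp hf hpos)).trans h1
  rw [h2, add_dotProduct, smul_dotProduct, smul_dotProduct, smul_eq_mul, smul_eq_mul,
    ← (jet_comp_phi hp hpot v).1]
  rfl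

theorem grad_eq_zero_of_pot (hn : 1 ≤ n) {f : Heis n → ℝ} {p : Heis n}
    (hf : ContDiffAt ℝ 2 f p) (hpos : 0 < f p) (h : grad (pot f) p = 0) : grad f p = 0 := by
  have hn0 : (n : ℝ) ≠ 0 := by positivity
  rw [(jet_pot hf hpos).1] at h
  refine (smul_eq_zero.1 h).resolve_left ?_
  have := (pot_pos hpos).ne'
  have := hpos.ne'
  simp [*]

theorem eq_one_of_pot (hn : 1 ≤ n) {f : Heis n → ℝ} {p : Heis n} (hpos : 0 < f p)
    (h : pot f p = 1) : f p = 1 := by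
  have hn0 : (n : ℝ) ≠ 0 := by positivity
  have h1 : f p = pot f p ^ (-(n : ℝ)) := by
    rw [pot, ← Real.rpow_mul hpos.le]
    field_simp
    rw [Real.rpow_one]
  rw [h1, h, Real.one_rpow]

theorem grad_pot_transform_affine (hn : 1 ≤ n) {e : Heis n ≃ Heis n} {κ μ : ℝ}
    (h : AffineContact e κ 1 μ) {f : Heis n → ℝ} {p : Heis n} (hf : ContDiffAt ℝ 2 f (e p))
    (hpos : 0 < f (e p)) : grad (pot (transform e f)) p = grad (pot f) (e p) := by
  have hκ := h.pos.ne'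
  have hp1 := (h.conformalContactAt p).pot_transform hn hpos
  rw [(jet_pot (h.contDiffAt_transform hf) (h.transform_pos hpos)).1, h.grad_transform hf,
    (jet_pot hf hpos).1, hp1, h.transform_eq]
  have := hpos.ne'
  simp only [transpose_smul, transpose_one, smul_mulVec, one_mulVec, smul_smul]
  congr 1
  field_simp

theorem tensorA_transform_affine (hn : 1 ≤ n) {e : Heis n ≃ Heis n} {κ μ : ℝ}
    (h : AffineContact e κ 1 μ) {f : Heis n → ℝ} {p : Heis n} (hf : ContDiffAt ℝ 2 f (e p))
    (hpos : 0 < f (e p)) : tensorA (transform e f) p = tensorA f (e p) := by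
  simpa using h.tensorA_transform hn (ε := 1) (by simp) (by simp) hf hpos

theorem wc_vertical (s : ℝ) : wc ((0, 0, s) : Heis n) = s := by
  apply Complex.ext <;> simp [wc, zsq]

theorem phi_vertical (s : ℝ) : phi ((0, 0, s) : Heis n) = (0, 0, -s⁻¹) := by
  apply heis_ext
  · rw [zc_phi]
    have : ∀ s : ℝ, zc ((0, 0, s) : Heis n) = 0 := fun s => by ext i; simp [zc]; rfl
    rw [this, this, smul_zero]
  · rw [phi_snd_snd, wc_vertical, ← Complex.ofReal_inv, Complex.ofReal_re]

/-- A vertical translation followed by the CR inversion, the vertical translation back to `0` and a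
dilation is a CR map that fixes `0`. It preserves the value `1` and the gradient `0` of a function
at `0` and rotates its symmetrized Hessian, but it changes the `∂_t` derivative: this adds a
multiple of `J` to the Hessian. -/
theorem IsCRInvariant.sub_matJ (hn : 1 ≤ n) (hF : IsCRInvariant F) {S : Mat n} (hS : S.IsSymm)
    (c : ℝ) {t : ℝ} (ht : 0 < t) :
    F 0 1 0 (S + (2 * c) • matJ n) = F 0 1 0 (S + (2 * (c - n / t)) • matJ n) := by
  obtain ⟨u, hu, u0, ug, uh, ut⟩ := exists_jet hS c
  set p : Heis n := (0, 0, t) with hp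
  have hp0 : p ≠ 0 := by
    intro h
    have := congrArg (fun q : Heis n => q.2.2) h
    exact ht.ne' this
  have hD := affineContact_dilation (n := n) t ht
  have hT := affineContact_translation (n := n) (0, 0, t⁻¹)
  have hT' := affineContact_translation p
  set D := dilation (n := n) t ht with hDdef
  set T := translation (n := n) (0, 0, t⁻¹) with hTdef
  set T' := translation p with hTdef'
  have D0 : D 0 = 0 := by ext <;> simp [hDdef, dilation]
  have T'v : ∀ s, T' (0, 0, s) = (0, 0, t + s) := fun s => by
    ext <;> simp [hTdef', translation, op, hp]
  have Tv : ∀ s, T (0, 0, s) = (0, 0, t⁻¹ + s) := fun s => by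
    ext <;> simp [hTdef, translation, op]
  have T'0 : T' 0 = p := by
    have := T'v 0
    rwa [add_zero] at this
  have Tq : T (phi p) = 0 := by rw [hp, phi_vertical, Tv]; ext <;> simp
  set f1 := transform D u with hf1
  set f2 := transform T f1 with hf2
  set f3 := transform phi f2 with hf3
  set f4 := transform T' f3 with hf4
  have c0 : ContDiffAt ℝ 2 u (D 0) := hu.contDiffAt
  have q0 : 0 < u (D 0) := by rw [D0, u0]; exact one_pos
  have c1 : ContDiffAt ℝ 2 f1 (T (phi p)) := by rw [Tq]; exact hD.contDiffAt_transform c0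
  have q1 : 0 < f1 (T (phi p)) := by rw [Tq]; exact hD.transform_pos q0
  have c2 : ContDiffAt ℝ 2 f2 (phi p) := hT.contDiffAt_transform c1
  have q2 : 0 < f2 (phi p) := hT.transform_pos q1
  have c3 : ContDiffAt ℝ 2 f3 (T' 0) := by rw [T'0]; exact contDiffAt_transform_phi hp0 c2
  have q3 : 0 < f3 (T' 0) := by rw [T'0]; exact transform_phi_pos hp0 q2
  have c4 : ContDiffAt ℝ 2 f4 0 := hT'.contDiffAt_transform c3
  have q4 : 0 < f4 0 := hT'.transform_pos q3
  -- On the `t`-axis the map is `s ↦ t² (t⁻¹ - (t + s)⁻¹)`, with conformal factor `t / (t + s)`.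
  have hval : ∀ s : ℝ, 0 < t + s → f4 (0, 0, s) =
      ((t + s)⁻¹ * t) ^ n * u (0, 0, t ^ 2 * (t⁻¹ - (t + s)⁻¹)) := by
    intro s hs
    have hne : ((0, 0, t + s) : Heis n) ≠ 0 := by
      intro h
      have := congrArg (fun q : Heis n => q.2.2) h
      exact hs.ne' this
    have hDv : ∀ r, D (0, 0, r) = (0, 0, t ^ 2 * r) := fun r => by
      ext <;> simp [hDdef, dilation]
    rw [hf4, (hT'.conformalContactAt _).transform_eq, T'v, hf3,
      (conformalContactAt_phi hne).transform_eq, phi_vertical, hf2,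
      (hT.conformalContactAt _).transform_eq, Tv, hf1, (hD.conformalContactAt _).transform_eq, hDv,
      wc_vertical, Complex.norm_real, Real.norm_of_nonneg hs.le, mul_pow]
    simp only [one_pow, one_mul, sub_eq_add_neg]
    ring
  have f40 : f4 0 = 1 := by
    have := hval 0 (by simpa using ht)
    rw [add_zero, sub_self, mul_zero, inv_mul_cancel₀ ht.ne', one_pow, one_mul] at this
    exact this.trans u0
  have g0 : grad (pot u) (D 0) = 0 := by
    rw [(jet_pot c0 q0).1, D0, ug, smul_zero]
  have g2 : grad (pot f2) (phi p) = 0 := by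
    rw [grad_pot_transform_affine hn hT c1 q1, Tq, grad_pot_transform_affine hn hD c0 q0, g0]
  have g4 : grad f4 0 = 0 := by
    refine grad_eq_zero_of_pot hn c4 q4 (eq_of_dot_eq fun v => ?_)
    have hz : zc p = 0 := by ext i; simp [hp, zc]; rfl
    rw [grad_pot_transform_affine hn hT' c3 q3, T'0, grad_pot_transform_phi hn hp0 c2 q2, g2,
      cx_grad_norm_wc hp0, hz, smul_zero]
    simp [herm, cx, rv]
  have hM := phiUnitary_mem hp0
  set M := phiUnitary p
  have h4 : hessSym f4 0 = (realForm M)ᵀ * S * realForm M := by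
    rw [← smul_tensorA_of_normalized hn f40 g4, tensorA_transform_affine hn hT' c3 q3, T'0,
      tensorA_transform_phi hn hp0 c2 q2, tensorA_transform_affine hn hT c1 q1, Tq,
      tensorA_transform_affine hn hD c0 q0, D0, ← uh, ← smul_tensorA_of_normalized hn u0 ug,
      Matrix.mul_smul, Matrix.smul_mul]
  -- The derivative of the map on the `t`-axis is `1` at `0`, so the change of the `∂_t` derivative
  -- comes from the `n`-th power of the conformal factor.
  have ht4 : tderiv f4 0 = c - n / t := by
    refine tderiv_eq_of_hasDerivAt (c4.differentiableAt (by norm_num)) ?_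
    have hid : HasDerivAt (fun s : ℝ => t + s) 1 0 := (hasDerivAt_id (0 : ℝ)).const_add t
    have hinv := hid.inv (by simpa using ht.ne')
    have hA := (hinv.mul_const t).pow n
    have hθ := (hinv.const_sub t⁻¹).const_mul (t ^ 2)
    have hγ : HasDerivAt (fun s : ℝ => ((0, 0, t ^ 2 * (t⁻¹ - (t + s)⁻¹)) : Heis n))
        (0, 0, 1) 0 := by
      refine (hasDerivAt_const _ _).prodMk ((hasDerivAt_const _ _).prodMk (hθ.congr_deriv ?_))
      field_simp
      simp
    have hB := (hu.differentiable (by norm_num) (0 : Heis n)).hasFDerivAt.comp_hasDerivAt_of_eq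
      (0 : ℝ) hγ (by ext <;> simp)
    refine ((hA.mul hB).congr_of_eventuallyEq ?_).congr_deriv ?_
    · have : ∀ᶠ s in 𝓝 (0 : ℝ), 0 < t + s :=
        hid.continuousAt.eventually (lt_mem_nhds (by simpa using ht))
      filter_upwards [this] with s hs
      have e : (0 : Heis n) + s • ((0, 0, 1) : Heis n) = (0, 0, s) := by ext <;> simp
      rw [e, hval s hs]
      rfl
    · have e : ((0, 0, t ^ 2 * (t⁻¹ - (t + 0)⁻¹)) : Heis n) = 0 := by ext <;> simp
      change _ * _ * _ * u (0, 0, t ^ 2 * (t⁻¹ - (t + 0)⁻¹)) + _ * tderiv u 0 = _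
      rw [e, u0, ut]
      simp only [Pi.pow_apply, Pi.inv_apply, add_zero, inv_mul_cancel₀ ht.ne',
        one_pow]
      field_simp
      ring
  have hev : evalOp F f4 0 = evalOp F u 0 := by
    rw [hF.eval_extend (translation_mem p) c3 q3, T'0, hF.eval_phi hp0 c2 q2,
      hF.eval_extend (translation_mem _) c1 q1, Tq, hF.eval_extend (dilation_mem t ht) c0 q0, D0]
  rw [evalOp, evalOp, f40, g4, u0, ug, hess_eq_hessSym_add c4, hess_eq_hessSym_add hu.contDiffAt,
    h4, ht4, uh, ut] at hev
  have hmat : (realForm M)ᵀ * (S + (2 * (c - n / t)) • matJ n) * realForm M =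
      (realForm M)ᵀ * S * realForm M + (2 * (c - n / t)) • matJ n := by
    rw [Matrix.mul_add, Matrix.add_mul, Matrix.mul_smul, Matrix.smul_mul,
      Matrix.mul_assoc _ (matJ n), ← realForm_mul_matJ, ← Matrix.mul_assoc _ _ (matJ n),
      realForm_transpose_mul hM, one_mul]
  rw [hF.eq_rotation (A := S + (2 * (c - n / t)) • matJ n) ⟨S, _, hS, rfl⟩ hM, hmat, hev]

/-- Every multiple of `J` arises as the change of the Hessian for a suitable height `t > 0`. -/
theorem IsCRInvariant.add_matJ (hn : 1 ≤ n) (hF : IsCRInvariant F) {A : Mat n}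
    (hA : A ∈ symJ n) (α : ℝ) : F 0 1 0 A = F 0 1 0 (A + α • matJ n) := by
  have hn0 : (0 : ℝ) < n := by exact_mod_cast hn
  have key : ∀ {S : Mat n} (_ : S.IsSymm) (c d : ℝ), d < c →
      F 0 1 0 (S + c • matJ n) = F 0 1 0 (S + d • matJ n) := by
    intro S hS c d hd
    have hcd : 0 < c - d := sub_pos.2 hd
    have h := hF.sub_matJ hn hS (c / 2) (t := 2 * n / (c - d)) (by positivity)
    have e1 : 2 * (c / 2) = c := by ring
    have e2 : 2 * (c / 2 - n / (2 * n / (c - d))) = d := by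
      field_simp
      ring
    rwa [e1, e2] at h
  obtain ⟨S, c, hS, rfl⟩ := hA
  rw [add_assoc, ← add_smul]
  rcases lt_trichotomy α 0 with h | rfl | h
  · exact key hS _ _ (by linarith)
  · rw [add_zero]
  · exact (key hS _ _ (by linarith)).symm

/-- The value of a CR invariant operator at a normalized jet at `0`. -/
theorem IsCRInvariant.eval_normalized (hn : 1 ≤ n) (hF : IsCRInvariant F) {f : Heis n → ℝ}
    (hf : ContDiffAt ℝ 2 f 0) (hpos : 0 < f 0) (h1 : pot f 0 = 1) (h2 : grad (pot f) 0 = 0) :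
    evalOp F f 0 = F 0 1 0 (-((hdim n - 2) / 2) • tensorA f 0) := by
  have f0 := eq_one_of_pot hn hpos h1
  have g0 := grad_eq_zero_of_pot hn hf hpos h2
  rw [smul_tensorA_of_normalized hn f0 g0, evalOp, f0, g0, hess_eq_hessSym_add hf,
    ← hF.add_matJ hn (mem_symJ_of_isSymm (hessSym_isSymm f 0))]

end Forward

/-! ### Normalization of jets by CR maps -/

section Forward

variable {n : ℕ} {F : Heis n → ℝ → (Idx n → ℝ) → Mat n → ℝ}

theorem translation_zero (a : Heis n) : translation a 0 = a := by
  ext <;> simp [translation, op]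

theorem translation_neg_self (a : Heis n) : translation (-a) a = 0 := by
  have := (translation a).symm_apply_apply 0
  rwa [translation_zero] at this

/-- For a prescribed value `v` and a prescribed gradient `a` of the potential at `φ(p)`, a point
`p` can be chosen at which the gradient of the transformed potential `|w| (v ∘ φ)` vanishes. -/
theorem exists_critical_phi {a : Idx n → ℝ} (ha : a ≠ 0) {v₀ : ℝ} (hv₀ : 0 < v₀) :
    ∃ p : Heis n, p ≠ 0 ∧ ∀ v : Idx n → ℝ,
      ‖wc p‖ * (herm (cx a) (phiDeriv p (cx v))).re
        + v₀ * (grad (fun q => ‖wc q‖) p ⬝ᵥ v) = 0 := by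
  -- The point has `t = 0`, and `z` is the imaginary multiple of `a` that balances the two terms.
  set k : ℂ := (((2 * v₀)⁻¹ : ℝ) : ℂ) * Complex.I with hk
  set p : Heis n := (fun i => (k * cx a i).re, fun i => (k * cx a i).im, 0) with hp
  have haa : 0 < a ⬝ᵥ a := by
    refine lt_of_le_of_ne (Finset.sum_nonneg fun i _ => mul_self_nonneg _) fun h => ha ?_
    exact dotProduct_self_eq_zero.1 h.symm
  have hz : zc p = k • cx a := rfl
  set N : ℝ := (2 * v₀)⁻¹ ^ 2 * (a ⬝ᵥ a) with hN
  have hN0 : 0 < N := by positivity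
  have hsq : zsq p = N := by
    have h : (zsq p : ℂ) = N := by
      rw [← herm_zc_self, hz, herm_smul_left, herm_smul_right, herm_self, hk, map_mul,
        Complex.conj_I, Complex.conj_ofReal, hN]
      push_cast
      linear_combination (-((2 * (v₀ : ℂ))⁻¹ ^ 2 * ((a ⬝ᵥ a : ℝ) : ℂ))) * Complex.I_sq
    exact_mod_cast h
  have hw : wc p = Complex.I * N := by
    apply Complex.ext
    · simp [wc, hp]
    · simp [wc, hsq]
  have hnorm : ‖wc p‖ = N := by
    rw [hw, norm_mul, Complex.norm_I, one_mul, Complex.norm_real, Real.norm_of_nonneg hN0.le]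
  have hp0 : p ≠ 0 := by
    intro h
    rw [h] at hsq
    simp [zsq] at hsq
    exact hN0.ne hsq
  have hNc : (N : ℂ) ≠ 0 := by exact_mod_cast hN0.ne'
  refine ⟨p, hp0, fun v => ?_⟩
  have h1 : herm (cx a) (phiDeriv p (cx v)) = Complex.I * herm (cx a) (cx v) * (N : ℂ)⁻¹ := by
    have hkk : conj k * k * ((a ⬝ᵥ a : ℝ) : ℂ) = N := by
      rw [← hsq, ← herm_zc_self, hz, herm_smul_left, herm_smul_right, herm_self, mul_assoc]
    rw [phiDeriv, herm_smul_right, herm_sub_right, herm_smul_right, hz, herm_smul_left,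
      herm_smul_right, herm_self, hw]
    have e : 2 * Complex.I * (conj k * herm (cx a) (cx v)) * (Complex.I * (N : ℂ))⁻¹ *
        (k * ((a ⬝ᵥ a : ℝ) : ℂ)) = 2 * Complex.I * herm (cx a) (cx v) * (Complex.I * (N : ℂ))⁻¹ *
        (conj k * k * ((a ⬝ᵥ a : ℝ) : ℂ)) := by ring
    rw [e, hkk]
    field_simp
    linear_combination (-herm (cx a) (cx v)) * Complex.I_sq
  have h2 : grad (fun q => ‖wc q‖) p = rv ((2 * k) • cx a) := by
    have e : ∀ l : ℂ, -2 * Complex.I * (Complex.I * N) * (N : ℂ)⁻¹ * l = 2 * l := fun l => by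
      field_simp
      linear_combination (-l) * Complex.I_sq
    rw [cx_grad_norm_wc hp0, hnorm, hw, hz, smul_smul, e]
  rw [h1, h2, hnorm, dot_eq_re_herm, cx_rv, herm_smul_left, ← Complex.re_ofReal_mul,
    ← Complex.re_ofReal_mul, ← Complex.add_re]
  have h3 : conj (2 * k) = -(v₀ : ℂ)⁻¹ * Complex.I := by
    rw [hk, map_mul, map_mul, Complex.conj_ofNat, Complex.conj_I, Complex.conj_ofReal]
    push_cast
    field_simp
  have hvc : (v₀ : ℂ) ≠ 0 := by exact_mod_cast hv₀.ne'
  rw [h3]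
  convert Complex.zero_re
  field_simp
  ring

/-- At a critical point, a translation and a dilation normalize the jet. -/
theorem IsCRInvariant.eval_critical (hn : 1 ≤ n) (hF : IsCRInvariant F) {u : Heis n → ℝ}
    {p : Heis n} (hu : ContDiffAt ℝ 2 u p) (hpos : 0 < u p) (hg : grad (pot u) p = 0) :
    evalOp F u p = F 0 1 0 (-((hdim n - 2) / 2) • tensorA u p) := by
  have hT := affineContact_translation p
  have hv := pot_pos hpos
  have hD := affineContact_dilation (n := n) _ hv
  have D0 : dilation (n := n) _ hv 0 = 0 := by ext <;> simp [dilation]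
  have T0 := translation_zero p
  have c0 : ContDiffAt ℝ 2 u (translation p 0) := by rwa [T0]
  have q0 : 0 < u (translation p 0) := by rwa [T0]
  set f₁ := transform (translation p) u
  have c1 : ContDiffAt ℝ 2 f₁ (dilation _ hv 0) := by rw [D0]; exact hT.contDiffAt_transform c0
  have q1 : 0 < f₁ (dilation _ hv 0) := by rw [D0]; exact hT.transform_pos q0
  have hval : pot (transform (dilation _ hv) f₁) 0 = 1 := by
    rw [(hD.conformalContactAt 0).pot_transform hn q1, D0,
      (hT.conformalContactAt 0).pot_transform hn q0, T0, inv_one, one_mul, inv_mul_cancel₀ hv.ne']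
  have hgrad : grad (pot (transform (dilation _ hv) f₁)) 0 = 0 := by
    rw [grad_pot_transform_affine hn hD c1 q1, D0, grad_pot_transform_affine hn hT c0 q0, T0, hg]
  have key := hF.eval_normalized hn (hD.contDiffAt_transform c1) (hD.transform_pos q1) hval hgrad
  rwa [hF.eval_extend (dilation_mem _ hv) c1 q1, D0, hF.eval_extend (translation_mem p) c0 q0, T0,
    tensorA_transform_affine hn hD c1 q1, D0, tensorA_transform_affine hn hT c0 q0, T0] at key

/-- An invariant operator depends on the jet only through the tensor: a CR inversion makes the
gradient vanish, and the rotation that it contributes is removed by invariance. -/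
theorem IsCRInvariant.eval_eq (hn : 1 ≤ n) (hF : IsCRInvariant F) {u : Heis n → ℝ}
    {p : Heis n} (hu : ContDiffAt ℝ 2 u p) (hpos : 0 < u p) :
    evalOp F u p = F 0 1 0 (-((hdim n - 2) / 2) • tensorA u p) := by
  by_cases hg : grad (pot u) p = 0
  · exact hF.eval_critical hn hu hpos hg
  obtain ⟨c, hc, hcrit⟩ := exists_critical_phi hg (pot_pos hpos)
  have hT := affineContact_translation p
  have hT' := affineContact_translation (-phi c)
  have T0 := translation_zero p
  have Tc := translation_neg_self (phi c)
  have c0 : ContDiffAt ℝ 2 u (translation p 0) := by rwa [T0]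
  have q0 : 0 < u (translation p 0) := by rwa [T0]
  set f₁ := transform (translation p) u
  have c1 : ContDiffAt ℝ 2 f₁ (translation (-phi c) (phi c)) := by
    rw [Tc]; exact hT.contDiffAt_transform c0
  have q1 : 0 < f₁ (translation (-phi c) (phi c)) := by rw [Tc]; exact hT.transform_pos q0
  set f₂ := transform (translation (-phi c)) f₁
  have c2 : ContDiffAt ℝ 2 f₂ (phi c) := hT'.contDiffAt_transform c1
  have q2 : 0 < f₂ (phi c) := hT'.transform_pos q1
  have hval : pot f₂ (phi c) = pot u p := by
    rw [(hT'.conformalContactAt _).pot_transform hn q1, Tc,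
      (hT.conformalContactAt 0).pot_transform hn q0, T0, inv_one, one_mul, one_mul]
  have hgrad : grad (pot f₂) (phi c) = grad (pot u) p := by
    rw [grad_pot_transform_affine hn hT' c1 q1, Tc, grad_pot_transform_affine hn hT c0 q0, T0]
  have hten : tensorA f₂ (phi c) = tensorA u p := by
    rw [tensorA_transform_affine hn hT' c1 q1, Tc, tensorA_transform_affine hn hT c0 q0, T0]
  have hev : evalOp F f₂ (phi c) = evalOp F u p := by
    rw [hF.eval_extend (translation_mem _) c1 q1, Tc, hF.eval_extend (translation_mem p) c0 q0, T0]
  have key := hF.eval_critical hn (contDiffAt_transform_phi hc c2) (transform_phi_pos hc q2)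
    (eq_of_dot_eq fun v => by
      rw [grad_pot_transform_phi hn hc c2 q2, hgrad, hval, hcrit, zero_dotProduct])
  rw [hF.eval_phi hc c2 q2, hev, tensorA_transform_phi hn hc c2 q2, hten] at key
  rw [key, hF.eq_rotation (mem_symJ_of_isSymm ((tensorA_isSymm u p).smul _)) (phiUnitary_mem hc),
    Matrix.mul_smul, Matrix.smul_mul]

end Forward

/-- An operator that is a continuous function of the tensor, with the matrix invariances, is CR
invariant. -/
theorem isCRInvariant_of_tensorA {n : ℕ} (hn : 1 ≤ n)
    {F : Heis n → ℝ → (Idx n → ℝ) → Mat n → ℝ} {Φ : Mat n → ℝ}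
    (hΦ : ContinuousOn Φ {A | A.IsSymm})
    (hrot : ∀ A : Mat n, A.IsSymm → ∀ M ∈ unitaryGroup (Fin n) ℂ,
      Φ ((realForm M)ᵀ * A * realForm M) = Φ A)
    (hG : ∀ A : Mat n, A.IsSymm → Φ (matG n * A * matG n) = Φ A)
    (hF : ∀ u : Heis n → ℝ, ContDiff ℝ 2 u → (∀ p, 0 < u p) → ∀ p,
      evalOp F u p = Φ (tensorA u p)) : IsCRInvariant F := by
  intro u hu hpos g hg p hp
  obtain ⟨v, hv, hvpos, hev⟩ := exists_global_extension
    (contDiffAt_transform hg hp hu.contDiffAt) (transform_pos hg hp (hpos _))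
  rw [← evalOp_congr F hev, hF v hv hvpos, tensorA_congr hev,
    tensorInvariant_of_mem hn hΦ hrot hG hg p hp u hu.contDiffAt (hpos _), hF u hu hpos]

end HeisenbergCR

theorem theorem1p3 (n : ℕ) (hn : 1 ≤ n)
    (F : HeisenbergCR.Heis n → ℝ → (HeisenbergCR.Idx n → ℝ) → HeisenbergCR.Mat n → ℝ)
    (hF : ContinuousOn (fun q : HeisenbergCR.Heis n × ℝ × (HeisenbergCR.Idx n → ℝ) ×
        HeisenbergCR.Mat n => F q.1 q.2.1 q.2.2.1 q.2.2.2) (HeisenbergCR.opDomain n)) :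
    HeisenbergCR.IsCRInvariant F ↔
      (∀ u : HeisenbergCR.Heis n → ℝ, ContDiff ℝ 2 u → (∀ p, 0 < u p) → ∀ p,
        HeisenbergCR.evalOp F u p =
          F 0 1 0 (-((HeisenbergCR.hdim n - 2) / 2) • HeisenbergCR.tensorA u p)) ∧
      (∀ A ∈ HeisenbergCR.symJ n, ∀ M ∈ Matrix.unitaryGroup (Fin n) ℂ,
        F 0 1 0 A =
          F 0 1 0 ((HeisenbergCR.realForm M).transpose * A * HeisenbergCR.realForm M)) ∧
      (∀ A ∈ HeisenbergCR.symJ n,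
        F 0 1 0 A = F 0 1 0 (HeisenbergCR.matG n * A * HeisenbergCR.matG n)) ∧
      (∀ A ∈ HeisenbergCR.symJ n, ∀ α : ℝ,
        F 0 1 0 A = F 0 1 0 (A + α • HeisenbergCR.matJ n)) := by
  constructor
  · intro h
    exact ⟨fun u hu hpos p => h.eval_eq hn hu.contDiffAt (hpos p),
      fun A hA M hM => h.eq_rotation hA hM, fun A hA => h.eq_inversion hA,
      fun A hA α => h.add_matJ hn hA α⟩
  · rintro ⟨hform, hrot, hG, -⟩
    set k : ℝ := -((HeisenbergCR.hdim n - 2) / 2)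
    have hmem : ∀ A : HeisenbergCR.Mat n, A.IsSymm → k • A ∈ HeisenbergCR.symJ n := fun A hA =>
      HeisenbergCR.mem_symJ_of_isSymm (hA.smul k)
    refine HeisenbergCR.isCRInvariant_of_tensorA hn (Φ := fun A => F 0 1 0 (k • A)) ?_
      (fun A hA M hM => ?_) (fun A hA => ?_) hform
    · exact hF.comp (f := fun A => (0, 1, 0, k • A)) (by fun_prop)
        fun A hA => ⟨one_pos, hmem A hA⟩
    · rw [hrot _ (hmem A hA) M hM, Matrix.mul_smul, Matrix.smul_mul]
    · rw [hG _ (hmem A hA), Matrix.mul_smul, Matrix.smul_mul]
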